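/- **Setting.** Let $N\ge 2$, $n\ge 1$, $\omega=e^{2\pi i/N}$, $\epsilon=(-1)^N$. On $(\mathbb C^N)^{\otimes n}$ with basis $|\gamma_1\rangle\otimes\cdots\otimes|\gamma_n\rangle$, $\gamma_k\in\mathbb Z_N$, let $u_k|\gamma_k\rangle=\omega^{\gamma_k}|\gamma_k\rangle$, $v_k|\gamma_k\rangle=|\gamma_k+1\rangle$ (acting at site $k$). Given non-zero complex numbers $\kappa_k,a_k,b_k,c_k,d_k$ ($1\le k\le n$), $a_0$, $c_{n+1}$ and boundary spins $\gamma_0,\gamma_{n+1}\in\mathbb Z_N$, put $$L_k(\lambda)=\begin{pmatrix}1+\lambda\kappa_kv_k&\lambda u_k^{-1}(a_k-b_kv_k)\\u_k(c_k-d_kv_k)&\lambda a_kc_k+v_kb_kd_k/\kappa_k\end{pmatrix},\qquad \mathbf t^{B}(\lambda)=(1,\ \lambda\omega^{-\gamma_0}a_0)\,L_1(\lambda)\cdots L_n(\lambda)\begin{pmatrix}1\\ \omega^{\gamma_{n+1}}c_{n+1}\end{pmatrix}.$$ For $z=\lambda^N$ let $$\mathcal L_k(z)=\begin{pmatrix}1-\epsilon\kappa_k^Nz&-\epsilon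 z(a_k^N-b_k^N)\\c_k^N-d_k^N&b_k^Nd_k^N/\kappa_k^N-\epsilon za_k^Nc_k^N\end{pmatrix}\ (k\le n),\qquad \mathcal L_{n+1}(z)=\begin{pmatrix}1&-\epsilon za_0^N\\c_{n+1}^N&-\epsilon za_0^Nc_{n+1}^N\end{pmatrix},$$ $$\mathcal T_m=\mathcal L_1\cdots\mathcal L_m=\begin{pmatrix}\mathcal A_m&\mathcal B_m\\\mathcal C_m&\mathcal D_m\end{pmatrix}.$$ **Amplitudes.** Let $r_k$ ($k\le n$) satisfy $r_k^N=a_k^N-b_k^N\neq0$, let $r_{n+1}=a_0$, and let $r_{m,s}\ne0$ ($1\le m\le n+1$, $0\le s\le m-1$) satisfy $r_{1,0}=r_1$, $$\mathcal B_m(z)=(-\epsilon)^mz\,r_{m,0}^N\prod_{s=1}^{m-1}(z-\epsilon r_{m,s}^N),\qquad \tilde r_{n+1}=\omega a_0,\qquad\text{where } \tilde r_m=\prod_{s=0}^{m-1}r_{m,s}.$$ Assume that, for each $m\le n+1$, the numbers $r_{m,s}^N$, $1\le s\le m-1$, are pairwise different and $\det\mathcal T_n(\epsilon r_{m,s}^N)\ne0$.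 Let $s_1,\dots,s_{n+1}$ satisfy $$\prod_{j=1}^{n+1}s_j^{-1}=a_0c_{n+1}\prod_{m=1}^na_mc_m,\qquad \prod_{j=1}^{n+1}\Bigl(1-(-1)^N\frac{\lambda^N}{s_j^N}\Bigr)=\mathcal A_{n+1}(\lambda^N)+\mathcal D_{n+1}(\lambda^N).$$ **Points on the Fermat curve.** For $p=(x,y)$ with $x^N+y^N=1$, $y\neq 0$, let $w_p$ be the function on $\mathbb Z_N$ with $w_p(0)=1$, $w_p(\gamma)/w_p(\gamma-1)=y/(1-\omega^\gamma x)$. Points with fixed coordinates are $$p_k=\Bigl(\frac{r_k}{a_k},\frac{b_k}{a_k}\Bigr)\ (1\le k\le n),\qquad p_{m,0}=\Bigl(\frac{r_{m-1,0}a_mc_m}{r_{m,0}},\frac{\kappa_1\cdots\kappa_{m-1}r_m}{r_{m,0}}\Bigr)\ (2\le m\le n+1,\ a_{n+1}\text{ read as }a_0),$$ $$\tilde p_m=\Bigl(\frac{r_m}{\tilde r_m},\frac{b_md_m\tilde r_{m-1}}{\kappa_m\tilde r_m}\Bigr)\ (2\le m\le n).$$ Points with given $x$, and $y$ to be chosen,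 are $p^{m,s}_{m',s'}$ ($s,s'\ge1$; $m'=m$ and $s\neq s'$, or $m'=m-1$), $p_{m,s}$, $\tilde p_{m,s}$ ($1\le s<m\le n$), and, for $1\le m,k\le n$, $1\le j\le n+1$, $p^{BB}_{j,k}$, $p^B_{m,k}$, $\tilde p^B_{m,k}$, with $$x^{m,s}_{m',s'}=\frac{r_{m,s}}{r_{m',s'}},\quad x_{m,s}=\frac{a_m\kappa_mr_{m,s}}{b_m},\quad\tilde x_{m,s}=\frac{d_m}{\kappa_mc_mr_{m,s}},\quad x^{BB}_{j,k}=\frac{r_{n+1,k}}{s_j},\quad x^B_{m,k}=\frac{b_m}{a_m\kappa_mr_{n+1,k}},\quad\tilde x^B_{m,k}=\frac{r_{n+1,k}c_m\kappa_m}{d_m}.$$ An *admissible choice* consists of $y$-coordinates for these points such that all points lie on $x^N+y^N=1$ and, for $2\le m\le n$, $1\le l\le m-1$, and for $1\le k\le n$ respectively, $$\frac{\tilde r_m\,r_{m+1,0}\,r_m}{\tilde r_{m-1}\,r_{m,0}\,r_{m+1}\,b_mc_m\,y_{m,l}\,\tilde y_{m,l}}\prod_{i\ne l}\frac{y^{m,l}_{m,i}}{y^{m,i}_{m,l}}\cdot\frac{\prod_{k=1}^my^{m+1,k}_{m,l}}{\prod_{i=1}^{m-2}y^{m,l}_{m-1,i}}=1,\qquad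 \prod_{m=1}^n\omega a_md_m\,y^B_{m,k}\,\tilde y^B_{m,k}=\chi_k\prod_{j=1}^{n+1}y^{BB}_{j,k},$$ $$\chi_k=\frac{r_{n+1,0}\,\tilde r_n}{a_0\,\tilde r_{n+1}}\prod_{m\ne k}\frac{y^{n+1,m}_{n+1,k}}{y^{n+1,k}_{n+1,m}}\prod_{m=1}^{n-1}y^{n+1,k}_{n,m}.$$ **Auxiliary vectors.** For $\rho_m=(\rho_{m,0},\dots,\rho_{m,m-1})\in\mathbb Z_N^m$ put $\tilde\rho_m=\sum_{k\ge0}\rho_{m,k}$, $\tilde\rho'_m=\sum_{k\ge1}\rho_{m,k}$. Let $\psi^{(k)}_\rho=\sum_\gamma w_{p_k}(\gamma-\rho)|\gamma\rangle$, $\Psi_{\rho_1}=\psi^{(1)}_{\rho_{1,0}}$ and, for $2\le m\le n$, $$\Psi_{\rho_m}=\sum_{\rho_{m-1},\,t}\frac{\omega^{(\tilde\rho_m-\tilde\rho_{m-1})(t-\rho_{m,0})}}{w_{p_{m,0}}(\rho_{m,0}-\rho_{m-1,0}-1)\,w_{\tilde p_m}(\tilde\rho_m-t-1)}\,G_m\;\Psi_{\rho_{m-1}}\otimes\psi^{(m)}_t,$$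 $$G_m=\frac{\prod_{l=1}^{m-2}\prod_{k=1}^{m-1}w_{p^{m,k}_{m-1,l}}(\rho_{m-1,l}-\rho_{m,k})}{\prod_{j\ne l}w_{p^{m-1,l}_{m-1,j}}(\rho_{m-1,j}-\rho_{m-1,l})}\prod_{l=1}^{m-2}\frac{w_{p_{m-1,l}}(-\rho_{m-1,l})}{w_{\tilde p_{m-1,l}}(\rho_{m-1,l})},$$ and, for $\rho'_{n+1}=(\rho_{n+1,1},\dots,\rho_{n+1,n})\in\mathbb Z_N^n$, $$\Psi^B_{\rho'_{n+1}}=\sum_{\rho_n}\frac{\omega^{(\gamma_0+1-\tilde\rho_n)(\tilde\rho'_{n+1}-1)}}{w_{p_{n+1,0}}(\gamma_{n+1}-\tilde\rho'_{n+1}-\rho_{n,0})}\,G_{n+1}\,\Psi_{\rho_n}.$$ **Statement.** Admissible choices exist. For every admissible choice and every $\sigma\in\mathbb Z_N^{n+1}$ with $\sum_j\sigma_j=\gamma_{n+1}-\gamma_0$ in $\mathbb Z_N$, set $$t^B(\lambda|\sigma)=\prod_{j=1}^{n+1}\Bigl(\frac{\lambda}{s_j\omega^{-\sigma_j}}+1\Bigr),\qquad\tilde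 q_k(\rho)=\prod_{j=1}^{n+1}w_{p^{BB}_{j,k}}(\sigma_j-\rho)\prod_{m=1}^n\frac{w_{p^B_{m,k}}(\rho-1)}{w_{\tilde p^B_{m,k}}(-\rho-1)},$$ $$Q^B(\rho'_{n+1}|\sigma)=\frac{\prod_{k=1}^n\tilde q_k(\rho_{n+1,k})}{\prod_{m\ne m'}w_{p^{n+1,m'}_{n+1,m}}(\rho_{n+1,m}-\rho_{n+1,m'})},\qquad\Phi_\sigma=\sum_{\rho'_{n+1}}Q^B(\rho'_{n+1}|\sigma)\,\Psi^B_{\rho'_{n+1}}.$$ Let $F_m(\lambda)=(b_m+\omega a_m\kappa_m\lambda)(\lambda c_m+d_m/\kappa_m)$ for $m\le n$, $F_{n+1}=0$ (the boundary site has $\kappa_{n+1}=b_{n+1}=d_{n+1}=b_{n+1}d_{n+1}/\kappa_{n+1}=0$), $\Delta_k^+(\lambda)=\chi_k^{-1}(\lambda/\omega)^{-n}\prod_{m=1}^nF_m(\lambda/\omega)$, $\Delta_k^-(\lambda)=\chi_k(\lambda/\omega)^nF_{n+1}(\lambda/\omega)$. Then: 1. $\Delta^-_k=0$, and $\tilde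 q_k$ solves the Baxter equations: for $1\le k\le n$, $\rho\in\mathbb Z_N$ and $\lambda_k=-r_{n+1,k}\omega^{-\rho}$, $$t^B(\lambda_k|\sigma)\,\tilde q_k(\rho)=\Delta^+_k(\lambda_k)\,\tilde q_k(\rho+1)+\Delta^-_k(\omega\lambda_k)\,\tilde q_k(\rho-1).$$ 2. $\Phi_\sigma\neq0$ and $\mathbf t^B(\lambda)\Phi_\sigma=t^B(\lambda|\sigma)\,\Phi_\sigma$ for all $\lambda\in\mathbb C$; that is, every $\sigma$ in Baxter's conjectured spectrum has an eigenvector. -/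

import Mathlib

namespace BBS

noncomputable section

/-- `ω ^ g` for `g ∈ ℤ/N`, where `ω = exp (2 π i / N)`. -/
def omegaPow {N : ℕ} [NeZero N] (g : ZMod N) : ℂ := ZMod.stdAddChar g

/-- The primitive root of unity `ω = exp (2 π i / N)`. -/
def omega (N : ℕ) [NeZero N] : ℂ := omegaPow (1 : ZMod N)

theorem omega_eq (N : ℕ) [NeZero N] :
    omega N = Complex.exp (2 * Real.pi * Complex.I / N) := by
  have h := ZMod.stdAddChar_coe (N := N) 1
  simpa [omega, omegaPow] using h

/-- The sign `ε = (-1) ^ N`. -/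
def eps (N : ℕ) : ℂ := (-1) ^ N

/-- The cyclic function `w_p`, `p = (x, y)`: the solution of
`w_p γ / w_p (γ - 1) = y / (1 - ω ^ γ x)`, `w_p 0 = 1`, written out on the
representatives `0, …, N - 1`. It satisfies the equation on all of `ℤ/N` when `x ^ N + y ^ N = 1`
and `y ≠ 0`. -/
def w {N : ℕ} [NeZero N] (x y : ℂ) (g : ZMod N) : ℂ :=
  ∏ j ∈ Finset.Icc 1 g.val, y / (1 - omega N ^ j * x)

/-- The five parameters of a cyclic `L`-operator. -/
structure Site where
  kap : ℂ
  a : ℂ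
  b : ℂ
  c : ℂ
  d : ℂ

/-- The parameters of the model: the sites `1, …, n` (other values of `bulk` are not used),
the boundary parameters `a₀`, `c_{n+1}`, and the boundary spins `γ_0`, `γ_{n+1}`. -/
structure Model (N n : ℕ) where
  bulk : ℕ → Site
  a0 : ℂ
  cEnd : ℂ
  g0 : ZMod N
  gEnd : ZMod N

/-! ### The transfer matrix -/

/-- The quantum space of `n` spins: the value of a state at `γ` is its coordinate at the basis
vector `|γ_1⟩ ⊗ ⋯ ⊗ |γ_n⟩`; the spin of site `k` has index `k - 1`. -/
abbrev State (N n : ℕ) := (Fin n → ZMod N) → ℂ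

/-- The diagonal operator `|γ⟩ ↦ ω ^ (e γ_k) |γ⟩` at one site: `u_k` for `e = 1`,
`u_k⁻¹` for `e = -1`. -/
def uPow {N n : ℕ} [NeZero N] (e : ZMod N) (k : Fin n) : Module.End ℂ (State N n) where
  toFun f := fun γ => omegaPow (e * γ k) * f γ
  map_add' f g := by
    funext γ
    simp [mul_add]
  map_smul' t f := by
    funext γ
    simp [mul_left_comm]

/-- The shift operator `v_k |γ_k⟩ = |γ_k + 1⟩`. -/
def vOp {N n : ℕ} (k : Fin n) : Module.End ℂ (State N n) where
  toFun f := fun γ => f (Function.update γ k (γ k - 1))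
  map_add' _ _ := rfl
  map_smul' _ _ := rfl

/-- The cyclic `L`-operator with parameters `S`, acting at the site of index `k`. -/
def LOp {N n : ℕ} [NeZero N] (S : Site) (k : Fin n) (lam : ℂ) :
    Matrix (Fin 2) (Fin 2) (Module.End ℂ (State N n)) :=
  !![1 + (lam * S.kap) • vOp k,
      lam • (uPow (-1) k * (S.a • (1 : Module.End ℂ (State N n)) - S.b • vOp k));
    uPow 1 k * (S.c • (1 : Module.End ℂ (State N n)) - S.d • vOp k),
      (lam * S.a * S.c) • (1 : Module.End ℂ (State N n)) + (S.b * S.d / S.kap) • vOp k]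

variable {N n : ℕ} [NeZero N]

/-- The monodromy matrix `L_1(λ) L_2(λ) ⋯ L_n(λ)`. -/
def Model.monodromy (M : Model N n) (lam : ℂ) :
    Matrix (Fin 2) (Fin 2) (Module.End ℂ (State N n)) :=
  (List.ofFn fun k : Fin n => LOp (M.bulk (k + 1)) k lam).prod

/-- The transfer matrix with fixed boundary spins,
`t^B(λ) = (1, λ ω^{-γ_0} a_0) L_1(λ) ⋯ L_n(λ) (1, ω^{γ_{n+1}} c_{n+1})ᵀ`. -/
def Model.tB (M : Model N n) (lam : ℂ) : Module.End ℂ (State N n) :=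
  let row : Fin 2 → ℂ := ![1, lam * omegaPow (-M.g0) * M.a0]
  let col : Fin 2 → ℂ := ![1, omegaPow M.gEnd * M.cEnd]
  ∑ i : Fin 2, ∑ j : Fin 2, (row i * col j) • M.monodromy lam i j

/-! ### Averaged operators and amplitudes -/

/-- The parameters of the sites `1, …, n + 1`; the last one carries the boundary operator
`L_{n+1}`, for which `κ = b = d = 0` (and `b d / κ` is read as `0`). -/
def Model.site (M : Model N n) (k : ℕ) : Site :=
  if k = n + 1 then
    { kap := 0, a := M.a0 * omegaPow (M.gEnd - M.g0), b := 0, c := M.cEnd, d := 0 }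
  else M.bulk k

/-- The averaged `L`-operator as a function of `z = λ ^ N`. -/
def avgL (N : ℕ) (S : Site) (z : ℂ) : Matrix (Fin 2) (Fin 2) ℂ :=
  !![1 - eps N * S.kap ^ N * z, -eps N * z * (S.a ^ N - S.b ^ N);
    S.c ^ N - S.d ^ N, S.b ^ N * S.d ^ N / S.kap ^ N - eps N * z * S.a ^ N * S.c ^ N]

/-- The averaged monodromy matrix of the sites `1, …, m`, `m ≤ n + 1`. -/
def Model.avgT (M : Model N n) (m : ℕ) (z : ℂ) : Matrix (Fin 2) (Fin 2) ℂ :=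
  (List.ofFn fun k : Fin m => avgL N (M.site (k + 1)) z).prod

/-- `F_k(λ) = (b_k + ω a_k κ_k λ) (λ c_k + d_k / κ_k)`. -/
def Model.F (M : Model N n) (k : ℕ) (lam : ℂ) : ℂ :=
  ((M.site k).b + omega N * (M.site k).a * (M.site k).kap * lam) *
    (lam * (M.site k).c + (M.site k).d / (M.site k).kap)

/-- The amplitudes `r_m` (`1 ≤ m ≤ n + 1`) and `r_{m,s}` (`1 ≤ m ≤ n + 1`, `0 ≤ s ≤ m - 1`);
`R m s` is `r_{m,s}`. -/
structure Amplitudes where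
  r : ℕ → ℂ
  R : ℕ → ℕ → ℂ

/-- `r̃_m = r_{m,0} r_{m,1} ⋯ r_{m,m-1}`. -/
def Amplitudes.rt (A : Amplitudes) (m : ℕ) : ℂ := ∏ s ∈ Finset.range m, A.R m s

/-- The equations that determine the amplitudes up to roots of unity, and the normalizations. -/
structure IsAmplitudes (M : Model N n) (A : Amplitudes) : Prop where
  r_pow : ∀ k, 1 ≤ k → k ≤ n → A.r k ^ N = (M.bulk k).a ^ N - (M.bulk k).b ^ N
  r_last : A.r (n + 1) = M.a0
  R_one : A.R 1 0 = A.r 1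
  avgB : ∀ m, 1 ≤ m → m ≤ n + 1 → ∀ z : ℂ,
    M.avgT m z 0 1 =
      (-eps N) ^ m * z * A.R m 0 ^ N * ∏ s ∈ Finset.Icc 1 (m - 1), (z - eps N * A.R m s ^ N)
  rt_last : A.rt (n + 1) = omega N * M.a0

/-- Genericity: the parameters do not vanish, `r_k ≠ 0`, the averaged `B_m` divided by `z` has
degree `m - 1` and non-zero simple zeros `ε r_{m,s} ^ N`, at which the determinant of the averaged
monodromy matrix of the sites `1, …, n` does not vanish. -/
structure IsGeneric (M : Model N n) (A : Amplitudes) : Prop where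
  bulk_ne : ∀ k, 1 ≤ k → k ≤ n → (M.bulk k).kap ≠ 0 ∧ (M.bulk k).a ≠ 0 ∧ (M.bulk k).b ≠ 0 ∧
    (M.bulk k).c ≠ 0 ∧ (M.bulk k).d ≠ 0
  a0_ne : M.a0 ≠ 0
  cEnd_ne : M.cEnd ≠ 0
  r_ne : ∀ k, 1 ≤ k → k ≤ n → A.r k ≠ 0
  R_ne : ∀ m, 1 ≤ m → m ≤ n + 1 → ∀ s, s < m → A.R m s ≠ 0
  simple : ∀ m, 1 ≤ m → m ≤ n + 1 → ∀ s s', 1 ≤ s → s < m → 1 ≤ s' → s' < m → s ≠ s' →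
    A.R m s ^ N ≠ A.R m s' ^ N
  det_ne : ∀ m, 1 ≤ m → m ≤ n + 1 → ∀ s, 1 ≤ s → s < m →
    (M.avgT n (eps N * A.R m s ^ N)).det ≠ 0

/-- The `y`-coordinates of the points of the Fermat curve that are fixed only up to phases:
`Y m s m' s'` is `y^{m,s}_{m',s'}`, `y m s` is `y_{m,s}`, `yt m s` is `ỹ_{m,s}`, and
`yBB j k`, `yB m k`, `ytB m k` are the coordinates of the points `p^BB_{j,k}`, `p^B_{m,k}`,
`p̃^B_{m,k}` with indices counted from `0`. -/
structure Phases (n : ℕ) where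
  Y : ℕ → ℕ → ℕ → ℕ → ℂ
  y : ℕ → ℕ → ℂ
  yt : ℕ → ℕ → ℂ
  yBB : Fin (n + 1) → Fin n → ℂ
  yB : Fin n → Fin n → ℂ
  ytB : Fin n → Fin n → ℂ

/-! ### The `x`-coordinates of the points of the Fermat curve -/

/-- `x^{m,s}_{m',s'} = r_{m,s} / r_{m',s'}`. -/
def xPair (A : Amplitudes) (m s m' s' : ℕ) : ℂ := A.R m s / A.R m' s'

/-- `x_{m,s} = a_m κ_m r_{m,s} / b_m`. -/
def xOne (M : Model N n) (A : Amplitudes) (m s : ℕ) : ℂ :=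
  (M.bulk m).a * (M.bulk m).kap * A.R m s / (M.bulk m).b

/-- `x̃_{m,s} = d_m / (κ_m c_m r_{m,s})`. -/
def xtOne (M : Model N n) (A : Amplitudes) (m s : ℕ) : ℂ :=
  (M.bulk m).d / ((M.bulk m).kap * (M.bulk m).c * A.R m s)

/-- `x^BB_{j,k} = r_{n+1,k} / s_j`. -/
def xBB (A : Amplitudes) (s : Fin (n + 1) → ℂ) (j : Fin (n + 1)) (k : Fin n) : ℂ :=
  A.R (n + 1) (k + 1) / s j

/-- `x^B_{m,k} = b_m / (a_m κ_m r_{n+1,k})`. -/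
def xB (M : Model N n) (A : Amplitudes) (m k : Fin n) : ℂ :=
  (M.bulk (m + 1)).b / ((M.bulk (m + 1)).a * (M.bulk (m + 1)).kap * A.R (n + 1) (k + 1))

/-- `x̃^B_{m,k} = r_{n+1,k} c_m κ_m / d_m`. -/
def xtB (M : Model N n) (A : Amplitudes) (m k : Fin n) : ℂ :=
  A.R (n + 1) (k + 1) * (M.bulk (m + 1)).c * (M.bulk (m + 1)).kap / (M.bulk (m + 1)).d

/-- The constants `χ_k`, `k = 1, …, n` (index `k - 1`). -/
def chi (M : Model N n) (A : Amplitudes) (Ph : Phases n) (k : Fin n) : ℂ :=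
  A.R (n + 1) 0 * A.rt n / (M.a0 * A.rt (n + 1)) *
    (∏ m ∈ (Finset.Icc 1 n).erase (k + 1 : ℕ),
      Ph.Y (n + 1) m (n + 1) (k + 1) / Ph.Y (n + 1) (k + 1) (n + 1) m) *
    ∏ m ∈ Finset.Icc 1 (n - 1), Ph.Y (n + 1) (k + 1) n m

/-- The points lie on the Fermat curve `x ^ N + y ^ N = 1`, and the two families of relations on
the phases of their `y`-coordinates hold. -/
structure IsPhases (M : Model N n) (A : Amplitudes) (s : Fin (n + 1) → ℂ) (Ph : Phases n) :
    Prop where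
  same_level : ∀ m, 2 ≤ m → m ≤ n + 1 → ∀ i j, 1 ≤ i → i < m → 1 ≤ j → j < m → i ≠ j →
    xPair A m i m j ^ N + Ph.Y m i m j ^ N = 1
  next_level : ∀ m, 2 ≤ m → m ≤ n → ∀ k l, 1 ≤ k → k ≤ m → 1 ≤ l → l < m →
    xPair A (m + 1) k m l ^ N + Ph.Y (m + 1) k m l ^ N = 1
  one : ∀ m, 2 ≤ m → m ≤ n → ∀ l, 1 ≤ l → l < m →
    xOne M A m l ^ N + Ph.y m l ^ N = 1
  tilde_one : ∀ m, 2 ≤ m → m ≤ n → ∀ l, 1 ≤ l → l < m →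
    xtOne M A m l ^ N + Ph.yt m l ^ N = 1
  bulk_rel : ∀ m, 2 ≤ m → m ≤ n → ∀ l, 1 ≤ l → l < m →
    A.rt m * A.R (m + 1) 0 * A.r m /
        (A.rt (m - 1) * A.R m 0 * A.r (m + 1) * (M.bulk m).b * (M.bulk m).c *
          Ph.y m l * Ph.yt m l) *
      (∏ i ∈ (Finset.Icc 1 (m - 1)).erase l, Ph.Y m l m i / Ph.Y m i m l) *
      ((∏ k ∈ Finset.Icc 1 m, Ph.Y (m + 1) k m l) /
        ∏ i ∈ Finset.Icc 1 (m - 2), Ph.Y m l (m - 1) i) = 1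
  BB : ∀ j k, xBB A s j k ^ N + Ph.yBB j k ^ N = 1
  B : ∀ m k, xB M A m k ^ N + Ph.yB m k ^ N = 1
  tilde_B : ∀ m k, xtB M A m k ^ N + Ph.ytB m k ^ N = 1
  boundary_rel : ∀ k : Fin n,
    ∏ m : Fin n, (omega N * (M.bulk (m + 1)).a * (M.bulk (m + 1)).d * Ph.yB m k * Ph.ytB m k) =
      chi M A Ph k * ∏ j : Fin (n + 1), Ph.yBB j k

/-! ### Eigenvectors of the auxiliary problems -/

/-- `w_p` at the point `p^{m,s}_{m',s'}`. -/
def wPair (A : Amplitudes) (Ph : Phases n) (m s m' s' : ℕ) (g : ZMod N) : ℂ :=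
  w (xPair A m s m' s') (Ph.Y m s m' s') g

/-- The part common to the coefficients `Q(ρ_m, · | ρ_{m+1})` and `Q^B`: here `ρ` is
`(ρ_{m,0}, …, ρ_{m,m-1})`, and `τ` is `(ρ_{m+1,1}, …, ρ_{m+1,m})` with indices counted from `0`. -/
def Qcommon (M : Model N n) (A : Amplitudes) (Ph : Phases n) (m : ℕ) (ρ τ : Fin m → ZMod N) : ℂ :=
  (∏ l ∈ Finset.univ.filter (fun l : Fin m => l.val ≠ 0), ∏ k : Fin m,
      wPair A Ph (m + 1) (k + 1) m l (ρ l - τ k)) /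
    (∏ l ∈ Finset.univ.filter (fun l : Fin m => l.val ≠ 0),
      ∏ j ∈ Finset.univ.filter (fun j : Fin m => j.val ≠ 0 ∧ j ≠ l),
        wPair A Ph m l m j (ρ j - ρ l)) *
    ∏ l ∈ Finset.univ.filter (fun l : Fin m => l.val ≠ 0),
      w (xOne M A m l) (Ph.y m l) (-ρ l) / w (xtOne M A m l) (Ph.yt m l) (ρ l)

/-- The coefficient `Q(ρ_{m}, t | ρ_{m+1})` for `m ≥ 1`, built with the points
`p_{m+1,0}` and `p̃_{m+1}`. -/
def Q (M : Model N n) (A : Amplitudes) (Ph : Phases n) (m : ℕ) [NeZero m]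
    (ρ : Fin m → ZMod N) (t : ZMod N) (ρ' : Fin (m + 1) → ZMod N) : ℂ :=
  omegaPow ((∑ k, ρ' k - ∑ k, ρ k) * (t - ρ' 0)) /
    (w (A.R m 0 * (M.bulk (m + 1)).a * (M.bulk (m + 1)).c / A.R (m + 1) 0)
        ((∏ k ∈ Finset.Icc 1 m, (M.bulk k).kap) * A.r (m + 1) / A.R (m + 1) 0)
        (ρ' 0 - ρ 0 - 1) *
      w (A.r (m + 1) / A.rt (m + 1))
        ((M.bulk (m + 1)).b * (M.bulk (m + 1)).d * A.rt m / (M.bulk (m + 1)).kap / A.rt (m + 1))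
        (∑ k, ρ' k - t - 1)) *
    Qcommon M A Ph m ρ (fun k => ρ' k.succ)

/-- The one-site vector `ψ^{(k)}_ρ = ∑_γ w_{p_k}(γ - ρ) |γ⟩`, with
`p_k = (r_k / a_k, b_k / a_k)`. -/
def psi (M : Model N n) (A : Amplitudes) (k : ℕ) (ρ : ZMod N) (g : ZMod N) : ℂ :=
  w (A.r k / (M.bulk k).a) ((M.bulk k).b / (M.bulk k).a) (g - ρ)

/-- The eigenvectors `Ψ_{ρ_m}` of `B_m(λ)` on the first `m` sites, by recursion on `m`. -/
def Psi (M : Model N n) (A : Amplitudes) (Ph : Phases n) :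
    (m : ℕ) → (Fin m → ZMod N) → State N m
  | 0, _ => fun _ => 1
  | 1, ρ => fun γ => psi M A 1 (ρ 0) (γ 0)
  | m + 2, ρ' => fun γ =>
      ∑ ρ : Fin (m + 1) → ZMod N, ∑ t : ZMod N,
        Q M A Ph (m + 1) ρ t ρ' *
          (Psi M A Ph (m + 1) ρ (Fin.init γ) * psi M A (m + 2) t (γ (Fin.last (m + 1))))

variable [NeZero n]

/-- The coefficient `Q^B(ρ_n | ρ'_{n+1})`, built with the point `p_{n+1,0}`; here `τ` is
`(ρ_{n+1,1}, …, ρ_{n+1,n})`. -/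
def QB (M : Model N n) (A : Amplitudes) (Ph : Phases n) (ρ τ : Fin n → ZMod N) : ℂ :=
  omegaPow ((M.g0 + 1 - ∑ k, ρ k) * (∑ k, τ k - 1)) /
    w (A.R n 0 * M.a0 * M.cEnd / A.R (n + 1) 0)
      ((∏ k ∈ Finset.Icc 1 n, (M.bulk k).kap) * M.a0 / A.R (n + 1) 0)
      (M.gEnd - ∑ k, τ k - ρ 0) *
    Qcommon M A Ph n ρ τ

/-- The eigenvectors `Ψ^B` of `B_{n+1}(λ)`. -/
def PsiB (M : Model N n) (A : Amplitudes) (Ph : Phases n) (τ : Fin n → ZMod N) : State N n :=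
  ∑ ρ : Fin n → ZMod N, QB M A Ph ρ τ • Psi M A Ph n ρ

/-! ### Eigenvectors of the transfer matrix -/

/-- The function `q̃_k` of one separated variable. -/
def qTilde (M : Model N n) (A : Amplitudes) (Ph : Phases n) (s : Fin (n + 1) → ℂ)
    (σ : Fin (n + 1) → ZMod N) (k : Fin n) (g : ZMod N) : ℂ :=
  (∏ j : Fin (n + 1), w (xBB A s j k) (Ph.yBB j k) (σ j - g)) *
    ∏ m : Fin n, w (xB M A m k) (Ph.yB m k) (g - 1) / w (xtB M A m k) (Ph.ytB m k) (-g - 1)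

/-- The coefficient `Q^B(ρ'_{n+1} | σ)`. -/
def QSigma (M : Model N n) (A : Amplitudes) (Ph : Phases n) (s : Fin (n + 1) → ℂ)
    (σ : Fin (n + 1) → ZMod N) (τ : Fin n → ZMod N) : ℂ :=
  (∏ k : Fin n, qTilde M A Ph s σ k (τ k)) /
    ∏ m : Fin n, ∏ m' ∈ Finset.univ.filter (fun m' : Fin n => m' ≠ m),
      wPair A Ph (n + 1) (m' + 1) (n + 1) (m + 1) (τ m - τ m')

/-- The vector `Φ_σ`. -/
def Phi (M : Model N n) (A : Amplitudes) (Ph : Phases n) (s : Fin (n + 1) → ℂ)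
    (σ : Fin (n + 1) → ZMod N) : State N n :=
  ∑ τ : Fin n → ZMod N, QSigma M A Ph s σ τ • PsiB M A Ph τ

/-- `t^B(λ | σ) = ∏_j (λ / (s_j ω^{-σ_j}) + 1)`. -/
def eigB (s : Fin (n + 1) → ℂ) (σ : Fin (n + 1) → ZMod N) (lam : ℂ) : ℂ :=
  ∏ j : Fin (n + 1), (lam / (s j * omegaPow (-σ j)) + 1)

/-- `Δ⁺_k(λ)`. -/
def DeltaPlus (M : Model N n) (A : Amplitudes) (Ph : Phases n) (k : Fin n) (lam : ℂ) : ℂ :=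
  (chi M A Ph k)⁻¹ * ((lam / omega N) ^ n)⁻¹ * ∏ m ∈ Finset.Icc 1 n, M.F m (lam / omega N)

/-- `Δ⁻_k(λ)`. -/
def DeltaMinus (M : Model N n) (A : Amplitudes) (Ph : Phases n) (k : Fin n) (lam : ℂ) : ℂ :=
  chi M A Ph k * (lam / omega N) ^ n * M.F (n + 1) (lam / omega N)

/-- The zero `λ_{n+1,k} = - r_{n+1,k} ω^{-ρ}` of the eigenvalue of `B_{n+1}(λ)`. -/
def zeroB (N : ℕ) [NeZero N] (A : Amplitudes) (k : Fin n) (g : ZMod N) : ℂ :=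
  -A.R (n + 1) (k + 1) * omegaPow (-g)

end

end BBS

namespace BBS

noncomputable section

open Finset Polynomial

section

variable {N : ℕ} [NeZero N]

/-! ### Roots of unity and the function `w` -/

/-! The proof is separation of variables, carried out with three facts about products of L-operators
and no Yang–Baxter relation. The entries are polynomial in λ with known outer coefficients
(`mono_matEnds`). They satisfy a quantum determinant identity linking λ/ω and λ (`mono_quantumDet`).
The total shift V = v_1⋯v_m commutes with A and D and ω-commutes with B and C (`mono_twist`).

Bulk. By induction on the number of sites, the vectors Ψ_ρ diagonalize B_m(λ), the indices ρ_k with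
k ≥ 1 placing its zeros and ρ_0 its leading coefficient (`Level`). At a zero of the eigenvalue, A_m
raises the corresponding index by one, and V raises ρ_0. Interpolation from these values and the
outer coefficients then gives A_m(λ) on Ψ_ρ for every λ. In B_{m+1} = A_m b + B_m d, the eigenvalue
equation for a combination of the Ψ_ρ splits into a leading-coefficient, a constant-coefficient and
a residue condition (`Level.sum_A_eq`). These are first-order recursions, solved by products of the
functions w. The Fermat equations make w cyclic, and the first family of phase relations makes the
residue condition hold (`Qcommon_mul_phiA`). Finally, A_{m+1} at the new zeros is found from the
quantum determinant of the last site (`LOp_last_mul_mono`).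

Boundary. The combination A_n + ω^{γ_{n+1}} c_{n+1} B_n plays the part of B_{n+1} and is diagonal on
Ψ^B (`A_PsiB`). At its zeros, half of t^B vanishes; the quantum determinant of the whole chain
evaluates the other half and shows that t^B lowers one index (`tB_PsiB`). There is no raising term,
which is why the Baxter equation has two terms only. Since t^B(λ|σ) is a product of linear factors,
such an equation is solved by a product of functions w (`qTilde_add_one`). Both t^B and its proposed
eigenvalue have degree n + 1, so agreement of the outer coefficients and at the n zeros is enough
(`tB_Phi`); the constraint on the sum of σ matches the leading coefficients. Linear independence of
the Ψ^B and non-zero coefficients give Φ_σ ≠ 0.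

Admissible choices. The N-th powers of both families of phase relations are identities between
averaged monodromy matrices at zeros of their B-entries (`bulk_rel_pow`, `boundary_rel_pow`). Hence
y_{m,l} can be defined by the first family, and the second fails at most by an N-th root of unity,
which one y-coordinate absorbs. -/

theorem omegaPow_add (g h : ZMod N) : omegaPow (g + h) = omegaPow g * omegaPow h :=
  AddChar.map_add_eq_mul _ g h

theorem omegaPow_zero : omegaPow (0 : ZMod N) = 1 := AddChar.map_zero_eq_one _

theorem omegaPow_one : omegaPow (1 : ZMod N) = omega N := rfl

theorem omegaPow_ne_zero (g : ZMod N) : omegaPow g ≠ 0 := by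
  intro h
  have h1 := omegaPow_add g (-g)
  simp [h, omegaPow_zero] at h1

theorem omega_ne_zero : omega N ≠ 0 := omegaPow_ne_zero 1

theorem omegaPow_neg (g : ZMod N) : omegaPow (-g) = (omegaPow g)⁻¹ := by
  have h1 := omegaPow_add g (-g)
  rw [add_neg_cancel, omegaPow_zero] at h1
  exact eq_inv_of_mul_eq_one_right h1.symm

theorem omegaPow_sub (g h : ZMod N) : omegaPow (g - h) = omegaPow g / omegaPow h := by
  rw [sub_eq_add_neg, omegaPow_add, omegaPow_neg, div_eq_mul_inv]

theorem omegaPow_natCast (k : ℕ) : omegaPow (k : ZMod N) = omega N ^ k := by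
  have h := AddChar.map_nsmul_eq_pow (ZMod.stdAddChar (N := N)) k 1
  simpa [omega, omegaPow] using h

theorem omegaPow_sum {ι : Type*} (s : Finset ι) (f : ι → ZMod N) :
    omegaPow (∑ i ∈ s, f i) = ∏ i ∈ s, omegaPow (f i) := by
  classical
  induction s using Finset.induction_on with
  | empty => simp [omegaPow_zero]
  | insert a s ha ih => rw [sum_insert ha, prod_insert ha, omegaPow_add, ih]

theorem omegaPow_pow (g : ZMod N) : omegaPow g ^ N = 1 := by
  rw [omegaPow, ← AddChar.map_nsmul_eq_pow]
  simp

theorem omegaPow_injective : Function.Injective (omegaPow : ZMod N → ℂ) :=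
  ZMod.injective_stdAddChar

theorem omega_pow : omega N ^ N = 1 := omegaPow_pow 1

theorem isPrimitiveRoot_omega : IsPrimitiveRoot (omega N) N := by
  rw [omega_eq]
  exact Complex.isPrimitiveRoot_exp N (NeZero.ne N)

/-- The exponents run over 1, …, N rather than 0, …, N − 1 so that the product is the denominator of
w taken once around the cycle. -/
theorem prod_one_sub_omega_pow (x : ℂ) : ∏ j ∈ Icc 1 N, (1 - omega N ^ j * x) = 1 - x ^ N := by
  have hN := NeZero.pos N
  have h := (isPrimitiveRoot_omega (N := N)).pow_sub_pow_eq_prod_sub_mul 1 x hN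
  rw [one_pow] at h
  rw [h]
  refine prod_bij (fun j _ => omega N ^ j) ?_ ?_ ?_ ?_
  · intro j _
    rw [Polynomial.mem_nthRootsFinset hN, ← pow_mul, mul_comm, pow_mul, omega_pow, one_pow]
  · intro i hi j hj hij
    simp only [mem_Icc] at hi hj
    rcases hi.2.lt_or_eq with hi' | hi' <;> rcases hj.2.lt_or_eq with hj' | hj'
    · exact isPrimitiveRoot_omega.pow_inj hi' hj' hij
    · subst hj'
      simp only [omega_pow] at hij
      exact absurd hij (isPrimitiveRoot_omega.pow_ne_one_of_pos_of_lt (by omega) hi')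
    · subst hi'
      simp only [omega_pow] at hij
      exact absurd hij.symm (isPrimitiveRoot_omega.pow_ne_one_of_pos_of_lt (by omega) hj')
    · rw [hi', hj']
  · intro b hb
    rw [Polynomial.mem_nthRootsFinset hN] at hb
    obtain ⟨i, hi, rfl⟩ := isPrimitiveRoot_omega.eq_pow_of_pow_eq_one hb
    rcases Nat.eq_zero_or_pos i with rfl | h0
    · exact ⟨N, by simp only [mem_Icc]; omega, by simp [omega_pow]⟩
    · exact ⟨i, by simp only [mem_Icc]; omega, rfl⟩
  · intro _ _
    rfl

/-- `(x, y)` lies on the Fermat curve and `y ≠ 0`. -/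
structure OnFermat (N : ℕ) (x y : ℂ) : Prop where
  eq : x ^ N + y ^ N = 1
  ne : y ≠ 0

theorem OnFermat.of_pow {x y : ℂ} (h : x ^ N + y ^ N = 1) (hx : x ^ N ≠ 1) : OnFermat N x y :=
  ⟨h, by rintro rfl; rw [zero_pow (NeZero.ne N), add_zero] at h; exact hx h⟩

theorem OnFermat.pow_ne {x y : ℂ} (h : OnFermat N x y) : x ^ N ≠ 1 := by
  intro hx
  have := h.eq
  rw [hx, add_eq_left] at this
  exact h.ne (pow_eq_zero_iff (NeZero.ne N) |>.1 this)

theorem one_sub_ne_zero {x : ℂ} (h : x ^ N ≠ 1) (g : ZMod N) : 1 - omegaPow g * x ≠ 0 := by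
  intro h0
  apply h
  have : (omegaPow g * x) ^ N = 1 := by rw [← sub_eq_zero.1 h0, one_pow]
  rwa [mul_pow, omegaPow_pow, one_mul] at this

theorem OnFermat.sub_ne {x y : ℂ} (h : OnFermat N x y) (g : ZMod N) :
    1 - omegaPow g * x ≠ 0 := one_sub_ne_zero h.pow_ne g

theorem OnFermat.w_ne {x y : ℂ} (h : OnFermat N x y) (g : ZMod N) : w x y g ≠ 0 := by
  rw [w, prod_ne_zero_iff]
  intro j _
  have := h.sub_ne (j : ZMod N)
  rw [omegaPow_natCast] at this
  exact div_ne_zero h.ne this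

/-- For representatives other than 0 the recursion peels one factor off the defining product. The
step from N − 1 back to 0 closes up because the product around the cycle is y^N / (1 − x^N), which
is 1 on the Fermat curve. -/
theorem OnFermat.w_rec {x y : ℂ} (h : OnFermat N x y) (g : ZMod N) :
    w x y g * (1 - omegaPow g * x) = w x y (g - 1) * y := by
  have hv : ∀ k : ℕ, k < N → w x y (k : ZMod N) = ∏ j ∈ Icc 1 k, y / (1 - omega N ^ j * x) := by
    intro k hk
    rw [w, ZMod.val_cast_of_lt hk]
  have hN := NeZero.pos N
  obtain ⟨k, hk, rfl⟩ : ∃ k : ℕ, k < N ∧ (k : ZMod N) = g :=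
    ⟨g.val, ZMod.val_lt g, by simp⟩
  rcases Nat.eq_zero_or_pos k with rfl | h0
  · have e1 : ((0 : ℕ) : ZMod N) - 1 = ((N - 1 : ℕ) : ZMod N) := by
      rw [Nat.cast_sub (by omega)]
      simp
    rw [e1, hv _ hk, hv _ (by omega), Nat.cast_zero, omegaPow_zero]
    have h1 : ∏ j ∈ Icc 1 N, y / (1 - omega N ^ j * x) = 1 := by
      rw [prod_div_distrib, prod_one_sub_omega_pow, prod_const, Nat.card_Icc,
        Nat.add_sub_cancel]
      rw [div_eq_one_iff_eq (sub_ne_zero.2 (Ne.symm h.pow_ne))]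
      linear_combination h.eq
    obtain ⟨K, hK⟩ : ∃ K, N = K + 1 := ⟨N - 1, by omega⟩
    have h2 : Icc 1 N = Icc 1 (K + 1) := by rw [hK]
    have h3 : omega N ^ (K + 1) = 1 := by rw [← hK]; exact omega_pow
    have h4 := h.sub_ne 0
    rw [omegaPow_zero, one_mul] at h4
    rw [h2, prod_Icc_succ_top (by omega), h3, one_mul] at h1
    rw [show N - 1 = K by omega, Icc_eq_empty (by omega), prod_empty]
    field_simp at h1
    linear_combination -h1
  · obtain ⟨K, rfl⟩ : ∃ K, k = K + 1 := ⟨k - 1, by omega⟩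
    have e1 : ((K + 1 : ℕ) : ZMod N) - 1 = (K : ZMod N) := by push_cast; ring
    rw [e1, hv _ hk, hv _ (by omega), omegaPow_natCast, prod_Icc_succ_top (by omega)]
    have h4 := h.sub_ne ((K + 1 : ℕ) : ZMod N)
    rw [omegaPow_natCast] at h4
    rw [mul_assoc, div_mul_cancel₀ _ h4]

theorem OnFermat.w_pred {x y : ℂ} (h : OnFermat N x y) (g : ZMod N) :
    w x y (g - 1) = w x y g * ((1 - omegaPow g * x) / y) := by
  have := h.w_rec g
  have := h.ne
  field_simp
  exact (h.w_rec g).symm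

theorem OnFermat.w_succ {x y : ℂ} (h : OnFermat N x y) (g : ZMod N) :
    w x y (g + 1) = w x y g * (y / (1 - omegaPow (g + 1) * x)) := by
  have h1 := h.w_rec (g + 1)
  have := h.sub_ne (g + 1)
  rw [add_sub_cancel_right] at h1
  field_simp
  exact h1

/-! ### Finite products -/

theorem prod_filter_val_ne_zero {m : ℕ} (f : Fin (m + 1) → ℂ) :
    ∏ l ∈ univ.filter (fun l : Fin (m + 1) => l.val ≠ 0), f l = ∏ l : Fin m, f l.succ := by
  rw [prod_filter, Fin.prod_univ_succ]
  simp

theorem prod_filter_val_ne_zero_and_ne {m : ℕ} (f : Fin (m + 1) → ℂ) (k : Fin m) :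
    ∏ l ∈ univ.filter (fun l : Fin (m + 1) => l.val ≠ 0 ∧ l ≠ k.succ), f l =
      ∏ l ∈ univ.erase k, f l.succ := by
  rw [prod_filter, Fin.prod_univ_succ, ← filter_ne' univ k, prod_filter]
  simp

theorem prod_offDiag_split {ι : Type*} [Fintype ι] [DecidableEq ι] (k : ι) (h : ι → ι → ℂ) :
    ∏ l, ∏ j ∈ univ.erase l, h l j =
      (∏ l ∈ univ.erase k, h l k * h k l) *
        ∏ l ∈ univ.erase k, ∏ j ∈ (univ.erase l).erase k, h l j := by
  rw [← mul_prod_erase univ _ (mem_univ k), prod_mul_distrib]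
  have : ∀ l ∈ univ.erase k, ∏ j ∈ univ.erase l, h l j =
      h l k * ∏ j ∈ (univ.erase l).erase k, h l j := by
    intro l hl
    rw [mul_prod_erase]
    simp only [mem_erase, mem_univ, and_true] at hl ⊢
    exact Ne.symm hl
  rw [prod_congr rfl this, prod_mul_distrib]
  ring

theorem prod_mul_of_eq_off {ι : Type*} [Fintype ι] [DecidableEq ι] (k : ι) (f g : ι → ℂ) (c : ℂ)
    (hne : ∀ l, l ≠ k → g l = f l) (hk : g k = f k * c) : ∏ l, g l = (∏ l, f l) * c := by
  rw [← mul_prod_erase univ g (mem_univ k), ← mul_prod_erase univ f (mem_univ k), hk,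
    prod_congr rfl (fun l hl => hne l (ne_of_mem_erase hl))]
  ring

/-- For products over ordered pairs: shifting one coordinate k affects row k and column k only, so
the effect is a single product over the other indices. -/
theorem prod_offDiag_of_eq_off {ι : Type*} [Fintype ι] [DecidableEq ι] (k : ι) (f g : ι → ι → ℂ)
    (c d : ι → ℂ) (hne : ∀ l j, l ≠ k → j ≠ k → g l j = f l j)
    (hc : ∀ l, l ≠ k → g l k = f l k * c l) (hd : ∀ l, l ≠ k → g k l = f k l * d l) :
    ∏ l, ∏ j ∈ univ.erase l, g l j =
      (∏ l, ∏ j ∈ univ.erase l, f l j) * ∏ l ∈ univ.erase k, (c l * d l) := by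
  rw [prod_offDiag_split k g, prod_offDiag_split k f]
  have h1 : ∀ l ∈ univ.erase k, g l k * g k l = (f l k * f k l) * (c l * d l) := by
    intro l hl
    rw [hc l (ne_of_mem_erase hl), hd l (ne_of_mem_erase hl)]
    ring
  have h2 : ∀ l ∈ univ.erase k, ∏ j ∈ (univ.erase l).erase k, g l j =
      ∏ j ∈ (univ.erase l).erase k, f l j := by
    intro l hl
    exact prod_congr rfl fun j hj => hne l j (ne_of_mem_erase hl) (ne_of_mem_erase hj)
  rw [prod_congr rfl h1, prod_congr rfl h2, prod_mul_distrib]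
  ring

/-! ### Interpolation with prescribed outer coefficients -/

/-- Once the top coefficient is prescribed, what remains is fixed by the values at 0 and at the x_k.
The factor t / x_k in each basis polynomial makes it vanish at the extra node 0, so the constant
coefficient appears on its own. -/
theorem eval_eq_interpolation {ι : Type*} [Fintype ι] [DecidableEq ι] (x : ι → ℂ)
    (hx : Function.Injective x) (hx0 : ∀ k, x k ≠ 0) (p : ℂ[X])
    (hp : p.natDegree ≤ Fintype.card ι + 1) (t : ℂ) :
    p.eval t = p.coeff (Fintype.card ι + 1) * (t * ∏ k, (t - x k)) +
      p.coeff 0 * ((∏ k, (t - x k)) / ∏ k, (-x k)) +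
      ∑ k, p.eval (x k) *
        ((t / x k) * ((∏ l ∈ univ.erase k, (t - x l)) / ∏ l ∈ univ.erase k, (x k - x l))) := by
  set h := Fintype.card ι with hh
  set P : ℂ[X] := ∏ k, (X - C (x k)) with hP
  have hPm : P.Monic := monic_prod_of_monic _ _ fun k _ => monic_X_sub_C _
  have hPd : P.natDegree = h := by
    rw [hP, natDegree_prod_of_monic _ _ fun k _ => monic_X_sub_C _]
    simp [hh]
  set q : ℂ[X] := C (p.coeff (h + 1)) * (X * P) + C (p.coeff 0 / ∏ k, (-x k)) * P +
    ∑ k, C (p.eval (x k) / x k / ∏ l ∈ univ.erase k, (x k - x l)) *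
      (X * ∏ l ∈ univ.erase k, (X - C (x l))) with hq
  have hqe : ∀ t, q.eval t = p.coeff (h + 1) * (t * ∏ k, (t - x k)) +
      p.coeff 0 * ((∏ k, (t - x k)) / ∏ k, (-x k)) +
      ∑ k, p.eval (x k) *
        ((t / x k) * ((∏ l ∈ univ.erase k, (t - x l)) / ∏ l ∈ univ.erase k, (x k - x l))) := by
    intro t
    simp only [hq, hP, eval_add, eval_mul, eval_C, eval_X, eval_prod, eval_sub, eval_finsetSum]
    congr 1
    · ring
    · refine sum_congr rfl fun k _ => ?_
      ring
  rw [← hqe]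
  suffices hpq : p = q by rw [← hpq]
  have hsmall : ∀ k, (X * ∏ l ∈ univ.erase k, (X - C (x l)) : ℂ[X]).natDegree ≤ h := by
    intro k
    have hc : 0 < h := Fintype.card_pos_iff.2 ⟨k⟩
    refine (natDegree_mul_le).trans ?_
    rw [natDegree_X, natDegree_prod_of_monic _ _ fun k _ => monic_X_sub_C _]
    simp [card_erase_of_mem, ← hh]
    omega
  have hsum : (∑ k, C (p.eval (x k) / x k / ∏ l ∈ univ.erase k, (x k - x l)) *
      (X * ∏ l ∈ univ.erase k, (X - C (x l))) : ℂ[X]).natDegree ≤ h :=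
    natDegree_sum_le_of_forall_le _ _ fun k _ => (natDegree_C_mul_le _ _).trans (hsmall k)
  have hXP : (X * P).Monic := monic_X.mul hPm
  have hXPd : (X * P).natDegree = h + 1 := by
    rw [monic_X.natDegree_mul hPm, natDegree_X, hPd, add_comm]
  have hqd : q.natDegree ≤ h + 1 := by
    refine natDegree_add_le_of_degree_le (natDegree_add_le_of_degree_le ?_ ?_) (by omega)
    · exact (natDegree_C_mul_le _ _).trans hXPd.le
    · exact (natDegree_C_mul_le _ _).trans (by omega)
  have hqc : q.coeff (h + 1) = p.coeff (h + 1) := by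
    have e1 : (X * P).coeff (h + 1) = 1 := by rw [← hXPd]; exact hXP.coeff_natDegree
    have e2 : P.coeff (h + 1) = 0 := coeff_eq_zero_of_natDegree_lt (by omega)
    rw [hq, coeff_add, coeff_add, coeff_C_mul, coeff_C_mul, e1, e2,
      coeff_eq_zero_of_natDegree_lt (lt_of_le_of_lt hsum (by omega))]
    ring
  have hdeg : (p - q).degree < (h + 1 : ℕ) := by
    rw [degree_lt_iff_coeff_zero]
    intro i hi
    rcases hi.eq_or_lt with rfl | hi
    · rw [coeff_sub, hqc, sub_self]
    · rw [coeff_sub, coeff_eq_zero_of_natDegree_lt (by omega),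
        coeff_eq_zero_of_natDegree_lt (by omega), sub_self]
  -- The nodes are the x_k together with 0, which is the image of `none`.
  let v : Option ι → ℂ := fun o => o.elim 0 x
  have hv : Set.InjOn v (univ : Finset (Option ι)) := by
    intro a _ b _ hab
    cases a <;> cases b <;> simp [v] at hab ⊢
    · exact hx0 _ hab.symm
    · exact hx0 _ hab
    · exact hx hab
  refine Polynomial.eq_of_degree_sub_lt_of_eval_index_eq (univ : Finset (Option ι)) hv ?_ ?_
  · simpa [← hh] using hdeg
  · intro o _
    cases o with
    | none =>
      change p.eval 0 = q.eval 0
      rw [hqe]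
      have : ∏ k, (-x k) ≠ 0 := prod_ne_zero_iff.2 fun k _ => neg_ne_zero.2 (hx0 k)
      simp [coeff_zero_eq_eval_zero, div_self this]
    | some k =>
      change p.eval (x k) = q.eval (x k)
      have h0 : ∏ l, (x k - x l) = 0 := prod_eq_zero (mem_univ k) (sub_self _)
      have h1 : ∏ l ∈ univ.erase k, (x k - x l) ≠ 0 :=
        prod_ne_zero_iff.2 fun l hl => sub_ne_zero.2 fun h => ne_of_mem_erase hl (hx h).symm
      rw [hqe, h0, sum_eq_single k]
      · rw [div_self (hx0 k), div_self h1]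
        ring
      · intro l _ hl
        rw [prod_eq_zero (mem_erase.2 ⟨hl.symm, mem_univ k⟩) (sub_self _)]
        ring
      · simp

end

/-! ### Zeros of the eigenvalues of B and shifts of the common coefficient -/

section

variable {N n : ℕ} [NeZero N]

theorem prod_Icc_eq_prod_fin (m : ℕ) (f : ℕ → ℂ) : ∏ i ∈ Icc 1 m, f i = ∏ i : Fin m, f (i + 1) := by
  rw [Fin.prod_univ_eq_prod_range (fun i => f (i + 1)) m, ← Nat.Ico_zero_eq_range, prod_Ico_add' f 0 m 1]
  rfl

theorem prod_Icc_erase_eq_prod_fin (m : ℕ) (f : ℕ → ℂ) (l : Fin m) :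
    ∏ i ∈ (Icc 1 m).erase (l + 1), f i = ∏ i ∈ univ.erase l, f (i + 1) := by
  symm
  refine prod_bij (fun i _ => (i : ℕ) + 1) ?_ ?_ ?_ ?_
  · intro i hi
    simp only [mem_erase, mem_univ, and_true, mem_Icc] at hi ⊢
    rw [Ne, Fin.ext_iff] at hi
    omega
  · intro i _ j _ h
    exact Fin.ext (by simpa using h)
  · intro i hi
    simp only [mem_erase, mem_Icc] at hi
    exact ⟨⟨i - 1, by omega⟩, by simp [Fin.ext_iff]; omega, by simp; omega⟩
  · intro _ _
    rfl

theorem Amplitudes.rt_succ (A : Amplitudes) (m : ℕ) :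
    A.rt (m + 1) = A.R (m + 1) 0 * ∏ l : Fin m, A.R (m + 1) (l + 1) := by
  rw [Amplitudes.rt, ← Fin.prod_univ_eq_prod_range, Fin.prod_univ_succ]
  simp

/-- The zeros `-r_{m+1,k} ω^{-σ_k}` of the eigenvalue of `B_{m+1}`. -/
def bZero (A : Amplitudes) (m : ℕ) (σ : Fin m → ZMod N) (k : Fin m) : ℂ :=
  -A.R (m + 1) (k + 1) * omegaPow (-σ k)

/-- Genericity of the amplitudes and phases, with indices counted from `0`. -/
structure Regular (M : Model N n) (A : Amplitudes) (Ph : Phases n) : Prop where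
  kap_ne : ∀ m, m < n → (M.bulk (m + 1)).kap ≠ 0
  a_ne : ∀ m, m < n → (M.bulk (m + 1)).a ≠ 0
  b_ne : ∀ m, m < n → (M.bulk (m + 1)).b ≠ 0
  c_ne : ∀ m, m < n → (M.bulk (m + 1)).c ≠ 0
  d_ne : ∀ m, m < n → (M.bulk (m + 1)).d ≠ 0
  r_pow : ∀ m, m < n → A.r (m + 1) ^ N = (M.bulk (m + 1)).a ^ N - (M.bulk (m + 1)).b ^ N
  R_one : A.R 1 0 = A.r 1
  r_ne : ∀ m, m ≤ n → A.r (m + 1) ≠ 0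
  R_ne : ∀ m, m ≤ n → ∀ l, l ≤ m → A.R (m + 1) l ≠ 0
  same : ∀ m, m ≤ n → ∀ i j : Fin m, i ≠ j →
    OnFermat N (xPair A (m + 1) (i + 1) (m + 1) (j + 1)) (Ph.Y (m + 1) (i + 1) (m + 1) (j + 1))
  next : ∀ m, m < n → ∀ (k : Fin (m + 1)) (l : Fin m),
    OnFermat N (xPair A (m + 2) (k + 1) (m + 1) (l + 1)) (Ph.Y (m + 2) (k + 1) (m + 1) (l + 1))
  one : ∀ m, m < n → ∀ l : Fin m,
    OnFermat N (xOne M A (m + 1) (l + 1)) (Ph.y (m + 1) (l + 1))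
  tilde_one : ∀ m, m < n → ∀ l : Fin m,
    OnFermat N (xtOne M A (m + 1) (l + 1)) (Ph.yt (m + 1) (l + 1))
  rel : ∀ m, m < n → ∀ l : Fin m,
    A.rt (m + 1) * A.R (m + 2) 0 * A.r (m + 1) *
        (∏ i ∈ univ.erase l, Ph.Y (m + 1) (l + 1) (m + 1) (i + 1)) *
        ∏ k : Fin (m + 1), Ph.Y (m + 2) (k + 1) (m + 1) (l + 1) =
      A.rt m * A.R (m + 1) 0 * A.r (m + 2) * (M.bulk (m + 1)).b * (M.bulk (m + 1)).c *
          Ph.y (m + 1) (l + 1) * Ph.yt (m + 1) (l + 1) *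
        (∏ i ∈ univ.erase l, Ph.Y (m + 1) (i + 1) (m + 1) (l + 1)) *
        ∏ i ∈ Icc 1 (m - 1), Ph.Y (m + 1) (l + 1) m i
  zero : ∀ m, m + 1 < n →
    OnFermat N (A.R (m + 1) 0 * (M.bulk (m + 2)).a * (M.bulk (m + 2)).c / A.R (m + 2) 0)
      ((∏ k ∈ Icc 1 (m + 1), (M.bulk k).kap) * A.r (m + 2) / A.R (m + 2) 0)
  tilde : ∀ m, m + 1 < n →
    OnFermat N (A.r (m + 2) / A.rt (m + 2))
      ((M.bulk (m + 2)).b * (M.bulk (m + 2)).d * A.rt (m + 1) / (M.bulk (m + 2)).kap /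
        A.rt (m + 2))
  zero_last : ∀ m, m + 1 = n →
    OnFermat N (A.R (m + 1) 0 * M.a0 * M.cEnd / A.R (m + 2) 0)
      ((∏ k ∈ Icc 1 (m + 1), (M.bulk k).kap) * M.a0 / A.R (m + 2) 0)
  r_last : A.r (n + 1) = M.a0
  rt_last : A.rt (n + 1) = omega N * M.a0

/-- The denominators in the recursion of w, for the points with x = R'/R, are differences of two
zeros up to a factor; this is how polynomials in the zeros enter all the recursions. -/
theorem one_sub_omegaPow_mul_div {R : ℂ} (hR : R ≠ 0) (R' : ℂ) (g h : ZMod N) :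
    1 - omegaPow (g - h) * (R' / R) =
      (R * omegaPow (-g) - R' * omegaPow (-h)) * (omegaPow g / R) := by
  have := omegaPow_ne_zero g
  have := omegaPow_ne_zero h
  rw [omegaPow_sub, omegaPow_neg, omegaPow_neg]
  field_simp

theorem Model.site_of_lt (M : Model N n) {m : ℕ} (hm : m < n) : M.site (m + 1) = M.bulk (m + 1) := by
  rw [Model.site, if_neg (by omega)]

section Level

variable {M : Model N n} {A : Amplitudes} {Ph : Phases n}

theorem bZero_ne (h : Regular M A Ph) {m : ℕ} (hm : m ≤ n) (σ : Fin m → ZMod N) (k : Fin m) :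
    bZero A m σ k ≠ 0 :=
  mul_ne_zero (neg_ne_zero.2 (h.R_ne m hm _ k.2)) (omegaPow_ne_zero _)

theorem bZero_pow (A : Amplitudes) (m : ℕ) (σ : Fin m → ZMod N) (k : Fin m) (c : ZMod N) :
    (omegaPow c * bZero A m σ k) ^ N = (-1) ^ N * A.R (m + 1) (k + 1) ^ N := by
  rw [bZero, mul_pow, mul_pow, omegaPow_pow, omegaPow_pow, neg_pow]
  ring

theorem R_pow_ne (h : Regular M A Ph) {m : ℕ} (hm : m ≤ n) {i j : Fin m} (hij : i ≠ j) :
    A.R (m + 1) (i + 1) ^ N ≠ A.R (m + 1) (j + 1) ^ N := by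
  intro h0
  have h1 := (h.same m hm i j hij).pow_ne
  rw [xPair, div_pow, h0] at h1
  exact h1 (div_self (pow_ne_zero _ (h.R_ne m hm _ j.2)))

/-- N-th powers forget the indices σ and the powers of ω, and amplitudes with different labels have
different N-th powers. The factors ω^c are needed because raising an index divides its zero by ω. -/
theorem omegaPow_mul_bZero_ne (h : Regular M A Ph) {m : ℕ} (hm : m ≤ n) (σ σ' : Fin m → ZMod N)
    {i j : Fin m} (hij : i ≠ j) (c c' : ZMod N) :
    omegaPow c * bZero A m σ i ≠ omegaPow c' * bZero A m σ' j := by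
  intro h0
  have h1 := congrArg (· ^ N) h0
  simp only [bZero_pow] at h1
  exact R_pow_ne h hm hij (mul_left_cancel₀ (pow_ne_zero _ (by norm_num)) h1)

theorem bZero_injective (h : Regular M A Ph) {m : ℕ} (hm : m ≤ n) (σ : Fin m → ZMod N) :
    Function.Injective (bZero A m σ) := by
  intro i j hij
  by_contra hne
  refine omegaPow_mul_bZero_ne h hm σ σ hne 0 0 ?_
  rw [hij]

theorem Qcommon_succ (M : Model N n) (A : Amplitudes) (Ph : Phases n) (m : ℕ)
    (ρ τ : Fin (m + 1) → ZMod N) :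
    Qcommon M A Ph (m + 1) ρ τ =
      (∏ l : Fin m, ∏ k : Fin (m + 1),
        wPair A Ph (m + 2) (k + 1) (m + 1) (l + 1) (ρ l.succ - τ k)) /
      (∏ l : Fin m, ∏ j ∈ univ.erase l,
        wPair A Ph (m + 1) (l + 1) (m + 1) (j + 1) (ρ j.succ - ρ l.succ)) *
      ∏ l : Fin m, w (xOne M A (m + 1) (l + 1)) (Ph.y (m + 1) (l + 1)) (-ρ l.succ) /
        w (xtOne M A (m + 1) (l + 1)) (Ph.yt (m + 1) (l + 1)) (ρ l.succ) := by
  rw [Qcommon, prod_filter_val_ne_zero, prod_filter_val_ne_zero, prod_filter_val_ne_zero]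
  simp only [prod_filter_val_ne_zero_and_ne, Fin.val_succ]

theorem Qcommon_ne (h : Regular M A Ph) {m : ℕ} (hm : m < n) (ρ τ : Fin (m + 1) → ZMod N) :
    Qcommon M A Ph (m + 1) ρ τ ≠ 0 := by
  rw [Qcommon_succ]
  refine mul_ne_zero (div_ne_zero ?_ ?_) ?_
  · exact prod_ne_zero_iff.2 fun l _ => prod_ne_zero_iff.2 fun k _ => (h.next m hm k l).w_ne _
  · exact prod_ne_zero_iff.2 fun l _ => prod_ne_zero_iff.2 fun j hj =>
      (h.same m hm.le l j (ne_of_mem_erase hj).symm).w_ne _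
  · exact prod_ne_zero_iff.2 fun l _ =>
      div_ne_zero ((h.one m hm l).w_ne _) ((h.tilde_one m hm l).w_ne _)

theorem Qcommon_sub_single_zero (M : Model N n) (A : Amplitudes) (Ph : Phases n) (m : ℕ)
    (ρ τ : Fin (m + 1) → ZMod N) (c : ZMod N) :
    Qcommon M A Ph (m + 1) (ρ - Pi.single 0 c) τ = Qcommon M A Ph (m + 1) ρ τ := by
  rw [Qcommon_succ, Qcommon_succ]
  have : ∀ l : Fin m, (ρ - Pi.single 0 c : Fin (m + 1) → ZMod N) l.succ = ρ l.succ := by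
    intro l
    simp
  simp only [this]

/-- Only the pair functions between levels m + 2 and m + 1 involve τ, and those with index k each go
back by one step. -/
theorem Qcommon_add_single (h : Regular M A Ph) {m : ℕ} (hm : m < n)
    (ρ τ : Fin (m + 1) → ZMod N) (k : Fin (m + 1)) :
    Qcommon M A Ph (m + 1) ρ (τ + Pi.single k 1) = Qcommon M A Ph (m + 1) ρ τ *
      ∏ l : Fin m, ((bZero A (m + 1) τ k - bZero A m (Fin.tail ρ) l) *
        (omegaPow (ρ l.succ) / A.R (m + 1) (l + 1)) / Ph.Y (m + 2) (k + 1) (m + 1) (l + 1)) := by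
  have hl : ∀ l : Fin m, ∏ j : Fin (m + 1),
      wPair A Ph (m + 2) (j + 1) (m + 1) (l + 1) (ρ l.succ - (τ + Pi.single k 1 : Fin (m + 1) → ZMod N) j) =
      (∏ j : Fin (m + 1), wPair A Ph (m + 2) (j + 1) (m + 1) (l + 1) (ρ l.succ - τ j)) *
      ((bZero A (m + 1) τ k - bZero A m (Fin.tail ρ) l) *
        (omegaPow (ρ l.succ) / A.R (m + 1) (l + 1)) / Ph.Y (m + 2) (k + 1) (m + 1) (l + 1)) := by
    intro l
    refine prod_mul_of_eq_off k _ _ _ ?_ ?_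
    · intro j hj
      simp [hj]
    · have e1 : ρ l.succ - (τ + Pi.single k 1 : Fin (m + 1) → ZMod N) k = ρ l.succ - τ k - 1 := by
        simp
        ring
      rw [e1, wPair, wPair, (h.next m hm k l).w_pred, xPair,
        one_sub_omegaPow_mul_div (h.R_ne m hm.le _ l.2)]
      simp only [bZero, Fin.tail]
      ring
  rw [Qcommon_succ, Qcommon_succ]
  simp only [hl, prod_mul_distrib]
  ring

/-- Three groups of factors feel ρ_k: the pairs with the next level, row and column k of the pairs
within the level, and the two one-site functions. In the last group the denominators at p_{m+1,k}
and p̃_{m+1,k} are the two linear factors of F, whence the quotient by F. In row k the zero x_k is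
replaced by ωx_k. -/
theorem Qcommon_sub_single (h : Regular M A Ph) {m : ℕ} (hm : m < n)
    (ρ τ : Fin (m + 1) → ZMod N) (k : Fin m) :
    Qcommon M A Ph (m + 1) (ρ - Pi.single k.succ 1) τ = Qcommon M A Ph (m + 1) ρ τ *
      ((∏ j : Fin (m + 1), ((bZero A m (Fin.tail ρ) k - bZero A (m + 1) τ j) *
        (-(omegaPow (ρ k.succ) / A.R (m + 1) (k + 1))) / Ph.Y (m + 2) (j + 1) (m + 1) (k + 1))) /
      (∏ l ∈ univ.erase k, (((bZero A m (Fin.tail ρ) k - bZero A m (Fin.tail ρ) l) *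
        (-(omegaPow (ρ k.succ) / A.R (m + 1) (k + 1))) / Ph.Y (m + 1) (l + 1) (m + 1) (k + 1)) *
        (Ph.Y (m + 1) (k + 1) (m + 1) (l + 1) * -bZero A m (Fin.tail ρ) l /
          (omega N * bZero A m (Fin.tail ρ) k - bZero A m (Fin.tail ρ) l)))) *
      (Ph.y (m + 1) (k + 1) * Ph.yt (m + 1) (k + 1) * (M.bulk (m + 1)).b * (M.bulk (m + 1)).c *
        bZero A m (Fin.tail ρ) k / M.F (m + 1) (bZero A m (Fin.tail ρ) k))) := by
  have hoff : ∀ l : Fin m, l ≠ k →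
      (ρ - Pi.single k.succ 1 : Fin (m + 1) → ZMod N) l.succ = ρ l.succ := by
    intro l hl
    simp [hl]
  have hon : (ρ - Pi.single k.succ 1 : Fin (m + 1) → ZMod N) k.succ = ρ k.succ - 1 := by
    simp
  have hR := fun l : Fin m => h.R_ne m hm.le (l + 1) l.2
  have h1 : (∏ l : Fin m, ∏ j : Fin (m + 1), wPair A Ph (m + 2) (j + 1) (m + 1) (l + 1)
        ((ρ - Pi.single k.succ 1 : Fin (m + 1) → ZMod N) l.succ - τ j)) =
      (∏ l : Fin m, ∏ j : Fin (m + 1),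
        wPair A Ph (m + 2) (j + 1) (m + 1) (l + 1) (ρ l.succ - τ j)) *
      ∏ j : Fin (m + 1), ((bZero A m (Fin.tail ρ) k - bZero A (m + 1) τ j) *
        (-(omegaPow (ρ k.succ) / A.R (m + 1) (k + 1))) /
          Ph.Y (m + 2) (j + 1) (m + 1) (k + 1)) := by
    refine prod_mul_of_eq_off k _ _ _ ?_ ?_
    · intro l hl
      simp only [hoff l hl]
    · rw [hon, ← prod_mul_distrib]
      refine prod_congr rfl fun j _ => ?_
      rw [show ρ k.succ - 1 - τ j = ρ k.succ - τ j - 1 by ring, wPair, wPair,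
        (h.next m hm j k).w_pred, xPair, one_sub_omegaPow_mul_div (hR k)]
      simp only [bZero, Fin.tail]
      ring
  have h2 := prod_offDiag_of_eq_off k
    (fun l j : Fin m => wPair A Ph (m + 1) (l + 1) (m + 1) (j + 1) (ρ j.succ - ρ l.succ))
    (fun l j : Fin m => wPair A Ph (m + 1) (l + 1) (m + 1) (j + 1)
      ((ρ - Pi.single k.succ 1 : Fin (m + 1) → ZMod N) j.succ -
        (ρ - Pi.single k.succ 1 : Fin (m + 1) → ZMod N) l.succ))
    (fun l => (bZero A m (Fin.tail ρ) k - bZero A m (Fin.tail ρ) l) *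
        (-(omegaPow (ρ k.succ) / A.R (m + 1) (k + 1))) / Ph.Y (m + 1) (l + 1) (m + 1) (k + 1))
    (fun l => Ph.Y (m + 1) (k + 1) (m + 1) (l + 1) * -bZero A m (Fin.tail ρ) l /
          (omega N * bZero A m (Fin.tail ρ) k - bZero A m (Fin.tail ρ) l))
    (by
      intro l j hl hj
      simp only [hoff l hl, hoff j hj])
    (by
      intro l hl
      simp only [hon, hoff l hl]
      rw [show ρ k.succ - 1 - ρ l.succ = ρ k.succ - ρ l.succ - 1 by ring, wPair, wPair,
        (h.same m hm.le l k hl).w_pred, xPair, one_sub_omegaPow_mul_div (hR k)]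
      simp only [bZero, Fin.tail]
      ring)
    (by
      intro l hl
      simp only [hon, hoff l hl]
      rw [show ρ l.succ - (ρ k.succ - 1) = ρ l.succ - ρ k.succ + 1 by ring, wPair, wPair,
        (h.same m hm.le k l hl.symm).w_succ]
      congr 1
      have hne := omegaPow_mul_bZero_ne h hm.le (Fin.tail ρ) (Fin.tail ρ) hl.symm 1 0
      rw [omegaPow_zero, one_mul, omegaPow_one] at hne
      have h0 : 1 - omegaPow (ρ l.succ - ρ k.succ + 1) *
          xPair A (m + 1) (k + 1) (m + 1) (l + 1) =
          (omega N * bZero A m (Fin.tail ρ) k - bZero A m (Fin.tail ρ) l) *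
            (omegaPow (ρ l.succ) / A.R (m + 1) (l + 1)) := by
        rw [xPair, show ρ l.succ - ρ k.succ + 1 = ρ l.succ - (ρ k.succ - 1) by ring,
          one_sub_omegaPow_mul_div (hR l), show -(ρ k.succ - 1) = -ρ k.succ + 1 by ring,
          omegaPow_add, omegaPow_one]
        simp only [bZero, Fin.tail]
        ring
      rw [h0]
      have := sub_ne_zero.2 hne
      have := hR l
      have := omegaPow_ne_zero (ρ l.succ)
      have e2 : -bZero A m (Fin.tail ρ) l = A.R (m + 1) (l + 1) / omegaPow (ρ l.succ) := by
        rw [bZero, omegaPow_neg, Fin.tail]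
        ring
      rw [e2]
      field_simp)
  have h3 : (∏ l : Fin m, w (xOne M A (m + 1) (l + 1)) (Ph.y (m + 1) (l + 1))
          (-(ρ - Pi.single k.succ 1 : Fin (m + 1) → ZMod N) l.succ) /
        w (xtOne M A (m + 1) (l + 1)) (Ph.yt (m + 1) (l + 1))
          ((ρ - Pi.single k.succ 1 : Fin (m + 1) → ZMod N) l.succ)) =
      (∏ l : Fin m, w (xOne M A (m + 1) (l + 1)) (Ph.y (m + 1) (l + 1)) (-ρ l.succ) /
        w (xtOne M A (m + 1) (l + 1)) (Ph.yt (m + 1) (l + 1)) (ρ l.succ)) *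
      (Ph.y (m + 1) (k + 1) * Ph.yt (m + 1) (k + 1) * (M.bulk (m + 1)).b * (M.bulk (m + 1)).c *
        bZero A m (Fin.tail ρ) k / M.F (m + 1) (bZero A m (Fin.tail ρ) k)) := by
    refine prod_mul_of_eq_off k _ _ _ ?_ ?_
    · intro l hl
      simp only [hoff l hl]
    · rw [hon, show -(ρ k.succ - 1) = -ρ k.succ + 1 by ring, (h.one m hm k).w_succ,
        (h.tilde_one m hm k).w_pred]
      have n1 := (h.one m hm k).sub_ne (-ρ k.succ + 1)
      have n2 := (h.tilde_one m hm k).sub_ne (ρ k.succ)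
      have n3 := (h.tilde_one m hm k).w_ne (ρ k.succ)
      have n4 := (h.tilde_one m hm k).ne
      have n5 := h.a_ne m hm
      have n6 := h.b_ne m hm
      have n7 := h.c_ne m hm
      have n8 := h.kap_ne m hm
      have n9 := hR k
      have n10 := omegaPow_ne_zero (ρ k.succ)
      have e1 : M.F (m + 1) (bZero A m (Fin.tail ρ) k) =
          (M.bulk (m + 1)).b * (1 - omegaPow (-ρ k.succ + 1) * xOne M A (m + 1) (k + 1)) *
          ((M.bulk (m + 1)).c * bZero A m (Fin.tail ρ) k *
            (1 - omegaPow (ρ k.succ) * xtOne M A (m + 1) (k + 1))) := by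
        rw [Model.F, M.site_of_lt hm, xOne, xtOne, bZero, Fin.tail, omegaPow_add, omegaPow_one,
          omegaPow_neg]
        field_simp
        ring
      have n11 := bZero_ne h hm.le (Fin.tail ρ) k
      rw [e1]
      field_simp
  rw [Qcommon_succ, Qcommon_succ, h1, h2, h3]
  ring

/-- The coefficient in `A_{m+1}(λ_k) Ψ_ρ = φ_k(ρ) Ψ_{ρ + e_k}`. -/
def phiA (M : Model N n) (A : Amplitudes) (Ph : Phases n) (m : ℕ) (σ : Fin m → ZMod N)
    (k : Fin m) : ℂ :=
  -M.F (m + 1) (bZero A m σ k / omega N) * A.rt m *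
    (∏ i ∈ Icc 1 (m - 1), Ph.Y (m + 1) (k + 1) m i) * omegaPow (-∑ j, σ j) / A.r (m + 1)

theorem bZero_sub_single_self (A : Amplitudes) (m : ℕ) (σ : Fin m → ZMod N) (k : Fin m) :
    bZero A m (σ - Pi.single k 1) k = omega N * bZero A m σ k := by
  simp only [bZero, Pi.sub_apply, Pi.single_eq_same]
  rw [show -(σ k - 1) = -σ k + 1 by ring, omegaPow_add, omegaPow_one]
  ring

theorem bZero_sub_single_of_ne (A : Amplitudes) (m : ℕ) (σ : Fin m → ZMod N) {k l : Fin m}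
    (hl : l ≠ k) : bZero A m (σ - Pi.single k 1) l = bZero A m σ l := by
  simp [bZero, hl]

theorem bZero_add_single_self (A : Amplitudes) (m : ℕ) (σ : Fin m → ZMod N) (k : Fin m) :
    bZero A m (σ + Pi.single k 1) k = bZero A m σ k / omega N := by
  simp only [bZero, Pi.add_apply, Pi.single_eq_same]
  rw [show -(σ k + 1) = -σ k - 1 by ring, omegaPow_sub, omegaPow_one]
  ring

omit [NeZero N] in
theorem tail_sub_single (m : ℕ) (ρ : Fin (m + 1) → ZMod N) (k : Fin m) :
    Fin.tail (ρ - Pi.single k.succ 1) = Fin.tail ρ - Pi.single k 1 := by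
  funext l
  simp [Fin.tail, Pi.single_apply]

theorem phiA_sub_single (M : Model N n) (A : Amplitudes) (Ph : Phases n) (m : ℕ)
    (σ : Fin m → ZMod N) (k : Fin m) :
    phiA M A Ph m (σ - Pi.single k 1) k = -M.F (m + 1) (bZero A m σ k) * A.rt m *
      (∏ i ∈ Icc 1 (m - 1), Ph.Y (m + 1) (k + 1) m i) * (omega N * omegaPow (-∑ j, σ j)) /
        A.r (m + 1) := by
  have h1 : -∑ j, (σ - Pi.single k 1 : Fin m → ZMod N) j = 1 + -∑ j, σ j := by
    simp
    ring
  rw [phiA, bZero_sub_single_self, mul_div_cancel_left₀ _ omega_ne_zero, h1, omegaPow_add,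
    omegaPow_one]

theorem F_bZero_ne (h : Regular M A Ph) {m : ℕ} (hm : m < n) (σ : Fin m → ZMod N) (k : Fin m) :
    M.F (m + 1) (bZero A m σ k) ≠ 0 := by
  have n1 := (h.one m hm k).sub_ne (-σ k + 1)
  have n2 := (h.tilde_one m hm k).sub_ne (σ k)
  have n5 := h.a_ne m hm
  have n6 := h.b_ne m hm
  have n7 := h.c_ne m hm
  have n8 := h.kap_ne m hm
  have n9 := h.R_ne m hm.le _ k.2
  have n10 := omegaPow_ne_zero (σ k)
  have e1 : M.F (m + 1) (bZero A m σ k) =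
      (M.bulk (m + 1)).b * (1 - omegaPow (-σ k + 1) * xOne M A (m + 1) (k + 1)) *
      ((M.bulk (m + 1)).c * bZero A m σ k *
        (1 - omegaPow (σ k) * xtOne M A (m + 1) (k + 1))) := by
    rw [Model.F, M.site_of_lt hm, xOne, xtOne, bZero, omegaPow_add, omegaPow_one,
      omegaPow_neg]
    field_simp
    ring
  rw [e1]
  exact mul_ne_zero (mul_ne_zero n6 n1) (mul_ne_zero (mul_ne_zero n7 (bZero_ne h hm.le σ k)) n2)

/-- The residue condition `h2` of `Level.sum_A_eq`, before the exponential prefactor is included.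
The differences of zeros and the value of F cancel between the shift of the coefficient and `phiA`;
the constants that remain are balanced by the phase relation `rel`. -/
theorem Qcommon_mul_phiA (h : Regular M A Ph) {m : ℕ} (hm : m < n)
    (ρ τ : Fin (m + 1) → ZMod N) (k : Fin m) :
    Qcommon M A Ph (m + 1) (ρ - Pi.single k.succ 1) τ *
        (A.r (m + 2) * phiA M A Ph m (Fin.tail ρ - Pi.single k 1) k /
          (omega N * bZero A m (Fin.tail ρ) k *
            ∏ l ∈ univ.erase k, (omega N * bZero A m (Fin.tail ρ) k - bZero A m (Fin.tail ρ) l))) =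
      Qcommon M A Ph (m + 1) ρ τ *
        (A.R (m + 2) 0 * (∏ j, (bZero A m (Fin.tail ρ) k - bZero A (m + 1) τ j)) /
          (bZero A m (Fin.tail ρ) k *
            ∏ l ∈ univ.erase k, (bZero A m (Fin.tail ρ) k - bZero A m (Fin.tail ρ) l))) := by
  rw [Qcommon_sub_single h hm, phiA_sub_single, mul_assoc]
  congr 1
  set σ := Fin.tail ρ with hσ
  have hF := F_bZero_ne h hm σ k
  have hz := bZero_ne h hm.le σ k
  have hRk := h.R_ne m hm.le _ k.2
  have hR0 := h.R_ne m hm.le 0 (by omega)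
  have hr := h.r_ne m hm.le
  have hE := omegaPow_ne_zero (ρ k.succ)
  have hω := omega_ne_zero (N := N)
  have hcard : (univ.erase k).card = m - 1 := by simp
  -- There are m + 1 pairs with the next level against m − 1 pairs within the level, so the common
  -- scalar survives to the power 2.
  have hmpos : m - 1 + 2 = m + 1 := by have := k.2; omega
  have e1 : ∏ j : Fin (m + 1), ((bZero A m σ k - bZero A (m + 1) τ j) *
        (-(omegaPow (ρ k.succ) / A.R (m + 1) (k + 1))) / Ph.Y (m + 2) (j + 1) (m + 1) (k + 1)) =
      (∏ j, (bZero A m σ k - bZero A (m + 1) τ j)) *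
        ((-(omegaPow (ρ k.succ) / A.R (m + 1) (k + 1))) ^ (m - 1) *
          (-(omegaPow (ρ k.succ) / A.R (m + 1) (k + 1))) ^ 2) /
        ∏ j : Fin (m + 1), Ph.Y (m + 2) (j + 1) (m + 1) (k + 1) := by
    rw [prod_div_distrib, prod_mul_distrib, prod_const, ← pow_add, hmpos]
    simp
  have e2 : ∏ l ∈ univ.erase k, (((bZero A m σ k - bZero A m σ l) *
        (-(omegaPow (ρ k.succ) / A.R (m + 1) (k + 1))) / Ph.Y (m + 1) (l + 1) (m + 1) (k + 1)) *
        (Ph.Y (m + 1) (k + 1) (m + 1) (l + 1) * -bZero A m σ l /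
          (omega N * bZero A m σ k - bZero A m σ l))) =
      (∏ l ∈ univ.erase k, (bZero A m σ k - bZero A m σ l)) *
        (-(omegaPow (ρ k.succ) / A.R (m + 1) (k + 1))) ^ (m - 1) /
        (∏ l ∈ univ.erase k, Ph.Y (m + 1) (l + 1) (m + 1) (k + 1)) *
        ((∏ l ∈ univ.erase k, Ph.Y (m + 1) (k + 1) (m + 1) (l + 1)) *
          ((∏ l ∈ univ.erase k, A.R (m + 1) (l + 1)) / ∏ l ∈ univ.erase k, omegaPow (σ l)) /
        ∏ l ∈ univ.erase k, (omega N * bZero A m σ k - bZero A m σ l)) := by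
    rw [prod_mul_distrib, prod_div_distrib, prod_mul_distrib, prod_const, hcard,
      prod_div_distrib, prod_mul_distrib]
    congr 4
    rw [← prod_div_distrib]
    refine prod_congr rfl fun l _ => ?_
    rw [bZero, omegaPow_neg]
    ring
  have e3 : omegaPow (-∑ j, σ j) =
      (omegaPow (ρ k.succ) * ∏ l ∈ univ.erase k, omegaPow (σ l))⁻¹ := by
    rw [omegaPow_neg, omegaPow_sum, ← mul_prod_erase univ _ (mem_univ k)]
    rfl
  have e4 : A.rt (m + 1) = A.R (m + 1) 0 *
      (A.R (m + 1) (k + 1) * ∏ l ∈ univ.erase k, A.R (m + 1) (l + 1)) := by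
    rw [A.rt_succ, ← mul_prod_erase univ _ (mem_univ k)]
  have hrel := h.rel m hm k
  have ez : bZero A m σ k = -A.R (m + 1) (k + 1) / omegaPow (ρ k.succ) := by
    rw [bZero, omegaPow_neg, hσ, Fin.tail, div_eq_mul_inv]
  have p1 : ∏ j : Fin (m + 1), Ph.Y (m + 2) (j + 1) (m + 1) (k + 1) ≠ 0 :=
    prod_ne_zero_iff.2 fun j _ => (h.next m hm j k).ne
  have p2 : ∏ l ∈ univ.erase k, Ph.Y (m + 1) (l + 1) (m + 1) (k + 1) ≠ 0 :=
    prod_ne_zero_iff.2 fun l hl => (h.same m hm.le l k (ne_of_mem_erase hl)).ne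
  have p3 : ∏ l ∈ univ.erase k, Ph.Y (m + 1) (k + 1) (m + 1) (l + 1) ≠ 0 :=
    prod_ne_zero_iff.2 fun l hl => (h.same m hm.le k l (ne_of_mem_erase hl).symm).ne
  have p4 : ∏ l ∈ univ.erase k, A.R (m + 1) (l + 1) ≠ 0 :=
    prod_ne_zero_iff.2 fun l _ => h.R_ne m hm.le _ l.2
  have p5 : ∏ l ∈ univ.erase k, omegaPow (σ l) ≠ 0 :=
    prod_ne_zero_iff.2 fun l _ => omegaPow_ne_zero _
  have p6 : ∏ l ∈ univ.erase k, (omega N * bZero A m σ k - bZero A m σ l) ≠ 0 := by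
    refine prod_ne_zero_iff.2 fun l hl => sub_ne_zero.2 ?_
    have := omegaPow_mul_bZero_ne h hm.le σ σ (ne_of_mem_erase hl).symm 1 0
    rwa [omegaPow_one, omegaPow_zero, one_mul] at this
  have p7 : ∏ l ∈ univ.erase k, (bZero A m σ k - bZero A m σ l) ≠ 0 :=
    prod_ne_zero_iff.2 fun l hl => sub_ne_zero.2 fun h0 =>
      ne_of_mem_erase hl (bZero_injective h hm.le σ h0).symm
  rw [e1, e2, e3]
  rw [e4] at hrel
  have hpow : (-(omegaPow (ρ k.succ) / A.R (m + 1) (k + 1))) ^ (m - 1) ≠ 0 :=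
    pow_ne_zero _ (neg_ne_zero.2 (div_ne_zero hE hRk))
  generalize (-(omegaPow (ρ k.succ) / A.R (m + 1) (k + 1))) ^ (m - 1) = W at *
  generalize ∏ j : Fin (m + 1), Ph.Y (m + 2) (j + 1) (m + 1) (k + 1) = W1 at *
  generalize ∏ l ∈ univ.erase k, Ph.Y (m + 1) (l + 1) (m + 1) (k + 1) = W2 at *
  generalize ∏ l ∈ univ.erase k, Ph.Y (m + 1) (k + 1) (m + 1) (l + 1) = W3 at *
  generalize ∏ l ∈ univ.erase k, A.R (m + 1) (l + 1) = W4 at *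
  generalize ∏ l ∈ univ.erase k, omegaPow (σ l) = W5 at *
  generalize ∏ l ∈ univ.erase k, (omega N * bZero A m σ k - bZero A m σ l) = W6 at *
  generalize ∏ l ∈ univ.erase k, (bZero A m σ k - bZero A m σ l) = W7 at *
  generalize ∏ j, (bZero A m σ k - bZero A (m + 1) τ j) = W8 at *
  generalize M.F (m + 1) (bZero A m σ k) = W9 at *
  generalize ∏ i ∈ Icc 1 (m - 1), Ph.Y (m + 1) (k + 1) m i = W10 at *
  rw [ez]
  field_simp
  -- The phase relation carries R_{m+1,0} on both sides, once inside r̃_{m+1}.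
  refine mul_left_cancel₀ hR0 ?_
  linear_combination W8 * hrel

end Level

end

section

/-! ### Polynomial families in an algebra -/

section Ends

variable {E : Type*} [Ring E] [Algebra ℂ E]

/-- `f` is polynomial of degree at most `m`, with constant coefficient `c₀` and coefficient `c₁`
in degree `m`. -/
def HasEnds (m : ℕ) (f : ℂ → E) (c₀ c₁ : E) : Prop :=
  ∃ p : E[X], p.natDegree ≤ m ∧ p.coeff 0 = c₀ ∧ p.coeff m = c₁ ∧
    ∀ t, f t = p.eval (algebraMap ℂ E t)

theorem HasEnds.add {m : ℕ} {f g : ℂ → E} {c₀ c₁ d₀ d₁ : E} (hf : HasEnds m f c₀ c₁)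
    (hg : HasEnds m g d₀ d₁) : HasEnds m (fun t => f t + g t) (c₀ + d₀) (c₁ + d₁) := by
  obtain ⟨p, hp, p0, p1, hpe⟩ := hf
  obtain ⟨q, hq, q0, q1, hqe⟩ := hg
  refine ⟨p + q, natDegree_add_le_of_degree_le hp hq, ?_, ?_, fun t => ?_⟩
  · rw [coeff_add, p0, q0]
  · rw [coeff_add, p1, q1]
  · change f t + g t = _
    rw [eval_add, hpe, hqe]

theorem HasEnds.mul {k m : ℕ} {f g : ℂ → E} {c₀ c₁ d₀ d₁ : E} (hf : HasEnds k f c₀ c₁)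
    (hg : HasEnds m g d₀ d₁) : HasEnds (k + m) (fun t => f t * g t) (c₀ * d₀) (c₁ * d₁) := by
  obtain ⟨p, hp, p0, p1, hpe⟩ := hf
  obtain ⟨q, hq, q0, q1, hqe⟩ := hg
  refine ⟨p * q, natDegree_mul_le.trans (add_le_add hp hq), ?_, ?_, fun t => ?_⟩
  · rw [mul_coeff_zero, p0, q0]
  · rw [coeff_mul_add_eq_of_natDegree_le hp hq, p1, q1]
  · change f t * g t = _
    rw [hpe, hqe]
    -- Scalars are central in E, so evaluation at a scalar is multiplicative although E is not
    -- commutative.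
    exact (eval₂_mul_noncomm _ _ fun _ => (Algebra.commutes _ _).symm).symm

theorem HasEnds.linear (c₀ c₁ : E) : HasEnds 1 (fun t => c₀ + t • c₁) c₀ c₁ := by
  refine ⟨C c₀ + C c₁ * X, ?_, by simp, by simp [coeff_C], fun t => ?_⟩
  · exact natDegree_add_le_of_degree_le (by simp)
      ((natDegree_C_mul_le _ _).trans natDegree_X_le)
  · change c₀ + t • c₁ = _
    rw [eval_add, eval_C, eval_C_mul, eval_X, Algebra.smul_def, Algebra.commutes]

theorem HasEnds.const (c : E) : HasEnds 0 (fun _ => c) c c :=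
  ⟨C c, by simp, by simp, by simp, fun t => by simp⟩

theorem HasEnds.congr {m : ℕ} {f g : ℂ → E} {c₀ c₁ d₀ d₁ : E} (hf : HasEnds m f c₀ c₁)
    (h : ∀ t, g t = f t) (h₀ : d₀ = c₀) (h₁ : d₁ = c₁) : HasEnds m g d₀ d₁ := by
  rw [show g = f from funext h, h₀, h₁]
  exact hf

/-- Interpolation of a polynomial family from its outer coefficients and its values at the
points `x k`. -/
theorem HasEnds.interpolation {ι : Type*} [Fintype ι] [DecidableEq ι] {x : ι → ℂ}
    (hx : Function.Injective x) (hx0 : ∀ k, x k ≠ 0) {f : ℂ → E} {c₀ c₁ : E}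
    (hf : HasEnds (Fintype.card ι + 1) f c₀ c₁) (t : ℂ) :
    f t = (t * ∏ k, (t - x k)) • c₁ + ((∏ k, (t - x k)) / ∏ k, (-x k)) • c₀ +
      ∑ k, ((t / x k) *
        ((∏ l ∈ univ.erase k, (t - x l)) / ∏ l ∈ univ.erase k, (x k - x l))) • f (x k) := by
  obtain ⟨p, hp, p0, p1, hpe⟩ := hf
  set h := Fintype.card ι
  have hexp : ∀ t, f t = ∑ i ∈ range (h + 2), t ^ i • p.coeff i := by
    intro t
    rw [hpe, eval_eq_sum_range' (lt_of_le_of_lt hp (Nat.lt_succ_self (h + 1)))]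
    refine sum_congr rfl fun i _ => ?_
    rw [← map_pow, ← Algebra.commutes, Algebra.smul_def]
  have hterm : ∀ i ∈ range (h + 2), t ^ i • p.coeff i =
      (if i = h + 1 then (t * ∏ k, (t - x k)) • p.coeff i else 0) +
      (if i = 0 then ((∏ k, (t - x k)) / ∏ k, (-x k)) • p.coeff i else 0) +
      ∑ k, ((t / x k) *
        ((∏ l ∈ univ.erase k, (t - x l)) / ∏ l ∈ univ.erase k, (x k - x l))) •
          (x k ^ i • p.coeff i) := by
    intro i hi
    -- The operator formula is linear in the coefficients of the polynomial, so it follows from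
    -- scalar interpolation of each monomial.
    have h1 := eval_eq_interpolation x hx hx0 (X ^ i) (by
      rw [natDegree_X_pow]
      have := mem_range.1 hi
      omega) t
    simp only [eval_pow, eval_X, coeff_X_pow] at h1
    rw [h1]
    simp only [smul_smul, ← sum_smul, add_smul]
    congr 1
    · congr 1
      · by_cases hh : i = h + 1
        · rw [if_pos hh, if_pos hh.symm, one_mul]
        · rw [if_neg hh, if_neg (Ne.symm hh), zero_mul, zero_smul]
      · by_cases hh : i = 0
        · rw [if_pos hh, if_pos hh.symm, one_mul]
        · rw [if_neg hh, if_neg (Ne.symm hh), zero_mul, zero_smul]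
    · congr 1
      exact sum_congr rfl fun k _ => mul_comm _ _
  rw [hexp t, sum_congr rfl hterm, sum_add_distrib, sum_add_distrib, sum_comm]
  simp only [sum_ite_eq', mem_range, ← smul_sum, ← hexp]
  rw [if_pos (by omega), if_pos (by omega), p0, p1]

/-- The shape of a product of `L`-matrices as a function of the spectral parameter. -/
structure MatEnds (m : ℕ) (T : ℂ → Matrix (Fin 2) (Fin 2) E) (K Q : E) : Prop where
  a : HasEnds m (fun t => T t 0 0) 1 K
  b : ∃ x, HasEnds m (fun t => T t 0 1) 0 x
  c : ∃ x, HasEnds m (fun t => T t 1 0) x 0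
  d : ∃ x, HasEnds m (fun t => T t 1 1) x Q

/-- The upper right entries vanish at t = 0 and the lower left ones have zero top coefficient. Hence
the mixed products contribute neither to the outer coefficients of A nor to the top coefficient of
D, and both vanishing properties persist. -/
theorem MatEnds.mul {m : ℕ} {L T : ℂ → Matrix (Fin 2) (Fin 2) E} {k q K Q : E}
    (hL : MatEnds 1 L k q) (hT : MatEnds m T K Q) :
    MatEnds (m + 1) (fun t => L t * T t) (k * K) (q * Q) := by
  obtain ⟨a1, ⟨_, b1⟩, ⟨_, c1⟩, ⟨_, d1⟩⟩ := hL
  obtain ⟨a2, ⟨_, b2⟩, ⟨_, c2⟩, ⟨_, d2⟩⟩ := hT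
  have he : ∀ i j t, (L t * T t) i j = L t i 0 * T t 0 j + L t i 1 * T t 1 j := fun i j t => by
    rw [Matrix.mul_apply, Fin.sum_univ_two]
  rw [add_comm m 1]
  exact ⟨((a1.mul a2).add (b1.mul c2)).congr (he 0 0) (by simp) (by simp),
    ⟨_, ((a1.mul b2).add (b1.mul d2)).congr (he 0 1) (by simp) rfl⟩,
    ⟨_, ((c1.mul a2).add (d1.mul c2)).congr (he 1 0) rfl (by simp)⟩,
    ⟨_, ((c1.mul b2).add (d1.mul d2)).congr (he 1 1) rfl (by simp)⟩⟩

theorem MatEnds.list_prod {ι : Type*} {L : ι → ℂ → Matrix (Fin 2) (Fin 2) E} {k q : ι → E}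
    (hL : ∀ i, MatEnds 1 (L i) (k i) (q i)) (l : List ι) :
    MatEnds l.length (fun t => (l.map fun i => L i t).prod) (l.map k).prod (l.map q).prod := by
  induction l with
  | nil =>
    simp only [List.map_nil, List.prod_nil, List.length_nil]
    exact ⟨HasEnds.const 1, ⟨0, HasEnds.const 0⟩, ⟨0, HasEnds.const 0⟩, ⟨1, HasEnds.const 1⟩⟩
  | cons i l ih =>
    simp only [List.map_cons, List.prod_cons, List.length_cons]
    exact (hL i).mul ih

end Ends

/-! ### The quantum determinant -/

section QuantumDet

variable {E : Type*} [Ring E] [Algebra ℂ E]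

/-- The matrix `((0, 1), (-q, 0))`. -/
def detForm (q : ℂ) : Matrix (Fin 2) (Fin 2) ℂ := !![0, 1; -q, 0]

/-- `x J x'ᵀ = w J` for `J = detForm q`. -/
def QuantumDet (q : ℂ) (x x' : Matrix (Fin 2) (Fin 2) E) (w : E) : Prop :=
  ∀ i j, x i 0 * x' j 1 - q • (x i 1 * x' j 0) = detForm q i j • w

/-- When x' commutes with y, the expression (xy) J (x'y')ᵀ can be regrouped as x (y J y'ᵀ) x'ᵀ, and
the two identities apply one after the other. -/
theorem QuantumDet.mul {q : ℂ} {x x' y y' : Matrix (Fin 2) (Fin 2) E} {w z : E}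
    (hx : QuantumDet q x x' w) (hy : QuantumDet q y y' z)
    (hc : ∀ i j k l, Commute (x' i j) (y k l)) : QuantumDet q (x * y) (x' * y') (w * z) := by
  intro i j
  have key : (x * y) i 0 * (x' * y') j 1 - q • ((x * y) i 1 * (x' * y') j 0) =
      ∑ a, ∑ b, x i a * x' j b * (y a 0 * y' b 1 - q • (y a 1 * y' b 0)) := by
    simp only [Matrix.mul_apply, Fin.sum_univ_two]
    have sw : ∀ a b k l : Fin 2, ∀ u v : E, u * y a k * (x' b l * v) = u * x' b l * (y a k * v) := by
      intro a b k l u v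
      rw [mul_assoc, ← mul_assoc (y a k), ← (hc b l a k).eq]
      simp only [mul_assoc]
    simp only [add_mul, mul_add, sw, mul_sub, mul_smul_comm, smul_add]
    abel
  rw [key]
  have h1 : ∀ a b, y a 0 * y' b 1 - q • (y a 1 * y' b 0) = detForm q a b • z := hy
  have d00 : detForm q 0 0 = 0 := rfl
  have d01 : detForm q 0 1 = 1 := rfl
  have d10 : detForm q 1 0 = -q := rfl
  have d11 : detForm q 1 1 = 0 := rfl
  rw [← smul_mul_assoc, ← hx i j]
  simp only [h1, Fin.sum_univ_two, d00, d01, d10, d11, zero_smul, zero_add, one_smul,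
    add_zero, neg_smul, mul_smul_comm, sub_mul, smul_mul_assoc]
  rw [sub_eq_add_neg]

theorem QuantumDet.list_prod {ι : Type*} {q : ℂ} {x x' : ι → Matrix (Fin 2) (Fin 2) E} {w : ι → E}
    (h : ∀ i, QuantumDet q (x i) (x' i) (w i))
    (hc : ∀ p r, p ≠ r → ∀ i j k l, Commute (x' p i j) (x r k l)) {l : List ι} (hl : l.Nodup) :
    QuantumDet q (l.map x).prod (l.map x').prod (l.map w).prod := by
  induction l with
  | nil =>
    intro i j
    fin_cases i <;> fin_cases j <;> simp [detForm]
  | cons a l ih =>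
    simp only [List.map_cons, List.prod_cons]
    rw [List.nodup_cons] at hl
    refine (h a).mul (ih hl.2) ?_
    have : ∀ l' : List ι, a ∉ l' → ∀ i j k r, Commute (x' a i j) ((l'.map x).prod k r) := by
      intro l'
      induction l' with
      | nil =>
        intro _ i j k r
        simp only [List.map_nil, List.prod_nil, Matrix.one_apply]
        split_ifs
        · exact Commute.one_right _
        · exact Commute.zero_right _
      | cons b l' ih' =>
        intro hb i j k r
        rw [List.mem_cons, not_or] at hb
        simp only [List.map_cons, List.prod_cons, Matrix.mul_apply, Fin.sum_univ_two]
        exact ((hc a b hb.1 _ _ _ _).mul_right (ih' hb.2 _ _ _ _)).add_right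
          ((hc a b hb.1 _ _ _ _).mul_right (ih' hb.2 _ _ _ _))
    exact this l hl.1

/-- Moving V across a factor amounts to conjugation by the scalar diagonal matrix of δ, which is
compatible with matrix multiplication. -/
theorem twist_list_prod {ι : Type*} {x : ι → Matrix (Fin 2) (Fin 2) E} {V : E} {δ : Fin 2 → ℂ}
    (h : ∀ p i j, δ j • (x p i j * V) = δ i • (V * x p i j)) (l : List ι) (i j : Fin 2) :
    δ j • ((l.map x).prod i j * V) = δ i • (V * (l.map x).prod i j) := by
  induction l generalizing i with
  | nil =>
    simp only [List.map_nil, List.prod_nil, Matrix.one_apply]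
    split_ifs with hij
    · rw [hij, one_mul, mul_one]
    · simp
  | cons a l ih =>
    simp only [List.map_cons, List.prod_cons, Matrix.mul_apply, sum_mul, mul_sum, smul_sum]
    refine sum_congr rfl fun k _ => ?_
    rw [mul_assoc, ← mul_smul_comm, ih k, mul_smul_comm, ← mul_assoc, ← smul_mul_assoc, h a i k,
      smul_mul_assoc, mul_assoc]

end QuantumDet

end

section

/-! ### `L`-operators on a chain and on a single site -/

section Chain

variable {N : ℕ} {m : ℕ}

@[simp] theorem vOp_apply (k : Fin m) (f : State N m) (γ : Fin m → ZMod N) :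
    vOp k f γ = f (Function.update γ k (γ k - 1)) := rfl

/-- The product `v_1 ⋯ v_m`. -/
def vAll (N m : ℕ) : Module.End ℂ (State N m) where
  toFun f := fun γ => f (fun k => γ k - 1)
  map_add' _ _ := rfl
  map_smul' _ _ := rfl

@[simp] theorem vAll_apply (f : State N m) (γ : Fin m → ZMod N) :
    vAll N m f γ = f (fun k => γ k - 1) := rfl

theorem vAll_injective : Function.Injective (vAll N m) := by
  intro f g h
  funext γ
  have := congrFun h (fun k => γ k + 1)
  simpa using this

theorem list_prod_vOp (c : Fin m → ℂ) {l : List (Fin m)} (hl : l.Nodup) (f : State N m)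
    (γ : Fin m → ZMod N) :
    (l.map fun k => c k • vOp (N := N) k).prod f γ =
      (l.map c).prod * f (fun k => if k ∈ l then γ k - 1 else γ k) := by
  induction l generalizing γ with
  | nil => simp
  | cons a l ih =>
    rw [List.nodup_cons] at hl
    simp only [List.map_cons, List.prod_cons]
    rw [Module.End.mul_apply, LinearMap.smul_apply, Pi.smul_apply, vOp_apply, ih hl.2, smul_eq_mul,
      mul_assoc]
    congr 3
    funext k
    by_cases hk : k = a
    · subst hk
      simp [hl.1]
    · simp [hk]

theorem prod_ofFn_vOp (c : Fin m → ℂ) :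
    ((List.finRange m).map fun k => c k • vOp (N := N) k).prod = (∏ k, c k) • vAll N m := by
  refine LinearMap.ext fun f => funext fun γ => ?_
  rw [list_prod_vOp c (List.nodup_finRange m)]
  simp [List.prod_ofFn, ← List.ofFn_eq_map]

theorem list_prod_smul_one {R : Type*} [Ring R] [Algebra ℂ R] (c : Fin m → ℂ) :
    ((List.finRange m).map fun k => c k • (1 : R)).prod = (∏ k, c k) • (1 : R) := by
  have h : ∀ l : List (Fin m),
      (l.map fun k => c k • (1 : R)).prod = (l.map c).prod • (1 : R) := by
    intro l
    induction l with
    | nil => simp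
    | cons a l ih =>
      rw [List.map_cons, List.prod_cons, List.map_cons, List.prod_cons, ih, smul_mul_smul_comm,
        one_mul]
  rw [h, ← List.ofFn_eq_map, List.prod_ofFn]

variable [NeZero N]

@[simp] theorem uPow_apply (e : ZMod N) (k : Fin m) (f : State N m) (γ : Fin m → ZMod N) :
    uPow e k f γ = omegaPow (e * γ k) * f γ := rfl

theorem LOp_00 (S : Site) (k : Fin m) (t : ℂ) (f : State N m) (γ : Fin m → ZMod N) :
    LOp S k t 0 0 f γ = f γ + t * S.kap * f (Function.update γ k (γ k - 1)) := by
  simp [LOp]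

theorem LOp_01 (S : Site) (k : Fin m) (t : ℂ) (f : State N m) (γ : Fin m → ZMod N) :
    LOp S k t 0 1 f γ =
      t * (omegaPow (-γ k) * (S.a * f γ - S.b * f (Function.update γ k (γ k - 1)))) := by
  simp [LOp, mul_sub, mul_left_comm]

theorem LOp_10 (S : Site) (k : Fin m) (t : ℂ) (f : State N m) (γ : Fin m → ZMod N) :
    LOp S k t 1 0 f γ =
      omegaPow (γ k) * (S.c * f γ - S.d * f (Function.update γ k (γ k - 1))) := by
  simp [LOp]

theorem LOp_11 (S : Site) (k : Fin m) (t : ℂ) (f : State N m) (γ : Fin m → ZMod N) :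
    LOp S k t 1 1 f γ =
      t * S.a * S.c * f γ + S.b * S.d / S.kap * f (Function.update γ k (γ k - 1)) := by
  simp [LOp]

theorem LOp_matEnds (S : Site) (k : Fin m) :
    MatEnds 1 (fun t => LOp (N := N) S k t) (S.kap • vOp k)
      ((S.a * S.c) • (1 : Module.End ℂ (State N m))) := by
  refine ⟨(HasEnds.linear 1 (S.kap • vOp k)).congr (fun t => ?_) rfl rfl,
    ⟨_, (HasEnds.linear 0
      (uPow (-1) k * (S.a • (1 : Module.End ℂ (State N m)) - S.b • vOp k))).congr
        (fun t => ?_) rfl rfl⟩,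
    ⟨_, (HasEnds.linear (uPow 1 k * (S.c • (1 : Module.End ℂ (State N m)) - S.d • vOp k)) 0).congr
        (fun t => ?_) rfl rfl⟩,
    ⟨_, (HasEnds.linear ((S.b * S.d / S.kap) • vOp k)
      ((S.a * S.c) • (1 : Module.End ℂ (State N m)))).congr (fun t => ?_) rfl rfl⟩⟩
  · simp [LOp, mul_smul]
  · simp [LOp]
  · simp [LOp]
  · simp [LOp, mul_smul, add_comm]

/-- `(b + ω a κ t) (t c + d / κ)`. -/
def Site.qdet (N : ℕ) [NeZero N] (S : Site) (t : ℂ) : ℂ :=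
  (S.b + omega N * S.a * S.kap * t) * (t * S.c + S.d / S.kap)

/-- Each entry is a polynomial identity in the values of f at γ_k, γ_k − 1 and γ_k − 2. The relation
uv = ωvu is what forces the arguments t/ω and t. -/
theorem LOp_quantumDet {S : Site} (hS : S.kap ≠ 0) (k : Fin m) (t : ℂ) :
    QuantumDet (omega N) (LOp (N := N) S k (t / omega N)) (LOp S k t)
      (S.qdet N (t / omega N) • vOp k) := by
  have hω := omega_ne_zero (N := N)
  have hu : ∀ γ : Fin m → ZMod N, omegaPow (γ k - 1) = omegaPow (γ k) * (omega N)⁻¹ := fun γ => by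
    rw [omegaPow_sub, omegaPow_one, div_eq_mul_inv]
  have hu' : ∀ γ : Fin m → ZMod N, omegaPow (-(γ k - 1)) = (omegaPow (γ k))⁻¹ * omega N := fun γ => by
    rw [omegaPow_neg, omegaPow_sub, omegaPow_one, inv_div, div_eq_mul_inv, mul_comm]
  intro i j
  refine LinearMap.ext fun f => funext fun γ => ?_
  have hg := omegaPow_ne_zero (γ k)
  rw [LinearMap.sub_apply, LinearMap.smul_apply, Module.End.mul_apply, Module.End.mul_apply,
    LinearMap.smul_apply, LinearMap.smul_apply]
  simp only [Pi.sub_apply, Pi.smul_apply, smul_eq_mul]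
  fin_cases i <;> fin_cases j <;>
  simp only [detForm, Fin.zero_eta, Fin.mk_one, LOp_00, LOp_01, LOp_10, LOp_11, Function.update_self,
    Function.update_idem, vOp_apply, hu, hu', omegaPow_neg, Matrix.of_apply, Matrix.cons_val', Matrix.cons_val_zero,
    Matrix.cons_val_one, Matrix.cons_val_fin_one, Site.qdet]
  all_goals
    generalize f γ = x0
    generalize f (Function.update γ k (γ k - 1)) = x1
    generalize f (Function.update γ k (γ k - 1 - 1)) = x2
    field_simp
    ring

theorem LOp_commute (S S' : Site) (t t' : ℂ) {p r : Fin m} (hpr : p ≠ r) (i j k l : Fin 2) :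
    Commute (LOp (N := N) S p t i j) (LOp S' r t' k l) := by
  refine LinearMap.ext fun f => funext fun γ => ?_
  rw [Module.End.mul_apply, Module.End.mul_apply]
  have h1 := Function.update_comm hpr (γ p - 1) (γ r - 1) γ
  fin_cases i <;> fin_cases j <;> fin_cases k <;> fin_cases l <;>
  simp only [Fin.zero_eta, Fin.mk_one, LOp_00, LOp_01, LOp_10, LOp_11,
    Function.update_of_ne hpr, Function.update_of_ne hpr.symm, h1] <;>
  ring

theorem LOp_twist (S : Site) (p : Fin m) (t : ℂ) (i j : Fin 2) :
    (![1, omega N] : Fin 2 → ℂ) j • (LOp (N := N) S p t i j * vAll N m) =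
      (![1, omega N] : Fin 2 → ℂ) i • (vAll N m * LOp S p t i j) := by
  have hω := omega_ne_zero (N := N)
  refine LinearMap.ext fun f => funext fun γ => ?_
  have hg := omegaPow_ne_zero (γ p)
  have h1 : (fun k => Function.update γ p (γ p - 1) k - 1) =
      Function.update (fun k => γ k - 1) p (γ p - 1 - 1) := by
    funext k
    by_cases hk : k = p
    · subst hk
      simp
    · simp [hk]
  rw [LinearMap.smul_apply, LinearMap.smul_apply, Module.End.mul_apply, Module.End.mul_apply]
  simp only [Pi.smul_apply, smul_eq_mul, vAll_apply]
  fin_cases i <;> fin_cases j <;>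
  simp only [Fin.zero_eta, Fin.mk_one, LOp_00, LOp_01, LOp_10, LOp_11, vAll_apply, h1,
    Matrix.cons_val_zero, Matrix.cons_val_one, Matrix.cons_val_fin_one, omegaPow_neg, omegaPow_sub, omegaPow_one] <;>
  field_simp

end Chain

/-! ### Monodromy matrices of partial chains -/

section Mono

variable {N : ℕ} [NeZero N] {m : ℕ}

/-- The monodromy matrix of a chain with sites `S 1, …, S m`. -/
def mono (N : ℕ) [NeZero N] (S : ℕ → Site) (m : ℕ) (t : ℂ) :
    Matrix (Fin 2) (Fin 2) (Module.End ℂ (State N m)) :=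
  (List.ofFn fun k : Fin m => LOp (S (k + 1)) k t).prod

theorem mono_eq_map (S : ℕ → Site) (m : ℕ) (t : ℂ) :
    mono N S m t = ((List.finRange m).map fun k : Fin m => LOp (S (k + 1)) k t).prod := by
  rw [mono, List.ofFn_eq_map]

theorem mono_matEnds (S : ℕ → Site) (m : ℕ) :
    MatEnds m (mono N S m) ((∏ k : Fin m, (S (k + 1)).kap) • vAll N m)
      ((∏ k : Fin m, (S (k + 1)).a * (S (k + 1)).c) • (1 : Module.End ℂ (State N m))) := by
  have h := MatEnds.list_prod (fun k : Fin m => LOp_matEnds (N := N) (S (k + 1)) k)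
    (List.finRange m)
  rw [prod_ofFn_vOp fun k : Fin m => (S (k + 1)).kap,
    list_prod_smul_one fun k : Fin m => (S (k + 1)).a * (S (k + 1)).c, List.length_finRange] at h
  rw [show mono N S m = fun t => _ from funext (mono_eq_map S m)]
  exact h

theorem mono_quantumDet {S : ℕ → Site} (hS : ∀ k : Fin m, (S (k + 1)).kap ≠ 0) (t : ℂ) :
    QuantumDet (omega N) (mono N S m (t / omega N)) (mono N S m t)
      ((∏ k : Fin m, (S (k + 1)).qdet N (t / omega N)) • vAll N m) := by
  rw [mono_eq_map, mono_eq_map, ← prod_ofFn_vOp]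
  exact QuantumDet.list_prod (fun k => LOp_quantumDet (hS k) k t)
    (fun p r hpr i j k l => LOp_commute _ _ _ _ hpr i j k l) (List.nodup_finRange m)

theorem mono_twist (S : ℕ → Site) (t : ℂ) (i j : Fin 2) :
    (![1, omega N] : Fin 2 → ℂ) j • (mono N S m t i j * vAll N m) =
      (![1, omega N] : Fin 2 → ℂ) i • (vAll N m * mono N S m t i j) := by
  rw [mono_eq_map]
  exact twist_list_prod (fun p i j => LOp_twist _ p t i j) _ i j

/-- The tensor product of a state of `m` spins with a state of one spin. -/
def tens (N m : ℕ) : State N m →ₗ[ℂ] (ZMod N → ℂ) →ₗ[ℂ] State N (m + 1) :=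
  LinearMap.mk₂ ℂ (fun f g γ => f (Fin.init γ) * g (γ (Fin.last m)))
    (fun _ _ _ => funext fun _ => add_mul _ _ _) (fun _ _ _ => funext fun _ => mul_assoc _ _ _)
    (fun _ _ _ => funext fun _ => mul_add _ _ _)
    (fun _ _ _ => funext fun _ => mul_left_comm _ _ _)

omit [NeZero N] in
@[simp] theorem tens_apply (f : State N m) (g : ZMod N → ℂ) (γ : Fin (m + 1) → ZMod N) :
    tens N m f g γ = f (Fin.init γ) * g (γ (Fin.last m)) := rfl

/-- The entries of the `L`-operator on the state space of a single spin. -/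
def L1 (S : Site) (t : ℂ) (i j : Fin 2) (g : ZMod N → ℂ) : ZMod N → ℂ :=
  ![![fun γ => g γ + t * S.kap * g (γ - 1),
      fun γ => t * (omegaPow (-γ) * (S.a * g γ - S.b * g (γ - 1)))],
    ![fun γ => omegaPow γ * (S.c * g γ - S.d * g (γ - 1)),
      fun γ => t * S.a * S.c * g γ + S.b * S.d / S.kap * g (γ - 1)]] i j

theorem LOp_last_tens (S : Site) (t : ℂ) (i j : Fin 2) (f : State N m) (g : ZMod N → ℂ) :
    LOp S (Fin.last m) t i j (tens N m f g) = tens N m f (L1 S t i j g) := by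
  funext γ
  fin_cases i <;> fin_cases j <;>
  simp [LOp_00, LOp_01, LOp_10, LOp_11, L1, Fin.init_update_last] <;> ring

theorem LOp_castSucc_tens (S : Site) (k : Fin m) (t : ℂ) (i j : Fin 2) (f : State N m)
    (g : ZMod N → ℂ) :
    LOp S k.castSucc t i j (tens N m f g) = tens N m (LOp S k t i j f) g := by
  funext γ
  have h1 : ∀ x, Function.update γ k.castSucc x (Fin.last m) = γ (Fin.last m) := fun x =>
    Function.update_of_ne (Fin.castSucc_lt_last k).ne' _ _
  have h2 : Fin.init γ k = γ k.castSucc := rfl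
  fin_cases i <;> fin_cases j <;>
  simp [LOp_00, LOp_01, LOp_10, LOp_11, Fin.init_update_castSucc, h1, h2] <;> ring

theorem list_prod_LOp_castSucc_tens (S : Fin m → Site) (t : ℂ) (l : List (Fin m)) (i j : Fin 2)
    (f : State N m) (g : ZMod N → ℂ) :
    (l.map fun k => LOp (S k) k.castSucc t).prod i j (tens N m f g) =
      tens N m ((l.map fun k => LOp (S k) k t).prod i j f) g := by
  induction l generalizing i f with
  | nil => fin_cases i <;> fin_cases j <;> simp
  | cons a l ih =>
    simp only [List.map_cons, List.prod_cons, Matrix.mul_apply, Fin.sum_univ_two,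
      LinearMap.add_apply, Module.End.mul_apply, ih, LOp_castSucc_tens, map_add]

theorem mono_succ_eq (S : ℕ → Site) (t : ℂ) :
    mono N S (m + 1) t =
      ((List.finRange m).map fun k : Fin m => LOp (S (k + 1)) k.castSucc t).prod *
        LOp (S (m + 1)) (Fin.last m) t := by
  rw [mono, List.ofFn_succ', List.prod_concat, List.ofFn_eq_map]
  rfl

theorem mono_succ_tens (S : ℕ → Site) (t : ℂ) (i j : Fin 2) (f : State N m) (g : ZMod N → ℂ) :
    mono N S (m + 1) t i j (tens N m f g) =
      tens N m (mono N S m t i 0 f) (L1 (S (m + 1)) t 0 j g) +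
        tens N m (mono N S m t i 1 f) (L1 (S (m + 1)) t 1 j g) := by
  rw [mono_succ_eq, Matrix.mul_apply, Fin.sum_univ_two, mono_eq_map]
  simp only [LinearMap.add_apply, Module.End.mul_apply, LOp_last_tens,
    list_prod_LOp_castSucc_tens fun k : Fin m => S (k + 1)]

omit [NeZero N] in
theorem vAll_tens (f : State N m) (g : ZMod N → ℂ) :
    vAll N (m + 1) (tens N m f g) = tens N m (vAll N m f) (fun γ => g (γ - 1)) := rfl

/-- A kernel vector satisfies a f(x) = b f(x − 1) in the last spin; going once around the cycle of
length N gives a^N f = b^N f. -/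
theorem LOp_last_01_injective {S : Site} (hS : S.a ^ N ≠ S.b ^ N) {t : ℂ} (ht : t ≠ 0) :
    Function.Injective (LOp (N := N) S (Fin.last m) t 0 1) := by
  rw [← LinearMap.ker_eq_bot, LinearMap.ker_eq_bot']
  intro f hf
  funext γ
  have h1 : ∀ x, S.a * f (Function.update γ (Fin.last m) x) =
      S.b * f (Function.update γ (Fin.last m) (x - 1)) := by
    intro x
    have h2 := congrFun hf (Function.update γ (Fin.last m) x)
    rw [LOp_01, Function.update_self, Function.update_idem] at h2
    simpa [ht, omegaPow_ne_zero, sub_eq_zero] using h2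
  have h2 : ∀ k : ℕ, ∀ x, S.a ^ k * f (Function.update γ (Fin.last m) x) =
      S.b ^ k * f (Function.update γ (Fin.last m) (x - k)) := by
    intro k
    induction k with
    | zero => simp
    | succ k ih =>
      intro x
      rw [pow_succ', mul_assoc, ih, mul_left_comm, h1, pow_succ]
      push_cast
      rw [sub_sub]
      ring
  have h3 := h2 N (γ (Fin.last m))
  rw [ZMod.natCast_self, sub_zero, Function.update_eq_self] at h3
  have h4 : (S.a ^ N - S.b ^ N) * f γ = 0 := by rw [sub_mul, h3, sub_self]
  exact (mul_eq_zero.1 h4).resolve_left (sub_ne_zero.2 hS)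

/-- Splitting off the last site and applying its quantum determinant gives b(t) A(t) = a(t/ω) B(t) −
qdet · v · B'(t), where B' belongs to the first m sites. On the kernel of B(t) this determines A(t)
through an operator already known, because b(t) is injective. -/
theorem LOp_last_mul_mono {S : ℕ → Site} (hS : (S (m + 1)).kap ≠ 0) (t : ℂ)
    (F : State N (m + 1)) (hF : mono N S (m + 1) t 0 1 F = 0) :
    LOp (S (m + 1)) (Fin.last m) t 0 1 (mono N S (m + 1) t 0 0 F) =
      -((S (m + 1)).qdet N (t / omega N)) • vOp (Fin.last m)
        (((List.finRange m).map fun k : Fin m => LOp (S (k + 1)) k.castSucc t).prod 0 1 F) := by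
  have hω := omega_ne_zero (N := N)
  set P := ((List.finRange m).map fun k : Fin m => LOp (N := N) (S (k + 1)) k.castSucc t).prod
    with hP
  set x := LOp (N := N) (S (m + 1)) (Fin.last m) (t / omega N)
  set x' := LOp (N := N) (S (m + 1)) (Fin.last m) t with hx'
  have hq := LOp_quantumDet (N := N) hS (Fin.last m) t
  -- The entry b is proportional to the spectral parameter, so its rescaling supplies exactly the
  -- factor ω of the quantum determinant.
  have hb : x' 0 1 = omega N • x 0 1 := by
    refine LinearMap.ext fun f => funext fun γ => ?_
    simp only [x, x', LinearMap.smul_apply, Pi.smul_apply, smul_eq_mul, LOp_01]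
    field_simp
  have hcomm : ∀ (s : ℂ) (i j k l : Fin 2),
      Commute (P i j) (LOp (N := N) (S (m + 1)) (Fin.last m) s k l) := by
    intro s i j k l
    rw [hP]
    induction List.finRange m generalizing i with
    | nil =>
      simp only [List.map_nil, List.prod_nil, Matrix.one_apply]
      split_ifs
      · exact Commute.one_left _
      · exact Commute.zero_left _
    | cons a q ih =>
      simp only [List.map_cons, List.prod_cons, Matrix.mul_apply, Fin.sum_univ_two]
      have h1 : ∀ i' j', Commute (LOp (N := N) (S (a + 1)) a.castSucc t i' j')
          (LOp (S (m + 1)) (Fin.last m) s k l) :=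
        fun i' j' => LOp_commute _ _ _ _ (Fin.castSucc_lt_last a).ne i' j' k l
      exact ((h1 _ _).mul_left (ih _)).add_left ((h1 _ _).mul_left (ih _))
  have q00 := hq 0 0
  have q01 := hq 0 1
  have d00 : detForm (omega N) 0 0 = 0 := rfl
  have d01 : detForm (omega N) 0 1 = 1 := rfl
  rw [d00, zero_smul, sub_eq_zero] at q00
  rw [d01, one_smul, sub_eq_iff_eq_add] at q01
  have key : x' 0 1 * mono N S (m + 1) t 0 0 =
      x 0 0 * mono N S (m + 1) t 0 1 -
        (S (m + 1)).qdet N (t / omega N) • (vOp (Fin.last m) * P 0 1) := by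
    rw [mono_succ_eq, Matrix.mul_apply, Matrix.mul_apply, Fin.sum_univ_two, Fin.sum_univ_two,
      ← hP, ← hx', mul_add, mul_add, ← mul_assoc, ← mul_assoc, ← mul_assoc, ← mul_assoc,
      ← (hcomm t 0 0 0 1).eq, ← (hcomm t 0 1 0 1).eq, ← (hcomm _ 0 0 0 0).eq,
      ← (hcomm _ 0 1 0 0).eq]
    have e1 : P 0 0 * x' 0 1 * x' 0 0 = P 0 0 * x 0 0 * x' 0 1 := by
      rw [mul_assoc, mul_assoc, q00, hb, smul_mul_assoc]
    have e2 : P 0 1 * x' 0 1 * x' 1 0 = P 0 1 * x 0 0 * x' 1 1 -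
        (S (m + 1)).qdet N (t / omega N) • (vOp (Fin.last m) * P 0 1) := by
      -- The shift v is extracted from the entry 1 + κv at t = 1, so commutation with L-entries is
      -- enough.
      have hv : Commute (P 0 1) (vOp (Fin.last m)) := by
        have h1 := hcomm 1 0 1 0 0
        have e3 : LOp (N := N) (S (m + 1)) (Fin.last m) 1 0 0 =
          1 + (S (m + 1)).kap • vOp (Fin.last m) := by simp [LOp]
        rw [e3] at h1
        have h2 := (h1.sub_right (Commute.one_right _)).smul_right ((S (m + 1)).kap)⁻¹
        rwa [add_sub_cancel_left, smul_smul, inv_mul_cancel₀ hS, one_smul] at h2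
      rw [← hv.eq, mul_assoc, mul_assoc, hb, smul_mul_assoc, q01, mul_add, mul_smul_comm,
        mul_smul_comm]
      abel
    rw [e1, e2]
    abel
  have := congrArg (fun X => X F) key
  simpa [Module.End.mul_apply, hF] using this

theorem list_prod_castSucc_eq_tens (S : ℕ → Site) (t : ℂ) (i j : Fin 2) (f : State N m)
    (g : ZMod N → ℂ) :
    ((List.finRange m).map fun k : Fin m => LOp (S (k + 1)) k.castSucc t).prod i j
      (tens N m f g) = tens N m (mono N S m t i j f) g := by
  rw [list_prod_LOp_castSucc_tens fun k : Fin m => S (k + 1), mono_eq_map]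

omit [NeZero N] in
theorem vOp_last_tens (f : State N m) (g : ZMod N → ℂ) :
    vOp (Fin.last m) (tens N m f g) = tens N m f (fun γ => g (γ - 1)) := by
  funext γ
  simp

end Mono

end

section

/-! ### Joint eigenvectors -/

/-- For fixed i, each j ≠ i has some T_a separating it from i, and T_a − μ_j(a) kills v_j but not
v_i. The product of these operators isolates the coefficient of v_i. The T_a need not commute, as
every v_k is an eigenvector of all of them. -/
theorem linearIndependent_of_joint_eigenvectors {ι α V : Type*} [Fintype ι] [AddCommGroup V]
    [Module ℂ V] (T : α → Module.End ℂ V) (v : ι → V) (μ : ι → α → ℂ)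
    (hT : ∀ a i, T a (v i) = μ i a • v i) (hμ : ∀ i j, i ≠ j → ∃ a, μ i a ≠ μ j a)
    (hv : ∀ i, v i ≠ 0) : LinearIndependent ℂ v := by
  classical
  rw [Fintype.linearIndependent_iff]
  intro c hc i
  have hsep : ∀ j, ∃ S : Module.End ℂ V, (∀ k, ∃ ν : ℂ, S (v k) = ν • v k) ∧
      (j ≠ i → S (v j) = 0) ∧ ∃ ν : ℂ, ν ≠ 0 ∧ S (v i) = ν • v i := by
    intro j
    by_cases hj : j = i
    · exact ⟨1, fun k => ⟨1, by simp⟩, fun h => absurd hj h, 1, one_ne_zero, by simp⟩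
    · obtain ⟨a, ha⟩ := hμ i j (Ne.symm hj)
      refine ⟨T a - μ j a • 1, fun k => ⟨μ k a - μ j a, ?_⟩, fun _ => ?_,
        μ i a - μ j a, sub_ne_zero.2 ha, ?_⟩ <;>
      simp [hT, sub_smul]
  have hprod : ∀ s : Finset ι, ∃ S : Module.End ℂ V, (∀ k, ∃ ν : ℂ, S (v k) = ν • v k) ∧
      (∀ j ∈ s, j ≠ i → S (v j) = 0) ∧ ∃ ν : ℂ, ν ≠ 0 ∧ S (v i) = ν • v i := by
    intro s
    induction s using Finset.induction_on with
    | empty => exact ⟨1, fun k => ⟨1, by simp⟩, by simp, 1, one_ne_zero, by simp⟩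
    | insert j s _ ih =>
      obtain ⟨S, h1, h2, ν, hν, h3⟩ := ih
      obtain ⟨S', h1', h2', ν', hν', h3'⟩ := hsep j
      refine ⟨S' * S, fun k => ?_, fun l hl hli => ?_, ν * ν', mul_ne_zero hν hν', ?_⟩
      · obtain ⟨x, hx⟩ := h1 k
        obtain ⟨x', hx'⟩ := h1' k
        exact ⟨x * x', by rw [Module.End.mul_apply, hx, map_smul, hx', smul_smul]⟩
      · rw [Module.End.mul_apply]
        rcases Finset.mem_insert.1 hl with rfl | hl
        · obtain ⟨x, hx⟩ := h1 l
          rw [hx, map_smul, h2' hli, smul_zero]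
        · rw [h2 l hl hli, map_zero]
      · rw [Module.End.mul_apply, h3, map_smul, h3', smul_smul]
  obtain ⟨S, -, h2, ν, hν, h3⟩ := hprod univ
  have h4 := congrArg S hc
  rw [map_sum, map_zero, sum_eq_single i] at h4
  · rw [map_smul, h3, smul_smul] at h4
    exact ((mul_eq_zero.1 ((smul_eq_zero.1 h4).resolve_right (hv i))).resolve_right hν)
  · intro j _ hj
    rw [map_smul, h2 j (mem_univ j) hj, smul_zero]
  · simp

section Levels

variable {N n : ℕ} [NeZero N] {M : Model N n} {A : Amplitudes} {Ph : Phases n}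

theorem exists_prod_sub_bZero_ne (h : Regular M A Ph) {m : ℕ} (hm : m ≤ n)
    {σ σ' : Fin m → ZMod N} (hσ : σ ≠ σ') :
    ∃ k, ∏ j, (bZero A m σ k - bZero A m σ' j) ≠ 0 := by
  obtain ⟨k, hk⟩ := Function.ne_iff.1 hσ
  refine ⟨k, prod_ne_zero_iff.2 fun j _ => sub_ne_zero.2 fun h0 => ?_⟩
  by_cases hj : k = j
  · subst hj
    have h1 := mul_left_cancel₀ (neg_ne_zero.2 (h.R_ne m hm _ k.2)) h0
    exact hk (neg_injective (omegaPow_injective h1))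
  · have := omegaPow_mul_bZero_ne h hm σ σ' hj 0 0
    rw [omegaPow_zero, one_mul, one_mul] at this
    exact this h0

/-- The index ρ_0 is visible in the leading coefficient, at any t that is neither 0 nor a zero; the
other indices are visible in the zeros, by evaluation at a zero of one eigenvalue that is not a zero
of the other. -/
theorem exists_eigenvalue_ne (h : Regular M A Ph) {m : ℕ} (hm : m < n)
    {ρ ρ' : Fin (m + 1) → ZMod N} (hρ : ρ ≠ ρ') :
    ∃ t : ℂ, t * (A.R (m + 1) 0 * omegaPow (-ρ 0) * ∏ k, (t - bZero A m (Fin.tail ρ) k)) ≠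
      t * (A.R (m + 1) 0 * omegaPow (-ρ' 0) * ∏ k, (t - bZero A m (Fin.tail ρ') k)) := by
  have hR := h.R_ne m hm.le 0 (Nat.zero_le _)
  by_cases ht : Fin.tail ρ = Fin.tail ρ'
  · have h0 : ρ 0 ≠ ρ' 0 := by
      intro h0
      apply hρ
      rw [← Fin.cons_self_tail ρ, ← Fin.cons_self_tail ρ', h0, ht]
    obtain ⟨t, ht'⟩ := Infinite.exists_notMem_finset
      (insert 0 (univ.image (bZero A m (Fin.tail ρ'))))
    simp only [mem_insert, mem_image, mem_univ, true_and, not_or, not_exists] at ht'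
    have hP : ∏ k, (t - bZero A m (Fin.tail ρ') k) ≠ 0 :=
      prod_ne_zero_iff.2 fun k _ => sub_ne_zero.2 (Ne.symm (ht'.2 k))
    refine ⟨t, fun h1 => h0 ?_⟩
    rw [ht] at h1
    have h2 := mul_right_cancel₀ hP (mul_left_cancel₀ ht'.1 h1)
    exact neg_injective (omegaPow_injective (mul_left_cancel₀ hR h2))
  · obtain ⟨k, hk⟩ := exists_prod_sub_bZero_ne h hm.le ht
    refine ⟨bZero A m (Fin.tail ρ) k, ?_⟩
    rw [prod_eq_zero (mem_univ k) (sub_self _), mul_zero, mul_zero]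
    exact (mul_ne_zero (bZero_ne h hm.le _ k) (mul_ne_zero (mul_ne_zero hR
      (omegaPow_ne_zero _)) hk)).symm

/-! ### The vectors of one site -/

theorem psi_onFermat (h : Regular M A Ph) {m : ℕ} (hm : m < n) :
    OnFermat N (A.r (m + 1) / (M.bulk (m + 1)).a) ((M.bulk (m + 1)).b / (M.bulk (m + 1)).a) := by
  have ha := h.a_ne m hm
  refine ⟨?_, div_ne_zero (h.b_ne m hm) ha⟩
  rw [div_pow, div_pow, h.r_pow m hm]
  field_simp
  ring

theorem psi_sub_one (k : ℕ) (t : ZMod N) :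
    (fun γ => psi M A k t (γ - 1)) = psi M A k (t + 1) := by
  funext γ
  rw [psi, psi, show γ - 1 - t = γ - (t + 1) by ring]

theorem L1_11_psi (S : Site) (x : ℂ) (k : ℕ) (t : ZMod N) :
    L1 S x 1 1 (psi M A k t) =
      (x * S.a * S.c) • psi M A k t + (S.b * S.d / S.kap) • psi M A k (t + 1) := by
  rw [← psi_sub_one]
  rfl

/-- The recursion of w at p_k is the eigenvector equation of u⁻¹(a − bv): the term with b cancels a
and leaves r ω^{γ − t}, and u⁻¹ removes the dependence on γ. -/
theorem L1_01_psi (h : Regular M A Ph) {m : ℕ} (hm : m < n) (x : ℂ) (t : ZMod N) :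
    L1 (M.bulk (m + 1)) x 0 1 (psi M A (m + 1) t) =
      (x * (A.r (m + 1) * omegaPow (-t))) • psi M A (m + 1) t := by
  funext γ
  have ha := h.a_ne m hm
  have hb := h.b_ne m hm
  have h1 := (psi_onFermat h hm).w_pred (γ - t)
  have h2 : γ - 1 - t = γ - t - 1 := by ring
  change x * (omegaPow (-γ) * ((M.bulk (m + 1)).a * psi M A (m + 1) t γ -
    (M.bulk (m + 1)).b * psi M A (m + 1) t (γ - 1))) = _ * psi M A (m + 1) t γ
  rw [psi, psi, h2, h1, omegaPow_sub, omegaPow_neg, omegaPow_neg]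
  have := omegaPow_ne_zero γ
  have := omegaPow_ne_zero t
  field_simp
  ring

theorem psi_linearIndependent (h : Regular M A Ph) {m : ℕ} (hm : m < n) :
    LinearIndependent ℂ (psi M A (m + 1)) := by
  let T : Module.End ℂ (ZMod N → ℂ) :=
    { toFun := L1 (M.bulk (m + 1)) 1 0 1
      map_add' := fun f g => by
        funext γ
        simp only [L1, Matrix.cons_val_zero, Matrix.cons_val_one, Matrix.cons_val_fin_one,
          Pi.add_apply]
        ring
      map_smul' := fun c f => by
        funext γ
        simp only [L1, Matrix.cons_val_zero, Matrix.cons_val_one, Matrix.cons_val_fin_one,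
          Pi.smul_apply, smul_eq_mul, RingHom.id_apply]
        ring }
  refine linearIndependent_of_joint_eigenvectors (fun _ : Unit => T) _
    (fun t _ => 1 * (A.r (m + 1) * omegaPow (-t))) (fun _ t => L1_01_psi h hm 1 t) ?_ ?_
  · intro i j hij
    refine ⟨(), fun h0 => hij ?_⟩
    have := mul_left_cancel₀ (h.r_ne m hm.le) (mul_left_cancel₀ one_ne_zero h0)
    exact neg_injective (omegaPow_injective this)
  · intro t h0
    exact (psi_onFermat h hm).w_ne (t - t) (congrFun h0 t)

/-! ### The induction over the sites -/

/-- The action of the operators of the chain of `m + 1` sites on the vectors `Ψ_ρ`. -/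
structure Level (M : Model N n) (A : Amplitudes) (Ph : Phases n) (m : ℕ) : Prop where
  shift : ∀ ρ, vAll N (m + 1) (Psi M A Ph (m + 1) ρ) = Psi M A Ph (m + 1) (ρ + Pi.single 0 1)
  B_eq : ∀ t ρ, mono N M.bulk (m + 1) t 0 1 (Psi M A Ph (m + 1) ρ) =
    (t * (A.R (m + 1) 0 * omegaPow (-ρ 0) * ∏ k, (t - bZero A m (Fin.tail ρ) k))) •
      Psi M A Ph (m + 1) ρ
  A_eq : ∀ ρ k, mono N M.bulk (m + 1) (bZero A m (Fin.tail ρ) k) 0 0 (Psi M A Ph (m + 1) ρ) =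
    phiA M A Ph m (Fin.tail ρ) k • Psi M A Ph (m + 1) (ρ + Pi.single k.succ 1)
  indep : LinearIndependent ℂ (Psi M A Ph (m + 1))

omit [NeZero N] in
theorem sum_smul_shift {V : Type*} [AddCommGroup V] [Module ℂ V] {m : ℕ} [NeZero N]
    (f : (Fin m → ZMod N) → ℂ) (v : (Fin m → ZMod N) → V) (e : Fin m → ZMod N) :
    ∑ ρ, f ρ • v (ρ + e) = ∑ ρ, f (ρ - e) • v ρ := by
  rw [← Equiv.sum_comp (Equiv.addRight e) (fun ρ => f (ρ - e) • v ρ)]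
  simp

/-- A_{m+1} has degree m + 1, constant coefficient 1 and top coefficient proportional to V. Together
with its values at the m zeros of the eigenvalue of B_{m+1} this determines it. -/
theorem Level.A_apply (h : Regular M A Ph) {m : ℕ} (hm : m < n) (hl : Level M A Ph m) (t : ℂ)
    (ρ : Fin (m + 1) → ZMod N) :
    mono N M.bulk (m + 1) t 0 0 (Psi M A Ph (m + 1) ρ) =
      ((t * ∏ k, (t - bZero A m (Fin.tail ρ) k)) * ∏ k ∈ Icc 1 (m + 1), (M.bulk k).kap) •
        Psi M A Ph (m + 1) (ρ + Pi.single 0 1) +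
      ((∏ k, (t - bZero A m (Fin.tail ρ) k)) / ∏ k, (-bZero A m (Fin.tail ρ) k)) •
        Psi M A Ph (m + 1) ρ +
      ∑ k, (((t / bZero A m (Fin.tail ρ) k) *
        ((∏ l ∈ univ.erase k, (t - bZero A m (Fin.tail ρ) l)) /
          ∏ l ∈ univ.erase k, (bZero A m (Fin.tail ρ) k - bZero A m (Fin.tail ρ) l))) *
          phiA M A Ph m (Fin.tail ρ) k) • Psi M A Ph (m + 1) (ρ + Pi.single k.succ 1) := by
  have he := (mono_matEnds (N := N) M.bulk (m + 1)).a
  have hc : m + 1 = Fintype.card (Fin m) + 1 := by simp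
  have he' : HasEnds (Fintype.card (Fin m) + 1) (fun t => mono N M.bulk (m + 1) t 0 0) 1
    ((∏ k : Fin (m + 1), (M.bulk (k + 1)).kap) • vAll N (m + 1)) := hc ▸ he
  have h1 := congrArg (fun X => X (Psi M A Ph (m + 1) ρ))
    (he'.interpolation (bZero_injective h hm.le (Fin.tail ρ)) (bZero_ne h hm.le _) t)
  simp only [LinearMap.add_apply, LinearMap.smul_apply, LinearMap.sum_apply,
    Module.End.one_apply, hl.shift, hl.A_eq, smul_smul] at h1
  rw [h1, prod_Icc_eq_prod_fin]

/-- A family of coefficients satisfying the three kinds of recursions carries `A_{m+1}` to a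
diagonal operator. -/
theorem Level.sum_A_eq (h : Regular M A Ph) {m : ℕ} (hm : m < n) (hl : Level M A Ph m)
    (q q₁ : (Fin (m + 1) → ZMod N) → ℂ) (τ : Fin (m + 1) → ZMod N) (g e α : ℂ)
    (h0 : ∀ ρ, g * (∏ k ∈ Icc 1 (m + 1), (M.bulk k).kap) * q (ρ - Pi.single 0 1) =
      (e - A.R (m + 1) 0 * omegaPow (-ρ 0) * α) * q ρ)
    (h1 : ∀ ρ, g * q ρ = e * (∏ j, (-bZero A (m + 1) τ j)) * q ρ -
      A.R (m + 1) 0 * omegaPow (-ρ 0) * (∏ k, (-bZero A m (Fin.tail ρ) k)) * q₁ ρ)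
    (h2 : ∀ ρ k, q (ρ - Pi.single k.succ 1) *
        (g * phiA M A Ph m (Fin.tail ρ - Pi.single k 1) k /
          (omega N * bZero A m (Fin.tail ρ) k *
            ∏ l ∈ univ.erase k, (omega N * bZero A m (Fin.tail ρ) k - bZero A m (Fin.tail ρ) l))) =
      q ρ * (e * (∏ j, (bZero A m (Fin.tail ρ) k - bZero A (m + 1) τ j)) /
          (bZero A m (Fin.tail ρ) k *
            ∏ l ∈ univ.erase k, (bZero A m (Fin.tail ρ) k - bZero A m (Fin.tail ρ) l))))
    (t : ℂ) :
    g • mono N M.bulk (m + 1) t 0 0 (∑ ρ, q ρ • Psi M A Ph (m + 1) ρ) =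
      ∑ ρ, (e * (∏ j, (t - bZero A (m + 1) τ j)) * q ρ -
        A.R (m + 1) 0 * omegaPow (-ρ 0) * (∏ k, (t - bZero A m (Fin.tail ρ) k)) *
          (t * α * q ρ + q₁ ρ)) • Psi M A Ph (m + 1) ρ := by
  have htail0 : ∀ ρ : Fin (m + 1) → ZMod N, Fin.tail (ρ - Pi.single 0 1) = Fin.tail ρ := by
    intro ρ
    funext l
    simp [Fin.tail]
  -- The coefficient of Ψ_ρ collects contributions from ρ − e_0, ρ and ρ − e_k. For ρ − e_k the k-th
  -- node is ωx_k and the others are unchanged: the Lagrange numerator, which omits k, stays the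
  -- same and only the denominator changes.
  have hexp : g • mono N M.bulk (m + 1) t 0 0 (∑ ρ, q ρ • Psi M A Ph (m + 1) ρ) =
      ∑ ρ, (g * (q (ρ - Pi.single 0 1) * ((t * ∏ k, (t - bZero A m (Fin.tail ρ) k)) *
          ∏ k ∈ Icc 1 (m + 1), (M.bulk k).kap) +
        q ρ * ((∏ k, (t - bZero A m (Fin.tail ρ) k)) / ∏ k, (-bZero A m (Fin.tail ρ) k)) +
        ∑ k, q (ρ - Pi.single k.succ 1) * ((t / (omega N * bZero A m (Fin.tail ρ) k) *
          ((∏ l ∈ univ.erase k, (t - bZero A m (Fin.tail ρ) l)) /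
            ∏ l ∈ univ.erase k,
              (omega N * bZero A m (Fin.tail ρ) k - bZero A m (Fin.tail ρ) l))) *
          phiA M A Ph m (Fin.tail ρ - Pi.single k 1) k))) • Psi M A Ph (m + 1) ρ := by
    simp only [mul_smul, ← smul_sum, map_sum, map_smul]
    congr 1
    simp only [hl.A_apply h hm, smul_add, sum_add_distrib, add_smul, sum_smul, smul_sum, smul_smul]
    congr 1
    · congr 1
      rw [sum_smul_shift (fun ρ => q ρ * ((t * ∏ k, (t - bZero A m (Fin.tail ρ) k)) *
          ∏ k ∈ Icc 1 (m + 1), (M.bulk k).kap))]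
      simp only [htail0]
    · rw [sum_comm]
      refine Eq.trans ?_ sum_comm
      refine sum_congr rfl fun k _ => ?_
      rw [sum_smul_shift (fun ρ => q ρ * (((t / bZero A m (Fin.tail ρ) k) *
        ((∏ l ∈ univ.erase k, (t - bZero A m (Fin.tail ρ) l)) /
          ∏ l ∈ univ.erase k, (bZero A m (Fin.tail ρ) k - bZero A m (Fin.tail ρ) l))) *
          phiA M A Ph m (Fin.tail ρ) k))]
      refine sum_congr rfl fun ρ _ => ?_
      have a1 : ∏ l ∈ univ.erase k, (t - bZero A m (Fin.tail ρ - Pi.single k 1) l) =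
          ∏ l ∈ univ.erase k, (t - bZero A m (Fin.tail ρ) l) :=
        prod_congr rfl fun l hl' => by rw [bZero_sub_single_of_ne _ _ _ (ne_of_mem_erase hl')]
      have a2 : ∏ l ∈ univ.erase k, (omega N * bZero A m (Fin.tail ρ) k -
            bZero A m (Fin.tail ρ - Pi.single k 1) l) =
          ∏ l ∈ univ.erase k, (omega N * bZero A m (Fin.tail ρ) k - bZero A m (Fin.tail ρ) l) :=
        prod_congr rfl fun l hl' => by rw [bZero_sub_single_of_ne _ _ _ (ne_of_mem_erase hl')]
      rw [tail_sub_single, bZero_sub_single_self, a1, a2]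
  rw [hexp]
  refine sum_congr rfl fun ρ _ => ?_
  congr 1
  set x := bZero A m (Fin.tail ρ) with hx
  have hPdeg : (∏ j, (X - C (bZero A (m + 1) τ j))).natDegree = m + 1 := by
    rw [natDegree_prod_of_monic _ _ fun k _ => monic_X_sub_C _]
    simp
  -- The expected product over the new zeros is expanded at the nodes belonging to ρ, so that `h2`
  -- can match the two expansions node by node.
  have hlag := eval_eq_interpolation x (bZero_injective h hm.le _) (bZero_ne h hm.le _)
    (∏ j, (X - C (bZero A (m + 1) τ j))) (by rw [hPdeg, Fintype.card_fin]) t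
  have hlead : (∏ j, (X - C (bZero A (m + 1) τ j))).coeff (Fintype.card (Fin m) + 1) = 1 := by
    have := (monic_prod_of_monic univ (fun j => X - C (bZero A (m + 1) τ j))
      fun k _ => monic_X_sub_C _).coeff_natDegree
    rw [hPdeg] at this
    rw [Fintype.card_fin]
    exact this
  rw [hlead, coeff_zero_eq_eval_zero] at hlag
  simp only [eval_prod, eval_sub, eval_X, eval_C, zero_sub] at hlag
  have hP0 : ∏ k, (-x k) ≠ 0 :=
    prod_ne_zero_iff.2 fun k _ => neg_ne_zero.2 (bZero_ne h hm.le _ k)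
  have hk : ∀ k, g * (q (ρ - Pi.single k.succ 1) * ((t / (omega N * x k) *
          ((∏ l ∈ univ.erase k, (t - x l)) / ∏ l ∈ univ.erase k, (omega N * x k - x l))) *
          phiA M A Ph m (Fin.tail ρ - Pi.single k 1) k)) =
      e * q ρ * ((∏ j, (x k - bZero A (m + 1) τ j)) * (t / x k *
        ((∏ l ∈ univ.erase k, (t - x l)) / ∏ l ∈ univ.erase k, (x k - x l)))) := by
    intro k
    have := h2 ρ k
    linear_combination (t * ∏ l ∈ univ.erase k, (t - x l)) * this
  rw [mul_add, mul_add, mul_sum, sum_congr rfl fun k _ => hk k, ← mul_sum, hlag]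
  have e0 := h0 ρ
  have e1 := h1 ρ
  generalize ∑ k, (∏ j, (x k - bZero A (m + 1) τ j)) * (t / x k *
        ((∏ l ∈ univ.erase k, (t - x l)) / ∏ l ∈ univ.erase k, (x k - x l))) = s1 at *
  generalize ∏ k, (t - x k) = s2 at *
  rw [← hx] at e1
  generalize ∏ k, (-x k) = s3 at *
  field_simp
  -- With the nodes matched, `h0` compares the top coefficients and `h1` the constant ones.
  linear_combination (t * s2 * s3) * e0 + s2 * e1

end Levels

end

/-! ### Recursions for the coefficients Q and the induction step -/

section Step

variable {N n : ℕ} [NeZero N] {M : Model N n} {A : Amplitudes} {Ph : Phases n}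

omit [NeZero N] in
theorem sum_sub_single {m : ℕ} (ρ : Fin m → ZMod N) (k : Fin m) :
    ∑ j, (ρ - Pi.single k 1 : Fin m → ZMod N) j = ∑ j, ρ j - 1 := by
  simp

omit [NeZero N] in
theorem sum_add_single {m : ℕ} (ρ : Fin m → ZMod N) (k : Fin m) :
    ∑ j, (ρ + Pi.single k 1 : Fin m → ZMod N) j = ∑ j, ρ j + 1 := by
  simp [sum_add_distrib]

/-- The lowest coefficient of the eigenvalue of B depends on ρ only through the sum of all its
indices; this is the source of the sums ρ̃ in Q. -/
theorem mul_prod_neg_bZero (A : Amplitudes) (m : ℕ) (ρ : Fin (m + 1) → ZMod N) :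
    A.R (m + 1) 0 * omegaPow (-ρ 0) * ∏ k, (-bZero A m (Fin.tail ρ) k) =
      A.rt (m + 1) * omegaPow (-∑ k, ρ k) := by
  have h1 : ∀ k, -bZero A m (Fin.tail ρ) k = A.R (m + 1) (k + 1) * omegaPow (-ρ k.succ) :=
    fun k => by
      rw [bZero, Fin.tail]
      ring
  rw [prod_congr rfl fun k _ => h1 k, prod_mul_distrib, A.rt_succ, ← sum_neg_distrib,
    Fin.sum_univ_succ, omegaPow_add, omegaPow_sum]
  ring

theorem rt_ne (h : Regular M A Ph) {m : ℕ} (hm : m ≤ n) : A.rt (m + 1) ≠ 0 := by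
  rw [A.rt_succ]
  exact mul_ne_zero (h.R_ne m hm 0 (Nat.zero_le _))
    (prod_ne_zero_iff.2 fun l _ => h.R_ne m hm _ l.2)

theorem Q_ne (h : Regular M A Ph) {m : ℕ} (hm : m + 1 < n) (ρ : Fin (m + 1) → ZMod N)
    (t : ZMod N) (ρ' : Fin (m + 2) → ZMod N) : Q M A Ph (m + 1) ρ t ρ' ≠ 0 := by
  rw [Q]
  exact mul_ne_zero (div_ne_zero (omegaPow_ne_zero _) (mul_ne_zero ((h.zero m hm).w_ne _)
    ((h.tilde m hm).w_ne _))) (Qcommon_ne h (by omega) _ _)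

/-- Condition `h0` of `Level.sum_A_eq`: lowering ρ_0 is one step of w at p_{m+2,0}, and the
exponential contributes ω^{t − ρ'_0}. -/
theorem Q_sub_single_zero (h : Regular M A Ph) {m : ℕ} (hm : m + 1 < n)
    (ρ : Fin (m + 1) → ZMod N) (t : ZMod N) (ρ' : Fin (m + 2) → ZMod N) :
    A.r (m + 2) * omegaPow (-t) * (∏ k ∈ Icc 1 (m + 1), (M.bulk k).kap) *
        Q M A Ph (m + 1) (ρ - Pi.single 0 1) t ρ' =
      (A.R (m + 2) 0 * omegaPow (-ρ' 0) - A.R (m + 1) 0 * omegaPow (-ρ 0) *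
        ((M.bulk (m + 2)).a * (M.bulk (m + 2)).c)) * Q M A Ph (m + 1) ρ t ρ' := by
  have e1 : ρ' 0 - (ρ - Pi.single 0 1 : Fin (m + 1) → ZMod N) 0 - 1 = ρ' 0 - ρ 0 := by
    simp only [Pi.sub_apply, Pi.single_eq_same]
    ring
  have e2 : (∑ k, ρ' k - (∑ k, ρ k - 1)) * (t - ρ' 0) =
      (∑ k, ρ' k - ∑ k, ρ k) * (t - ρ' 0) + (t - ρ' 0) := by ring
  have hw := (h.zero m hm).w_rec (ρ' 0 - ρ 0)
  have hz := (h.zero m hm).w_ne (ρ' 0 - ρ 0)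
  have hz' := (h.zero m hm).w_ne (ρ' 0 - ρ 0 - 1)
  have ht := (h.tilde m hm).w_ne (∑ k, ρ' k - t - 1)
  have hR : A.R (m + 2) 0 ≠ 0 := h.R_ne (m + 1) hm.le 0 (Nat.zero_le _)
  rw [Q, Q, sum_sub_single, Qcommon_sub_single_zero, e1, e2, omegaPow_add]
  rw [omegaPow_sub] at hw
  rw [omegaPow_sub, omegaPow_neg, omegaPow_neg, omegaPow_neg]
  have n1 := omegaPow_ne_zero t
  have n2 := omegaPow_ne_zero (ρ' 0)
  have n3 := omegaPow_ne_zero (ρ 0)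
  generalize w _ _ (ρ' 0 - ρ 0) = w1 at *
  generalize w _ _ (ρ' 0 - ρ 0 - 1) = w0 at *
  generalize w _ _ (∑ k, ρ' k - t - 1) = w2 at *
  generalize Qcommon M A Ph (m + 1) ρ _ = w3 at *
  generalize omegaPow ((∑ k, ρ' k - ∑ k, ρ k) * (t - ρ' 0)) = w4 at *
  generalize ∏ k ∈ Icc 1 (m + 1), (M.bulk k).kap = K at *
  field_simp at hw ⊢
  linear_combination (-w4 * w3) * hw

/-- Condition `h1` of `Level.sum_A_eq`: lowering t is one step of w at p̃_{m+2}. The neighbour t − 1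
occurs because the entry d of the last site sends ψ_{t−1} partly to ψ_t. -/
theorem Q_sub_one (h : Regular M A Ph) {m : ℕ} (hm : m + 1 < n)
    (ρ : Fin (m + 1) → ZMod N) (t : ZMod N) (ρ' : Fin (m + 2) → ZMod N) :
    A.r (m + 2) * omegaPow (-t) * Q M A Ph (m + 1) ρ t ρ' =
      A.rt (m + 2) * omegaPow (-∑ k, ρ' k) * Q M A Ph (m + 1) ρ t ρ' -
        A.rt (m + 1) * omegaPow (-∑ k, ρ k) *
          ((M.bulk (m + 2)).b * (M.bulk (m + 2)).d / (M.bulk (m + 2)).kap *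
            Q M A Ph (m + 1) ρ (t - 1) ρ') := by
  have e1 : ∑ k, ρ' k - (t - 1) - 1 = ∑ k, ρ' k - t := by ring
  have e2 : (∑ k, ρ' k - ∑ k, ρ k) * (t - 1 - ρ' 0) =
      (∑ k, ρ' k - ∑ k, ρ k) * (t - ρ' 0) - (∑ k, ρ' k - ∑ k, ρ k) := by ring
  have hw := (h.tilde m hm).w_rec (∑ k, ρ' k - t)
  have ht := (h.tilde m hm).w_ne (∑ k, ρ' k - t)
  have ht' := (h.tilde m hm).w_ne (∑ k, ρ' k - t - 1)
  have hz := (h.zero m hm).w_ne (ρ' 0 - ρ 0 - 1)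
  have hrt' : A.rt (m + 2) ≠ 0 := rt_ne h (m := m + 1) hm.le
  have hk : (M.bulk (m + 2)).kap ≠ 0 := h.kap_ne (m + 1) hm
  rw [Q, Q, e1, e2, omegaPow_sub]
  rw [omegaPow_sub] at hw
  rw [omegaPow_sub, omegaPow_neg, omegaPow_neg, omegaPow_neg]
  have n1 := omegaPow_ne_zero t
  have n2 := omegaPow_ne_zero (∑ k, ρ' k)
  have n3 := omegaPow_ne_zero (∑ k, ρ k)
  generalize w _ _ (ρ' 0 - ρ 0 - 1) = w1 at *
  generalize w _ _ (∑ k, ρ' k - t) = w2 at *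
  generalize w _ _ (∑ k, ρ' k - t - 1) = w0 at *
  generalize Qcommon M A Ph (m + 1) ρ _ = w3 at *
  generalize omegaPow ((∑ k, ρ' k - ∑ k, ρ k) * (t - ρ' 0)) = w4 at *
  field_simp at hw ⊢
  linear_combination (-w4 * w3) * hw

/-- Condition `h2` of `Level.sum_A_eq`: the factor ω^{t − ρ'_0} from the exponential turns the
ω^{−t} on the left into the ω^{−ρ'_0} on the right. -/
theorem Q_sub_single_succ (h : Regular M A Ph) {m : ℕ} (hm : m + 1 < n)
    (ρ : Fin (m + 1) → ZMod N) (t : ZMod N) (ρ' : Fin (m + 2) → ZMod N) (k : Fin m) :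
    Q M A Ph (m + 1) (ρ - Pi.single k.succ 1) t ρ' *
        (A.r (m + 2) * omegaPow (-t) * phiA M A Ph m (Fin.tail ρ - Pi.single k 1) k /
          (omega N * bZero A m (Fin.tail ρ) k *
            ∏ l ∈ univ.erase k, (omega N * bZero A m (Fin.tail ρ) k - bZero A m (Fin.tail ρ) l))) =
      Q M A Ph (m + 1) ρ t ρ' *
        (A.R (m + 2) 0 * omegaPow (-ρ' 0) *
            (∏ j, (bZero A m (Fin.tail ρ) k - bZero A (m + 1) (Fin.tail ρ') j)) /
          (bZero A m (Fin.tail ρ) k *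
            ∏ l ∈ univ.erase k, (bZero A m (Fin.tail ρ) k - bZero A m (Fin.tail ρ) l))) := by
  have key := Qcommon_mul_phiA h (m := m) (by omega) ρ (fun j => ρ' j.succ) k
  have e1 : (ρ - Pi.single k.succ 1 : Fin (m + 1) → ZMod N) 0 = ρ 0 := by simp
  have e2 : (∑ k, ρ' k - (∑ k, ρ k - 1)) * (t - ρ' 0) =
      (∑ k, ρ' k - ∑ k, ρ k) * (t - ρ' 0) + (t - ρ' 0) := by ring
  rw [Q, Q, sum_sub_single, e1, e2, omegaPow_add, omegaPow_sub t, omegaPow_neg, omegaPow_neg]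
  have n1 := omegaPow_ne_zero t
  have n2 := omegaPow_ne_zero (ρ' 0)
  have e3 : ∀ x u v c d : ℂ, x * v / u * c * d = x / u * (v * c * d) :=
    fun x u v c d => by ring
  rw [e3, mul_assoc (omegaPow ((∑ k, ρ' k - ∑ k, ρ k) * (t - ρ' 0)) / _)]
  congr 1
  have e4 : omegaPow t / omegaPow (ρ' 0) * (omegaPow t)⁻¹ = (omegaPow (ρ' 0))⁻¹ := by
    field_simp
  have e5 : (fun j : Fin (m + 1) => ρ' j.succ) = Fin.tail ρ' := rfl
  rw [e5] at key ⊢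
  linear_combination (omegaPow (ρ' 0))⁻¹ * key +
    (Qcommon M A Ph (m + 1) (ρ - Pi.single k.succ 1) (Fin.tail ρ') *
        (A.r (m + 2) * phiA M A Ph m (Fin.tail ρ - Pi.single k 1) k /
          (omega N * bZero A m (Fin.tail ρ) k *
            ∏ l ∈ univ.erase k,
              (omega N * bZero A m (Fin.tail ρ) k - bZero A m (Fin.tail ρ) l)))) * e4

/-- Q involves ρ_0, t and ρ'_0 only through combinations that are invariant under a simultaneous
translation. -/
theorem Q_add_single_zero (M : Model N n) (A : Amplitudes) (Ph : Phases n) (m : ℕ)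
    (ρ : Fin (m + 1) → ZMod N) (t : ZMod N) (ρ' : Fin (m + 2) → ZMod N) :
    Q M A Ph (m + 1) (ρ - Pi.single 0 1) (t - 1) ρ' =
      Q M A Ph (m + 1) ρ t (ρ' + Pi.single 0 1) := by
  have e0 : (fun k : Fin (m + 1) => (ρ' + Pi.single 0 1 : Fin (m + 2) → ZMod N) k.succ) =
      fun k => ρ' k.succ := by
    funext k
    simp
  have e1 : (ρ' + Pi.single 0 1 : Fin (m + 2) → ZMod N) 0 = ρ' 0 + 1 := by simp
  have e2 : (ρ - Pi.single 0 1 : Fin (m + 1) → ZMod N) 0 = ρ 0 - 1 := by simp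
  rw [Q, Q, Qcommon_sub_single_zero, sum_sub_single, sum_add_single, e0, e1, e2]
  congr 4 <;> ring

/-- Raising ρ'_k and replacing t by t − 1 leave the argument of w at p̃_{m+2} unchanged, so only the
exponential and the pair functions differ. Their ratio is the eigenvalue of B_{m+1} at the new zero,
divided by that zero and up to constants; those constants define `phiA`. -/
theorem Q_add_single_succ (h : Regular M A Ph) {m : ℕ} (hm : m + 1 < n)
    (ρ : Fin (m + 1) → ZMod N) (t : ZMod N) (ρ' : Fin (m + 2) → ZMod N) (k : Fin (m + 1)) :
    -M.F (m + 2) (bZero A (m + 1) (Fin.tail ρ') k / omega N) *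
        (A.R (m + 1) 0 * omegaPow (-ρ 0) *
          ∏ l, (bZero A (m + 1) (Fin.tail ρ') k - bZero A m (Fin.tail ρ) l)) *
        Q M A Ph (m + 1) ρ (t - 1) ρ' =
      phiA M A Ph (m + 1) (Fin.tail ρ') k * (A.r (m + 2) * omegaPow (-t)) *
        Q M A Ph (m + 1) ρ t (ρ' + Pi.single k.succ 1) := by
  have e0 : (fun j : Fin (m + 1) => (ρ' + Pi.single k.succ 1 : Fin (m + 2) → ZMod N) j.succ) =
      Fin.tail ρ' + Pi.single k 1 := by
    funext j
    simp [Fin.tail, Pi.single_apply]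
  have e1 : (ρ' + Pi.single k.succ 1 : Fin (m + 2) → ZMod N) 0 = ρ' 0 := by simp
  have e2 : (∑ k, ρ' k + 1 - ∑ k, ρ k) * (t - ρ' 0) =
    (∑ k, ρ' k - ∑ k, ρ k) * (t - 1 - ρ' 0) + (∑ k, ρ' k - ∑ k, ρ k + t - ρ' 0) := by ring
  have e3 : ∑ k, ρ' k + 1 - t - 1 = ∑ k, ρ' k - (t - 1) - 1 := by ring
  have hr := h.r_ne (m + 1) hm.le
  have hY : ∏ l : Fin m, Ph.Y (m + 2) (k + 1) (m + 1) (l + 1) ≠ 0 :=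
    prod_ne_zero_iff.2 fun l _ => (h.next m (by omega) k l).ne
  have hRl : ∏ l : Fin m, A.R (m + 1) (l + 1) ≠ 0 :=
    prod_ne_zero_iff.2 fun l _ => h.R_ne m (by omega) _ l.2
  have hphi : phiA M A Ph (m + 1) (Fin.tail ρ') k =
      -M.F (m + 2) (bZero A (m + 1) (Fin.tail ρ') k / omega N) * A.rt (m + 1) *
      (∏ l : Fin m, Ph.Y (m + 2) (k + 1) (m + 1) (l + 1)) * omegaPow (-∑ j, Fin.tail ρ' j) /
        A.r (m + 2) := by
    rw [phiA, Nat.add_sub_cancel, prod_Icc_eq_prod_fin]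
  rw [Q, Q, sum_add_single, e0, e1, e2, e3, Qcommon_add_single h (by omega), omegaPow_add, hphi,
    prod_div_distrib, prod_mul_distrib, prod_div_distrib, ← omegaPow_sum, A.rt_succ m, Fin.sum_univ_succ (f := ρ), Fin.sum_univ_succ (f := ρ')]
  have t1 : ∑ j, Fin.tail ρ' j = ∑ i : Fin (m + 1), ρ' i.succ := rfl
  rw [t1]
  generalize ∑ i : Fin (m + 1), ρ' i.succ = s' at *
  generalize ∑ i : Fin m, ρ i.succ = s at *
  have e4 : omegaPow (ρ' 0 + s' - (ρ 0 + s) + t - ρ' 0) =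
      omegaPow s' / (omegaPow (ρ 0) * omegaPow s) * omegaPow t := by
    rw [← omegaPow_add, ← omegaPow_sub, ← omegaPow_add]
    congr 1
    ring
  rw [e4, omegaPow_neg, omegaPow_neg, omegaPow_neg]
  have n1 := omegaPow_ne_zero t
  have n2 := omegaPow_ne_zero s
  have n3 := omegaPow_ne_zero s'
  have n4 := omegaPow_ne_zero (ρ 0)
  change _ * (_ / (_ * _) * Qcommon M A Ph (m + 1) ρ (Fin.tail ρ')) = _
  change A.r (m + 2) ≠ 0 at hr
  generalize ∏ l : Fin m, Ph.Y (m + 2) (k + 1) (m + 1) (l + 1) = W1 at *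
  generalize ∏ l : Fin m, A.R (m + 1) (l + 1) = W2 at *
  generalize ∏ l, (bZero A (m + 1) (Fin.tail ρ') k - bZero A m (Fin.tail ρ) l) = W3 at *
  field_simp

omit [NeZero N] in
theorem smul_tens {m : ℕ} (c : ℂ) (f : State N m) (g : ZMod N → ℂ) :
    c • tens N m f g = tens N m (c • f) g := by
  rw [map_smul, LinearMap.smul_apply]

omit [NeZero N] in
theorem tens_smul {m : ℕ} (c : ℂ) (f : State N m) (g : ZMod N → ℂ) :
    tens N m f (c • g) = tens N m (c • f) g := by
  rw [map_smul, smul_tens]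

omit [NeZero N] in
theorem tens_add_tens {m : ℕ} (f f' : State N m) (g : ZMod N → ℂ) :
    tens N m f g + tens N m f' g = tens N m (f + f') g := by
  rw [map_add, LinearMap.add_apply]

/-- The component of `Ψ_{ρ'}` along the vector `ψ_t` of the last site. -/
def slice (M : Model N n) (A : Amplitudes) (Ph : Phases n) (m : ℕ) (ρ' : Fin (m + 2) → ZMod N)
    (t : ZMod N) : State N (m + 1) :=
  ∑ ρ, Q M A Ph (m + 1) ρ t ρ' • Psi M A Ph (m + 1) ρ

theorem Psi_succ (M : Model N n) (A : Amplitudes) (Ph : Phases n) (m : ℕ)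
    (ρ' : Fin (m + 2) → ZMod N) :
    Psi M A Ph (m + 2) ρ' = ∑ t, tens N (m + 1) (slice M A Ph m ρ' t) (psi M A (m + 2) t) := by
  funext γ
  change ∑ ρ : Fin (m + 1) → ZMod N, ∑ t : ZMod N, Q M A Ph (m + 1) ρ t ρ' *
    (Psi M A Ph (m + 1) ρ (Fin.init γ) * psi M A (m + 2) t (γ (Fin.last (m + 1)))) = _
  rw [sum_comm]
  simp only [slice, map_sum, map_smul, LinearMap.sum_apply, LinearMap.smul_apply, Finset.sum_apply,
    Pi.smul_apply, smul_eq_mul, tens_apply]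

theorem sum_tens_psi_add_one (M : Model N n) (A : Amplitudes) (m k : ℕ) (e : ZMod N → State N m) :
    ∑ t, tens N m (e t) (psi M A k (t + 1)) = ∑ t, tens N m (e (t - 1)) (psi M A k t) := by
  rw [← Equiv.sum_comp (Equiv.addRight (1 : ZMod N))
    (fun t => tens N m (e (t - 1)) (psi M A k t))]
  simp

theorem Level.B_slice {m : ℕ} (hl : Level M A Ph m) (x : ℂ) (ρ' : Fin (m + 2) → ZMod N)
    (t : ZMod N) :
    mono N M.bulk (m + 1) x 0 1 (slice M A Ph m ρ' t) =
      ∑ ρ, (Q M A Ph (m + 1) ρ t ρ' *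
        (x * (A.R (m + 1) 0 * omegaPow (-ρ 0) * ∏ k, (x - bZero A m (Fin.tail ρ) k)))) •
          Psi M A Ph (m + 1) ρ := by
  simp only [slice, map_sum, map_smul, hl.B_eq, smul_smul]

theorem Level.succ_shift {m : ℕ} (hl : Level M A Ph m) (ρ' : Fin (m + 2) → ZMod N) :
    vAll N (m + 2) (Psi M A Ph (m + 2) ρ') = Psi M A Ph (m + 2) (ρ' + Pi.single 0 1) := by
  rw [Psi_succ, Psi_succ, map_sum]
  simp only [vAll_tens, psi_sub_one]
  rw [sum_tens_psi_add_one M A (m + 1) (m + 2)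
    (fun t => vAll N (m + 1) (slice M A Ph m ρ' t))]
  refine sum_congr rfl fun t _ => ?_
  congr 2
  simp only [slice, map_sum, map_smul, hl.shift]
  rw [sum_smul_shift]
  simp only [Q_add_single_zero]

/-- In B_{m+2} = A_{m+1} b + B_{m+1} d, the entry b is diagonal on ψ_t and d maps ψ_t to a
combination of ψ_t and ψ_{t+1}. After reindexing the second part, each component along ψ_t is an
instance of `Level.sum_A_eq`, with q₁ coming from t − 1. -/
theorem Level.succ_B_eq (h : Regular M A Ph) {m : ℕ} (hm : m + 1 < n) (hl : Level M A Ph m)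
    (x : ℂ) (ρ' : Fin (m + 2) → ZMod N) :
    mono N M.bulk (m + 2) x 0 1 (Psi M A Ph (m + 2) ρ') =
      (x * (A.R (m + 2) 0 * omegaPow (-ρ' 0) *
        ∏ k, (x - bZero A (m + 1) (Fin.tail ρ') k))) • Psi M A Ph (m + 2) ρ' := by
  have hstep : ∀ t, (A.r (m + 2) * omegaPow (-t)) • mono N M.bulk (m + 1) x 0 0
      (slice M A Ph m ρ' t) = _ := fun t =>
    hl.sum_A_eq h (by omega) (fun ρ => Q M A Ph (m + 1) ρ t ρ')
      (fun ρ => (M.bulk (m + 2)).b * (M.bulk (m + 2)).d / (M.bulk (m + 2)).kap *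
            Q M A Ph (m + 1) ρ (t - 1) ρ') (Fin.tail ρ') (A.r (m + 2) * omegaPow (-t))
      (A.R (m + 2) 0 * omegaPow (-ρ' 0)) ((M.bulk (m + 2)).a * (M.bulk (m + 2)).c)
      (fun ρ => Q_sub_single_zero h hm ρ t ρ')
      (fun ρ => by
        rw [mul_prod_neg_bZero, mul_prod_neg_bZero]
        exact Q_sub_one h hm ρ t ρ')
      (fun ρ k => Q_sub_single_succ h hm ρ t ρ' k) x
  have hb : ∀ t, L1 (M.bulk (m + 2)) x 0 1 (psi M A (m + 2) t) =
      (x * (A.r (m + 2) * omegaPow (-t))) • psi M A (m + 2) t := L1_01_psi h hm x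
  have h1 : ∀ t, mono N M.bulk (m + 2) x 0 1
        (tens N (m + 1) (slice M A Ph m ρ' t) (psi M A (m + 2) t)) =
      tens N (m + 1) (x • (A.r (m + 2) * omegaPow (-t)) • mono N M.bulk (m + 1) x 0 0
        (slice M A Ph m ρ' t) + (x * (M.bulk (m + 2)).a * (M.bulk (m + 2)).c) •
          mono N M.bulk (m + 1) x 0 1 (slice M A Ph m ρ' t)) (psi M A (m + 2) t) +
      tens N (m + 1) (((M.bulk (m + 2)).b * (M.bulk (m + 2)).d / (M.bulk (m + 2)).kap) •
          mono N M.bulk (m + 1) x 0 1 (slice M A Ph m ρ' t)) (psi M A (m + 2) (t + 1)) := by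
    intro t
    rw [mono_succ_tens, hb, L1_11_psi]
    simp only [map_add, map_smul, LinearMap.add_apply, LinearMap.smul_apply, smul_smul]
    abel
  rw [Psi_succ, map_sum, sum_congr rfl fun t _ => h1 t, sum_add_distrib,
    sum_tens_psi_add_one M A (m + 1) (m + 2) (fun t =>
      ((M.bulk (m + 2)).b * (M.bulk (m + 2)).d / (M.bulk (m + 2)).kap) •
          mono N M.bulk (m + 1) x 0 1 (slice M A Ph m ρ' t)), ← sum_add_distrib, smul_sum]
  refine sum_congr rfl fun t _ => ?_
  rw [tens_add_tens, smul_tens]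
  congr 2
  rw [hstep t, hl.B_slice, hl.B_slice, slice]
  simp only [smul_sum, ← sum_add_distrib, smul_smul, ← add_smul]
  refine sum_congr rfl fun ρ _ => ?_
  congr 1
  ring

/-- At a zero, B_{m+2} kills Ψ_{ρ'}, so after applying the injective last entry b,
`LOp_last_mul_mono` replaces A_{m+2} by B_{m+1}, which is diagonal on the shorter chain. The
comparison of coefficients is `Q_add_single_succ`. -/
theorem Level.succ_A_eq (h : Regular M A Ph) {m : ℕ} (hm : m + 1 < n) (hl : Level M A Ph m)
    (ρ' : Fin (m + 2) → ZMod N) (k : Fin (m + 1)) :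
    mono N M.bulk (m + 2) (bZero A (m + 1) (Fin.tail ρ') k) 0 0 (Psi M A Ph (m + 2) ρ') =
      phiA M A Ph (m + 1) (Fin.tail ρ') k • Psi M A Ph (m + 2) (ρ' + Pi.single k.succ 1) := by
  set x := bZero A (m + 1) (Fin.tail ρ') k with hx
  have hx0 : x ≠ 0 := bZero_ne h hm.le _ k
  have hk : (M.bulk (m + 2)).kap ≠ 0 := h.kap_ne (m + 1) hm
  have hr : (M.bulk (m + 2)).a ^ N ≠ (M.bulk (m + 2)).b ^ N := by
    have h1 := h.r_pow (m + 1) hm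
    have h2 := pow_ne_zero N (h.r_ne (m + 1) hm.le)
    rw [h1] at h2
    exact sub_ne_zero.1 h2
  have hB : mono N M.bulk (m + 2) x 0 1 (Psi M A Ph (m + 2) ρ') = 0 := by
    rw [hl.succ_B_eq h hm, prod_eq_zero (mem_univ k) (sub_self _), mul_zero, mul_zero, zero_smul]
  have hb : ∀ t, L1 (M.bulk (m + 2)) x 0 1 (psi M A (m + 2) t) =
      (x * (A.r (m + 2) * omegaPow (-t))) • psi M A (m + 2) t := L1_01_psi h hm x
  refine LOp_last_01_injective (S := M.bulk (m + 2)) hr hx0 ?_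
  rw [LOp_last_mul_mono hk x _ hB, Psi_succ, Psi_succ, map_smul]
  simp only [map_sum, list_prod_castSucc_eq_tens, vOp_last_tens, psi_sub_one, LOp_last_tens, hb]
  rw [sum_tens_psi_add_one M A (m + 1) (m + 2) (fun t =>
    mono N M.bulk (m + 1) x 0 1 (slice M A Ph m ρ' t)), smul_sum, smul_sum]
  refine sum_congr rfl fun t _ => ?_
  rw [tens_smul, smul_tens, smul_tens]
  congr 2
  rw [hl.B_slice, slice]
  simp only [smul_sum, smul_smul]
  refine sum_congr rfl fun ρ _ => ?_
  congr 1
  have key := Q_add_single_succ h hm ρ t ρ' k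
  rw [← hx, Model.F, M.site_of_lt hm] at key
  rw [Site.qdet]
  linear_combination x * key

theorem sum_tens_psi_ne_zero (h : Regular M A Ph) {m : ℕ} (hm : m < n)
    (e : ZMod N → State N m) {t₀ : ZMod N} (he : e t₀ ≠ 0) :
    ∑ t, tens N m (e t) (psi M A (m + 1) t) ≠ 0 := by
  intro h0
  apply he
  funext δ
  have h1 := Fintype.linearIndependent_iff.1 (psi_linearIndependent h hm) (fun t => e t δ) ?_ t₀
  · exact h1
  · funext γ
    have h2 := congrFun h0 (Fin.snoc δ γ)
    simp only [Finset.sum_apply, tens_apply, Fin.init_snoc, Fin.snoc_last, Pi.smul_apply,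
      smul_eq_mul] at h2 ⊢
    exact h2

theorem Level.succ (h : Regular M A Ph) {m : ℕ} (hm : m + 1 < n) (hl : Level M A Ph m) :
    Level M A Ph (m + 1) := by
  refine ⟨hl.succ_shift, hl.succ_B_eq h hm, hl.succ_A_eq h hm, ?_⟩
  refine linearIndependent_of_joint_eigenvectors (fun t => mono N M.bulk (m + 2) t 0 1) _ _
    (fun t ρ => hl.succ_B_eq h hm t ρ) (fun ρ ρ' hρ => exists_eigenvalue_ne h hm hρ) ?_
  intro ρ' h0
  rw [Psi_succ] at h0
  -- Any component would do: each is a combination of independent vectors with non-zero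
  -- coefficients.
  refine sum_tens_psi_ne_zero h hm _ (t₀ := 0) ?_ h0
  intro h1
  exact Q_ne h hm 0 0 ρ' (Fintype.linearIndependent_iff.1 hl.indep _ h1 0)

theorem Psi_one (M : Model N n) (A : Amplitudes) (Ph : Phases n) (ρ : Fin 1 → ZMod N) :
    Psi M A Ph 1 ρ = tens N 0 1 (psi M A 1 (ρ 0)) := by
  funext γ
  change psi M A 1 (ρ 0) (γ 0) = 1 * psi M A 1 (ρ 0) (γ 0)
  rw [one_mul]

theorem level_zero (h : Regular M A Ph) (hn : 0 < n) : Level M A Ph 0 := by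
  have hB : ∀ t ρ, mono N M.bulk 1 t 0 1 (Psi M A Ph 1 ρ) =
      (t * (A.R 1 0 * omegaPow (-ρ 0) * ∏ k, (t - bZero A 0 (Fin.tail ρ) k))) •
      Psi M A Ph 1 ρ := by
    intro t ρ
    have hb : L1 (M.bulk 1) t 0 1 (psi M A 1 (ρ 0)) =
      (t * (A.r 1 * omegaPow (-ρ 0))) • psi M A 1 (ρ 0) := L1_01_psi h hn t (ρ 0)
    rw [Psi_one, mono_succ_tens, hb, h.R_one]
    simp [mono]
  refine ⟨fun ρ => ?_, hB, fun ρ k => k.elim0, ?_⟩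
  · rw [Psi_one, vAll_tens, psi_sub_one, Psi_one]
    simp only [Pi.add_apply, Pi.single_eq_same]
    rfl
  · refine linearIndependent_of_joint_eigenvectors (fun t => mono N M.bulk 1 t 0 1) _ _
      hB (fun ρ ρ' hρ => exists_eigenvalue_ne h hn hρ) ?_
    intro ρ h0
    exact (psi_onFermat h hn).w_ne (ρ 0 - ρ 0) (congrFun h0 ρ)

theorem level (h : Regular M A Ph) {m : ℕ} (hm : m < n) : Level M A Ph m := by
  induction m with
  | zero => exact level_zero h hm
  | succ m ih => exact (ih (by omega)).succ h hm

end Step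

/-! ### The boundary vectors and the action of the transfer matrix on them -/

section Boundary

variable {N m : ℕ} [NeZero N] {M : Model N (m + 1)} {A : Amplitudes} {Ph : Phases (m + 1)}

theorem QB_ne (h : Regular M A Ph) (ρ τ : Fin (m + 1) → ZMod N) : QB M A Ph ρ τ ≠ 0 := by
  rw [QB]
  exact mul_ne_zero (div_ne_zero (omegaPow_ne_zero _) ((h.zero_last m rfl).w_ne _))
    (Qcommon_ne h (by omega) _ _)

/-- The boundary analogue of `Q_sub_single_zero`: the right boundary vector plays the part of a last
site without spin, and the index ρ_{n+1,0} is tied to the value γ_0 + 1 − Στ. -/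
theorem QB_sub_single_zero (h : Regular M A Ph) (ρ τ : Fin (m + 1) → ZMod N) :
    M.a0 * omegaPow (-M.g0) * (∏ k ∈ Icc 1 (m + 1), (M.bulk k).kap) *
        QB M A Ph (ρ - Pi.single 0 1) τ =
      (A.R (m + 2) 0 * omegaPow (-(M.g0 + 1 - ∑ k, τ k)) - A.R (m + 1) 0 * omegaPow (-ρ 0) *
        (M.a0 * omegaPow (-M.g0) * (omegaPow M.gEnd * M.cEnd))) * QB M A Ph ρ τ := by
  have e1 : M.gEnd - ∑ k, τ k - (ρ - Pi.single 0 1 : Fin (m + 1) → ZMod N) 0 =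
      M.gEnd - ∑ k, τ k - ρ 0 + 1 := by
    simp only [Pi.sub_apply, Pi.single_eq_same]
    ring
  have e2 : (M.g0 + 1 - (∑ k, ρ k - 1)) * (∑ k, τ k - 1) =
      (M.g0 + 1 - ∑ k, ρ k) * (∑ k, τ k - 1) + (∑ k, τ k - 1) := by ring
  have hw := (h.zero_last m rfl).w_rec (M.gEnd - ∑ k, τ k - ρ 0 + 1)
  rw [add_sub_cancel_right] at hw
  have hz := (h.zero_last m rfl).w_ne (M.gEnd - ∑ k, τ k - ρ 0)
  have hz' := (h.zero_last m rfl).w_ne (M.gEnd - ∑ k, τ k - ρ 0 + 1)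
  have hR : A.R (m + 2) 0 ≠ 0 := h.R_ne (m + 1) le_rfl 0 (Nat.zero_le _)
  have e3 : omegaPow (M.gEnd - ∑ k, τ k - ρ 0 + 1) =
      omegaPow M.gEnd / omegaPow (∑ k, τ k) / omegaPow (ρ 0) * omega N := by
    rw [omegaPow_add, omegaPow_sub, omegaPow_sub, omegaPow_one]
  have e4 : omegaPow (-(M.g0 + 1 - ∑ k, τ k)) =
      omegaPow (∑ k, τ k) / (omegaPow M.g0 * omega N) := by
    rw [← omegaPow_one, ← omegaPow_add, ← omegaPow_sub]
    congr 1
    ring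
  rw [e3] at hw
  rw [QB, QB, sum_sub_single, Qcommon_sub_single_zero, e1, e2, e4, omegaPow_add, omegaPow_sub,
    omegaPow_neg, omegaPow_neg, omegaPow_one]
  have n0 := omega_ne_zero (N := N)
  have n1 := omegaPow_ne_zero M.g0
  have n2 := omegaPow_ne_zero (∑ k, τ k)
  have n3 := omegaPow_ne_zero (ρ 0)
  have n4 := omegaPow_ne_zero M.gEnd
  generalize w _ _ (M.gEnd - ∑ k, τ k - ρ 0) = w1 at *
  generalize w _ _ (M.gEnd - ∑ k, τ k - ρ 0 + 1) = w0 at *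
  generalize Qcommon M A Ph (m + 1) ρ _ = w3 at *
  generalize omegaPow ((M.g0 + 1 - ∑ k, ρ k) * (∑ k, τ k - 1)) = w4 at *
  generalize ∏ k ∈ Icc 1 (m + 1), (M.bulk k).kap = K at *
  field_simp at hw ⊢
  linear_combination (-w4 * w3) * hw

theorem QB_sub_single_succ (h : Regular M A Ph) (ρ τ : Fin (m + 1) → ZMod N) (k : Fin m) :
    QB M A Ph (ρ - Pi.single k.succ 1) τ *
        (M.a0 * omegaPow (-M.g0) * phiA M A Ph m (Fin.tail ρ - Pi.single k 1) k /
          (omega N * bZero A m (Fin.tail ρ) k *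
            ∏ l ∈ univ.erase k, (omega N * bZero A m (Fin.tail ρ) k - bZero A m (Fin.tail ρ) l))) =
      QB M A Ph ρ τ *
        (A.R (m + 2) 0 * omegaPow (-(M.g0 + 1 - ∑ k, τ k)) *
            (∏ j, (bZero A m (Fin.tail ρ) k - bZero A (m + 1) τ j)) /
          (bZero A m (Fin.tail ρ) k *
            ∏ l ∈ univ.erase k, (bZero A m (Fin.tail ρ) k - bZero A m (Fin.tail ρ) l))) := by
  have key := Qcommon_mul_phiA h (m := m) (by omega) ρ τ k
  have hr : A.r (m + 2) = M.a0 := h.r_last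
  have e1 : (ρ - Pi.single k.succ 1 : Fin (m + 1) → ZMod N) 0 = ρ 0 := by simp
  have e2 : (M.g0 + 1 - (∑ k, ρ k - 1)) * (∑ k, τ k - 1) =
      (M.g0 + 1 - ∑ k, ρ k) * (∑ k, τ k - 1) + (∑ k, τ k - 1) := by ring
  have e4 : omegaPow (-(M.g0 + 1 - ∑ k, τ k)) = omegaPow (∑ k, τ k - 1) * omegaPow (-M.g0) := by
    rw [← omegaPow_add]
    congr 1
    ring
  rw [hr] at key
  rw [QB, QB, sum_sub_single, e1, e2, omegaPow_add, e4]
  have e3 : ∀ x u v c d : ℂ, x * v / u * c * d = x / u * (v * c * d) :=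
    fun x u v c d => by ring
  rw [e3, mul_assoc (omegaPow ((M.g0 + 1 - ∑ k, ρ k) * (∑ k, τ k - 1)) / _)]
  congr 1
  linear_combination (omegaPow (∑ k, τ k - 1) * omegaPow (-M.g0)) * key

/-- The constant in `B_n(λ_k) Ψ^B_τ = c_k v_1 ⋯ v_n Ψ^B_{τ + e_k}`. -/
def constB (M : Model N (m + 1)) (A : Amplitudes) (Ph : Phases (m + 1)) (τ : Fin (m + 1) → ZMod N)
    (k : Fin (m + 1)) : ℂ :=
  bZero A (m + 1) τ k * A.rt (m + 1) * (∏ l : Fin m, Ph.Y (m + 2) (k + 1) (m + 1) (l + 1)) *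
    omegaPow (-∑ j, τ j - M.g0 - 1)

theorem constB_ne (h : Regular M A Ph) (τ : Fin (m + 1) → ZMod N) (k : Fin (m + 1)) :
    constB M A Ph τ k ≠ 0 :=
  mul_ne_zero (mul_ne_zero (mul_ne_zero (bZero_ne h le_rfl _ _) (rt_ne h (by omega)))
    (prod_ne_zero_iff.2 fun l _ => (h.next m (by omega) k l).ne)) (omegaPow_ne_zero _)

/-- Raising τ_k alone would move the argument of w at p_{n+1,0}; lowering ρ_0 at the same time
restores it. The remaining ratio is the eigenvalue of B_n up to a constant independent of ρ. -/
theorem QB_add_single (h : Regular M A Ph) (ρ τ : Fin (m + 1) → ZMod N) (k : Fin (m + 1)) :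
    QB M A Ph ρ τ * (bZero A (m + 1) τ k * (A.R (m + 1) 0 * omegaPow (-ρ 0) *
          ∏ l, (bZero A (m + 1) τ k - bZero A m (Fin.tail ρ) l))) =
      constB M A Ph τ k * QB M A Ph (ρ - Pi.single 0 1) (τ + Pi.single k 1) := by
  have e1 : M.gEnd - (∑ k, τ k + 1) - (ρ - Pi.single 0 1 : Fin (m + 1) → ZMod N) 0 =
      M.gEnd - ∑ k, τ k - ρ 0 := by
    simp only [Pi.sub_apply, Pi.single_eq_same]
    ring
  have e2 : (M.g0 + 1 - (∑ k, ρ k - 1)) * (∑ k, τ k + 1 - 1) =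
      (M.g0 + 1 - ∑ k, ρ k) * (∑ k, τ k - 1) + (∑ k, τ k + M.g0 + 1 - ∑ k, ρ k) := by ring
  have hY : ∏ l : Fin m, Ph.Y (m + 2) (k + 1) (m + 1) (l + 1) ≠ 0 :=
    prod_ne_zero_iff.2 fun l _ => (h.next m (by omega) k l).ne
  have hRl : ∏ l : Fin m, A.R (m + 1) (l + 1) ≠ 0 :=
    prod_ne_zero_iff.2 fun l _ => h.R_ne m (by omega) _ l.2
  have e3 : omegaPow (-∑ j, τ j - M.g0 - 1) = (omegaPow (∑ k, τ k + M.g0 + 1))⁻¹ := by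
    rw [← omegaPow_neg]
    congr 1
    ring
  rw [QB, QB, sum_sub_single, sum_add_single, e1, e2, Qcommon_add_single h (by omega),
    Qcommon_sub_single_zero, omegaPow_add, omegaPow_sub (∑ k, τ k + M.g0 + 1), constB, e3,
    A.rt_succ m, Fin.sum_univ_succ (f := ρ), omegaPow_add (ρ 0), omegaPow_sum, prod_div_distrib,
    prod_mul_distrib, prod_div_distrib, omegaPow_neg]
  have ht : Fin.tail (ρ - Pi.single 0 1) = Fin.tail ρ := by
    funext l
    simp [Fin.tail]
  have hs : ∀ l : Fin m, (ρ - Pi.single 0 1 : Fin (m + 1) → ZMod N) l.succ = ρ l.succ := by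
    intro l
    simp
  simp only [ht, hs]
  have n1 := omegaPow_ne_zero (∑ k, τ k + M.g0 + 1)
  have n3 := omegaPow_ne_zero (ρ 0)
  have n4 : ∏ l : Fin m, omegaPow (ρ l.succ) ≠ 0 := prod_ne_zero_iff.2 fun l _ =>
    omegaPow_ne_zero _
  have hz := (h.zero_last m rfl).w_ne (M.gEnd - ∑ k, τ k - ρ 0)
  field_simp

/-- The shift of ρ_0 in `QB_add_single` is the action of V on Ψ_ρ, by `Level.shift`. -/
theorem B_PsiB (h : Regular M A Ph) (τ : Fin (m + 1) → ZMod N) (k : Fin (m + 1)) :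
    mono N M.bulk (m + 1) (bZero A (m + 1) τ k) 0 1 (PsiB M A Ph τ) =
      constB M A Ph τ k • vAll N (m + 1) (PsiB M A Ph (τ + Pi.single k 1)) := by
  have hl := level h (m := m) (by omega)
  simp only [PsiB, map_sum, map_smul, hl.B_eq, hl.shift, smul_smul]
  refine Eq.trans ?_ (congrArg (constB M A Ph τ k • ·) (sum_smul_shift
    (fun ρ => QB M A Ph ρ (τ + Pi.single k 1)) (Psi M A Ph (m + 1)) (Pi.single 0 1)).symm)
  simp only [smul_sum]
  refine sum_congr rfl fun ρ _ => ?_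
  rw [smul_smul, QB_add_single h]

/-- The argument of `Level.succ_B_eq` with the boundary vector in place of the last site. Its
averaged counterpart has b d/κ = 0, so there is no q₁. -/
theorem A_PsiB (h : Regular M A Ph) (ha : M.a0 ≠ 0) (τ : Fin (m + 1) → ZMod N) (t : ℂ) :
    (M.a0 * omegaPow (-M.g0)) • (mono N M.bulk (m + 1) t 0 0 (PsiB M A Ph τ) +
        (omegaPow M.gEnd * M.cEnd) • mono N M.bulk (m + 1) t 0 1 (PsiB M A Ph τ)) =
      (A.R (m + 2) 0 * omegaPow (-(M.g0 + 1 - ∑ k, τ k)) *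
        ∏ j, (t - bZero A (m + 1) τ j)) • PsiB M A Ph τ := by
  have hl := level h (m := m) (by omega)
  -- The normalization r̃_{n+1} = ωa_0 enters here: with q₁ = 0 the constant-coefficient condition
  -- must hold exactly. The tuple extended by γ_0 + 1 − Στ has total γ_0 + 1, and the surplus 1 is
  -- compensated by that ω.
  have e1 : A.R (m + 2) 0 * omegaPow (-(M.g0 + 1 - ∑ k, τ k)) * ∏ j, (-bZero A (m + 1) τ j) =
      M.a0 * omegaPow (-M.g0) := by
    have h1 := mul_prod_neg_bZero A (m + 1)
      (Fin.cons (M.g0 + 1 - ∑ k, τ k) τ : Fin (m + 2) → ZMod N)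
    have hs : ∑ k, (Fin.cons (M.g0 + 1 - ∑ k, τ k) τ : Fin (m + 2) → ZMod N) k = M.g0 + 1 := by
      rw [Fin.sum_univ_succ]
      simp
    rw [Fin.tail_cons, Fin.cons_zero, hs] at h1
    rw [h1, h.rt_last, neg_add', omegaPow_sub, omegaPow_one]
    have := omega_ne_zero (N := N)
    field_simp
  have hstep := hl.sum_A_eq h (by omega) (fun ρ => QB M A Ph ρ τ) (fun _ => 0) τ
    (M.a0 * omegaPow (-M.g0)) (A.R (m + 2) 0 * omegaPow (-(M.g0 + 1 - ∑ k, τ k)))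
    (M.a0 * omegaPow (-M.g0) * (omegaPow M.gEnd * M.cEnd))
    (fun ρ => QB_sub_single_zero h ρ τ) (fun ρ => by rw [e1]; ring)
    (fun ρ k => QB_sub_single_succ h ρ τ k) t
  rw [smul_add, PsiB, hstep]
  simp only [map_sum, map_smul, hl.B_eq, smul_smul, smul_sum, ← sum_add_distrib, ← add_smul]
  refine sum_congr rfl fun ρ _ => ?_
  congr 1
  ring

theorem tB_eq (M : Model N (m + 1)) (t : ℂ) (f : State N (m + 1)) :
    M.tB t f = (mono N M.bulk (m + 1) t 0 0 f +
        (omegaPow M.gEnd * M.cEnd) • mono N M.bulk (m + 1) t 0 1 f) +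
      (t * omegaPow (-M.g0) * M.a0) • (mono N M.bulk (m + 1) t 1 0 f +
        (omegaPow M.gEnd * M.cEnd) • mono N M.bulk (m + 1) t 1 1 f) := by
  have hm : M.monodromy t = mono N M.bulk (m + 1) t := rfl
  simp only [Model.tB, hm, Fin.sum_univ_two, Matrix.cons_val_zero, Matrix.cons_val_one,
    Matrix.cons_val_fin_one, LinearMap.add_apply, LinearMap.smul_apply, one_mul, mul_one, one_smul,
    smul_add, smul_smul]

/-- The (1, 0) entry of the quantum determinant reads C(t/ω)B(t) − ωD(t/ω)A(t) = −ω qdet V. At a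
zero A acts on Ψ^B_τ as −c'B, and BΨ^B_τ is a multiple of VΨ^B_{τ+e_k}. The twist brings V to the
left, supplying the missing ω next to C, and V is then cancelled by injectivity. -/
theorem CD_PsiB (h : Regular M A Ph) (ha : M.a0 ≠ 0) (τ : Fin (m + 1) → ZMod N)
    (k : Fin (m + 1)) :
    constB M A Ph τ k •
        (mono N M.bulk (m + 1) (bZero A (m + 1) τ k / omega N) 1 0
            (PsiB M A Ph (τ + Pi.single k 1)) +
          (omegaPow M.gEnd * M.cEnd) • mono N M.bulk (m + 1) (bZero A (m + 1) τ k / omega N) 1 1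
            (PsiB M A Ph (τ + Pi.single k 1))) =
      -(∏ l : Fin (m + 1), (M.bulk (l + 1)).qdet N (bZero A (m + 1) τ k / omega N)) •
        PsiB M A Ph τ := by
  have hω := omega_ne_zero (N := N)
  set t := bZero A (m + 1) τ k with ht
  set Ψ := PsiB M A Ph τ
  set Ψ' := PsiB M A Ph (τ + Pi.single k 1)
  set c' := omegaPow M.gEnd * M.cEnd
  have hX : mono N M.bulk (m + 1) t 0 0 Ψ = -(c' • mono N M.bulk (m + 1) t 0 1 Ψ) := by
    have h1 := A_PsiB h ha τ t
    rw [prod_eq_zero (mem_univ k) (sub_self _), mul_zero, zero_smul] at h1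
    exact eq_neg_of_add_eq_zero_left
      ((smul_eq_zero.1 h1).resolve_left (mul_ne_zero ha (omegaPow_ne_zero _)))
  have hB : mono N M.bulk (m + 1) t 0 1 Ψ = constB M A Ph τ k • vAll N (m + 1) Ψ' := B_PsiB h τ k
  have hq := mono_quantumDet (N := N) (S := M.bulk) (m := m + 1) (fun l => h.kap_ne l l.2) t 1 0
  have d10 : detForm (omega N) 1 0 = -omega N := rfl
  rw [d10] at hq
  have hq' := congrArg (fun X => X Ψ) hq
  simp only [LinearMap.sub_apply, LinearMap.smul_apply, Module.End.mul_apply, hX, map_neg,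
    map_smul, hB] at hq'
  have hC := congrArg (fun X => X Ψ') (mono_twist (N := N) (m := m + 1) M.bulk (t / omega N) 1 0)
  have hD := congrArg (fun X => X Ψ') (mono_twist (N := N) (m := m + 1) M.bulk (t / omega N) 1 1)
  simp only [LinearMap.smul_apply, Module.End.mul_apply, Matrix.cons_val_zero, one_smul,
    Matrix.cons_val_one, Matrix.cons_val_fin_one] at hC hD
  have hD' := smul_right_injective _ hω hD
  rw [hC, hD'] at hq'
  refine vAll_injective (smul_right_injective _ hω ?_)
  simp only [map_smul, map_add, smul_add, smul_smul, smul_neg, sub_neg_eq_add, neg_smul,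
    neg_mul, map_neg] at hq' ⊢
  rw [← hq']
  congr 1
  · congr 1
    ring
  · congr 1
    ring

/-- The coefficient in `t^B(λ_k) Ψ^B_τ = D_k Ψ^B_{τ - e_k}`, at `τ + e_k`. -/
def coeffD (M : Model N (m + 1)) (A : Amplitudes) (Ph : Phases (m + 1)) (τ : Fin (m + 1) → ZMod N)
    (k : Fin (m + 1)) : ℂ :=
  -(M.a0 * (∏ l : Fin (m + 1), (M.bulk (l + 1)).qdet N (bZero A (m + 1) τ k / omega N)) *
    omegaPow (∑ j, τ j)) /
      (A.rt (m + 1) * ∏ l : Fin m, Ph.Y (m + 2) (k + 1) (m + 1) (l + 1))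

/-- Dividing by ω gives the zero that belongs to τ + e_k, where the A- and B-part of t^B vanishes on
Ψ^B_{τ+e_k}. Only the part evaluated in `CD_PsiB` remains, so t^B lowers the index. -/
theorem tB_PsiB (h : Regular M A Ph) (ha : M.a0 ≠ 0) (τ : Fin (m + 1) → ZMod N)
    (k : Fin (m + 1)) :
    M.tB (bZero A (m + 1) τ k / omega N) (PsiB M A Ph (τ + Pi.single k 1)) =
      coeffD M A Ph τ k • PsiB M A Ph τ := by
  have hω := omega_ne_zero (N := N)
  have hX : mono N M.bulk (m + 1) (bZero A (m + 1) τ k / omega N) 0 0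
      (PsiB M A Ph (τ + Pi.single k 1)) + (omegaPow M.gEnd * M.cEnd) •
        mono N M.bulk (m + 1) (bZero A (m + 1) τ k / omega N) 0 1
          (PsiB M A Ph (τ + Pi.single k 1)) = 0 := by
    have h1 := A_PsiB h ha (τ + Pi.single k 1) (bZero A (m + 1) τ k / omega N)
    rw [prod_eq_zero (mem_univ k) (by rw [bZero_add_single_self, sub_self]), mul_zero,
      zero_smul] at h1
    exact (smul_eq_zero.1 h1).resolve_left (mul_ne_zero ha (omegaPow_ne_zero _))
  have hc := constB_ne h τ k
  have hCD := CD_PsiB h ha τ k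
  rw [tB_eq, hX, zero_add]
  refine smul_right_injective _ hc ?_
  simp only
  rw [smul_comm, hCD, smul_smul, smul_smul]
  congr 1
  have hY : ∏ l : Fin m, Ph.Y (m + 2) (k + 1) (m + 1) (l + 1) ≠ 0 :=
    prod_ne_zero_iff.2 fun l _ => (h.next m (by omega) k l).ne
  have hrt := rt_ne h (m := m) (by omega)
  have e3 : omegaPow (-∑ j, τ j - M.g0 - 1) =
      (omegaPow (∑ k, τ k) * omegaPow M.g0 * omega N)⁻¹ := by
    rw [← omegaPow_one, ← omegaPow_add, ← omegaPow_add, ← omegaPow_neg]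
    congr 1
    ring
  rw [constB, coeffD, e3, omegaPow_neg]
  have n1 := omegaPow_ne_zero (∑ k, τ k)
  have n2 := omegaPow_ne_zero M.g0
  field_simp

theorem HasEnds.raise {E : Type*} [Ring E] [Algebra ℂ E] {m : ℕ} {f : ℂ → E} {c₀ c₁ : E}
    (hf : HasEnds m f c₀ c₁) : HasEnds (m + 1) f c₀ 0 := by
  obtain ⟨p, hp, p0, _, hpe⟩ := hf
  exact ⟨p, by omega, p0, coeff_eq_zero_of_natDegree_lt (by omega), hpe⟩

theorem HasEnds.smul_left {E : Type*} [Ring E] [Algebra ℂ E] {m : ℕ} {f : ℂ → E} {c₀ c₁ : E}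
    (hf : HasEnds m f c₀ c₁) (x : ℂ) : HasEnds m (fun t => x • f t) (x • c₀) (x • c₁) := by
  have h1 := (HasEnds.const (x • (1 : E))).mul hf
  rw [zero_add] at h1
  exact h1.congr (fun t => by simp) (by simp) (by simp)

theorem HasEnds.param_smul {E : Type*} [Ring E] [Algebra ℂ E] {m : ℕ} {f : ℂ → E} {c₀ c₁ : E}
    (hf : HasEnds m f c₀ c₁) : HasEnds (m + 1) (fun t => t • f t) 0 c₁ := by
  have h1 := (HasEnds.linear (0 : E) 1).mul hf
  rw [add_comm 1 m] at h1
  exact h1.congr (fun t => by simp) (by simp) (by simp)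

/-- The second boundary component carries an extra factor t, so only D reaches degree n + 1; both
outer coefficients are therefore scalars, without V. -/
theorem tB_hasEnds (M : Model N (m + 1)) :
    HasEnds (m + 2) M.tB 1 ((omegaPow (-M.g0) * M.a0 * (omegaPow M.gEnd * M.cEnd) *
      ∏ k : Fin (m + 1), (M.bulk (k + 1)).a * (M.bulk (k + 1)).c) • 1) := by
  obtain ⟨ha, ⟨_, hb⟩, ⟨_, hc⟩, ⟨_, hd⟩⟩ := mono_matEnds (N := N) M.bulk (m + 1)
  refine ((ha.raise.add (hb.raise.smul_left (omegaPow M.gEnd * M.cEnd))).add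
    ((hc.add (hd.smul_left (omegaPow M.gEnd * M.cEnd))).smul_left
      (omegaPow (-M.g0) * M.a0)).param_smul).congr (fun t => ?_) ?_ ?_
  · refine LinearMap.ext fun f => ?_
    rw [tB_eq]
    simp only [LinearMap.add_apply, LinearMap.smul_apply, smul_smul, mul_assoc]
  · simp
  · simp [smul_smul, mul_assoc]

theorem PsiB_linearIndependent (h : Regular M A Ph) (ha : M.a0 ≠ 0) :
    LinearIndependent ℂ (PsiB M A Ph) := by
  refine linearIndependent_of_joint_eigenvectors
    (fun t => (M.a0 * omegaPow (-M.g0)) • (mono N M.bulk (m + 1) t 0 0 +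
        (omegaPow M.gEnd * M.cEnd) • mono N M.bulk (m + 1) t 0 1)) _ _
    (fun t τ => A_PsiB h ha τ t) (fun τ τ' hτ => ?_) (fun τ h0 => ?_)
  · obtain ⟨k, hk⟩ := exists_prod_sub_bZero_ne h le_rfl hτ
    refine ⟨bZero A (m + 1) τ k, ?_⟩
    rw [prod_eq_zero (mem_univ k) (sub_self _), mul_zero]
    exact (mul_ne_zero (mul_ne_zero (h.R_ne (m + 1) le_rfl 0 (Nat.zero_le _))
      (omegaPow_ne_zero _)) hk).symm
  · exact QB_ne h 0 τ (Fintype.linearIndependent_iff.1 (level h (m := m) (by omega)).indep _ h0 0)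

end Boundary

/-! ### Baxter equations and the eigenvectors of the transfer matrix -/

section Eigenvector

variable {N m : ℕ} [NeZero N] {M : Model N (m + 1)} {A : Amplitudes} {Ph : Phases (m + 1)}
  {s : Fin (m + 2) → ℂ}

/-- Genericity of the points of the Fermat curve that enter the functions of the separated
variables. -/
structure BoundaryCurves (M : Model N (m + 1)) (A : Amplitudes) (s : Fin (m + 2) → ℂ)
    (Ph : Phases (m + 1)) : Prop where
  s_ne : ∀ j, s j ≠ 0
  BB : ∀ j k, OnFermat N (xBB A s j k) (Ph.yBB j k)
  B : ∀ l k, OnFermat N (xB M A l k) (Ph.yB l k)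
  tilde_B : ∀ l k, OnFermat N (xtB M A l k) (Ph.ytB l k)
  rel : ∀ k : Fin (m + 1),
    ∏ l : Fin (m + 1),
        (omega N * (M.bulk (l + 1)).a * (M.bulk (l + 1)).d * Ph.yB l k * Ph.ytB l k) =
      chi M A Ph k * ∏ j : Fin (m + 2), Ph.yBB j k

/-- At the boundary site b = κ = 0 kills the first factor of F, so the convention for d/κ does not
matter. -/
theorem deltaMinus_eq_zero (k : Fin (m + 1)) (t : ℂ) : DeltaMinus M A Ph k t = 0 := by
  simp [DeltaMinus, Model.F, Model.site]

theorem qTilde_ne (hb : BoundaryCurves M A s Ph) (σ : Fin (m + 2) → ZMod N) (k : Fin (m + 1))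
    (g : ZMod N) : qTilde M A Ph s σ k g ≠ 0 :=
  mul_ne_zero (prod_ne_zero_iff.2 fun j _ => (hb.BB j k).w_ne _)
    (prod_ne_zero_iff.2 fun l _ => div_ne_zero ((hb.B l k).w_ne _) ((hb.tilde_B l k).w_ne _))

theorem chi_ne (h : Regular M A Ph) (ha : M.a0 ≠ 0) (k : Fin (m + 1)) : chi M A Ph k ≠ 0 := by
  rw [chi, prod_Icc_erase_eq_prod_fin, prod_Icc_eq_prod_fin]
  refine mul_ne_zero (mul_ne_zero (div_ne_zero (mul_ne_zero (h.R_ne _ le_rfl 0 (Nat.zero_le _))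
    (rt_ne h (by omega))) (mul_ne_zero ha (rt_ne h le_rfl))) ?_) ?_
  · exact prod_ne_zero_iff.2 fun l hl => div_ne_zero
      (h.same (m + 1) le_rfl l k (ne_of_mem_erase hl)).ne
      (h.same (m + 1) le_rfl k l (ne_of_mem_erase hl).symm).ne
  · exact prod_ne_zero_iff.2 fun l _ => (h.next m (by omega) k l).ne

theorem F_zeroB_eq (h : Regular M A Ph) (l k : Fin (m + 1)) (g : ZMod N) :
    M.F (l + 1) (zeroB N A k g / omega N) =
      omega N * (M.bulk (l + 1)).a * (M.bulk (l + 1)).d * (zeroB N A k g / omega N) *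
        ((1 - omegaPow g * xB M A l k) * (1 - omegaPow (-g - 1) * xtB M A l k)) := by
  have n1 := h.a_ne l l.2
  have n2 := h.d_ne l l.2
  have n3 := h.kap_ne l l.2
  have n4 := h.R_ne (m + 1) le_rfl (k + 1) k.2
  have n5 := omega_ne_zero (N := N)
  have n6 := omegaPow_ne_zero g
  rw [Model.F, M.site_of_lt l.2, xB, xtB, zeroB, omegaPow_sub, omegaPow_neg, omegaPow_one]
  field_simp
  ring

theorem F_zeroB_ne (h : Regular M A Ph) (hb : BoundaryCurves M A s Ph) (l k : Fin (m + 1))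
    (g : ZMod N) : M.F (l + 1) (zeroB N A k g / omega N) ≠ 0 := by
  rw [F_zeroB_eq h]
  have hz : zeroB N A k g ≠ 0 := bZero_ne h le_rfl (fun _ => g) k
  exact mul_ne_zero (mul_ne_zero (mul_ne_zero (mul_ne_zero omega_ne_zero (h.a_ne l l.2))
    (h.d_ne l l.2)) (div_ne_zero hz omega_ne_zero))
    (mul_ne_zero ((hb.B l k).sub_ne _) ((hb.tilde_B l k).sub_ne _))

/-- One step in each w: the points p^BB give the linear factors of t^B(λ|σ), and the points p^B,
p̃^B give the factors of F. The y-coordinates left over combine to χ_k by the second family of phase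
relations. -/
theorem qTilde_add_one (h : Regular M A Ph) (hb : BoundaryCurves M A s Ph)
    (σ : Fin (m + 2) → ZMod N) (k : Fin (m + 1)) (g : ZMod N) :
    qTilde M A Ph s σ k (g + 1) = qTilde M A Ph s σ k g *
      (eigB s σ (zeroB N A k g) * chi M A Ph k * (zeroB N A k g / omega N) ^ (m + 1) /
        ∏ l : Fin (m + 1), M.F (l + 1) (zeroB N A k g / omega N)) := by
  have e1 : ∀ j, w (xBB A s j k) (Ph.yBB j k) (σ j - (g + 1)) =
      w (xBB A s j k) (Ph.yBB j k) (σ j - g) *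
        ((zeroB N A k g / (s j * omegaPow (-σ j)) + 1) / Ph.yBB j k) := by
    intro j
    rw [← sub_sub, (hb.BB j k).w_pred, xBB, zeroB, omegaPow_sub, omegaPow_neg, omegaPow_neg]
    have := hb.s_ne j
    have := omegaPow_ne_zero (σ j)
    have := omegaPow_ne_zero g
    field_simp
    ring
  have e2 : ∀ l, w (xB M A l k) (Ph.yB l k) (g + 1 - 1) /
        w (xtB M A l k) (Ph.ytB l k) (-(g + 1) - 1) =
      w (xB M A l k) (Ph.yB l k) (g - 1) / w (xtB M A l k) (Ph.ytB l k) (-g - 1) *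
        ((omega N * (M.bulk (l + 1)).a * (M.bulk (l + 1)).d * Ph.yB l k * Ph.ytB l k) *
          (zeroB N A k g / omega N) / M.F (l + 1) (zeroB N A k g / omega N)) := by
    intro l
    have h1 := (hb.B l k).w_succ (g - 1)
    rw [sub_add_cancel] at h1
    have hF := F_zeroB_ne h hb l k g
    rw [show g + 1 - 1 = g by ring, h1, show -(g + 1) - 1 = -g - 1 - 1 by ring,
      (hb.tilde_B l k).w_pred]
    rw [F_zeroB_eq h] at hF ⊢
    have n1 := (hb.B l k).sub_ne g
    have n2 := (hb.tilde_B l k).sub_ne (-g - 1)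
    have n3 := (hb.tilde_B l k).ne
    have n4 := (hb.tilde_B l k).w_ne (-g - 1)
    have n5 := h.a_ne l l.2
    have n6 := h.d_ne l l.2
    have n7 : zeroB N A k g / omega N ≠ 0 :=
      div_ne_zero (bZero_ne h le_rfl (fun _ => g) k) omega_ne_zero
    have n8 := omega_ne_zero (N := N)
    generalize zeroB N A k g / omega N = x at *
    field_simp
  have hBB : ∏ j, Ph.yBB j k ≠ 0 := prod_ne_zero_iff.2 fun j _ => (hb.BB j k).ne
  have hF : ∏ l : Fin (m + 1), M.F (l + 1) (zeroB N A k g / omega N) ≠ 0 :=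
    prod_ne_zero_iff.2 fun l _ => F_zeroB_ne h hb l k g
  rw [qTilde, qTilde, prod_congr rfl fun j _ => e1 j, prod_congr rfl fun l _ => e2 l,
    prod_mul_distrib, prod_mul_distrib (s := (univ : Finset (Fin (m + 1)))), prod_div_distrib,
    prod_div_distrib (f := fun l => _ * (zeroB N A k g / omega N)), prod_mul_distrib, hb.rel k,
    prod_const, card_univ, Fintype.card_fin, ← eigB]
  field_simp

theorem baxter_equation (h : Regular M A Ph) (ha : M.a0 ≠ 0) (hb : BoundaryCurves M A s Ph)
    (σ : Fin (m + 2) → ZMod N) (k : Fin (m + 1)) (g : ZMod N) :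
    eigB s σ (zeroB N A k g) * qTilde M A Ph s σ k g =
      DeltaPlus M A Ph k (zeroB N A k g) * qTilde M A Ph s σ k (g + 1) := by
  have hF : ∏ l : Fin (m + 1), M.F (l + 1) (zeroB N A k g / omega N) ≠ 0 :=
    prod_ne_zero_iff.2 fun l _ => F_zeroB_ne h hb l k g
  have hχ := chi_ne h ha k
  have hz : zeroB N A k g / omega N ≠ 0 :=
    div_ne_zero (bZero_ne h le_rfl (fun _ => g) k) omega_ne_zero
  rw [qTilde_add_one h hb, DeltaPlus, prod_Icc_eq_prod_fin]
  field_simp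

theorem QSigma_ne (h : Regular M A Ph) (hb : BoundaryCurves M A s Ph) (σ : Fin (m + 2) → ZMod N)
    (τ : Fin (m + 1) → ZMod N) : QSigma M A Ph s σ τ ≠ 0 := by
  refine div_ne_zero (prod_ne_zero_iff.2 fun k _ => qTilde_ne hb σ k _)
    (prod_ne_zero_iff.2 fun l _ => prod_ne_zero_iff.2 fun j hj => ?_)
  exact (h.same (m + 1) le_rfl j l (mem_filter.1 hj).2).w_ne _

theorem QSigma_add_single (h : Regular M A Ph) (hb : BoundaryCurves M A s Ph)
    (σ : Fin (m + 2) → ZMod N) (τ : Fin (m + 1) → ZMod N) (k : Fin (m + 1)) :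
    QSigma M A Ph s σ (τ + Pi.single k 1) = QSigma M A Ph s σ τ *
      ((eigB s σ (bZero A (m + 1) τ k) * chi M A Ph k * (bZero A (m + 1) τ k / omega N) ^ (m + 1) /
        ∏ l : Fin (m + 1), M.F (l + 1) (bZero A (m + 1) τ k / omega N)) /
      ∏ l ∈ univ.erase k, (((bZero A (m + 1) τ k - bZero A (m + 1) τ l) *
          (omegaPow (τ l) / A.R (m + 2) (l + 1)) / Ph.Y (m + 2) (k + 1) (m + 2) (l + 1)) *
        (Ph.Y (m + 2) (l + 1) (m + 2) (k + 1) * (bZero A (m + 1) τ k / omega N) /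
          (bZero A (m + 1) τ k / omega N - bZero A (m + 1) τ l)))) := by
  have hR := fun l : Fin (m + 1) => h.R_ne (m + 1) le_rfl (l + 1) l.2
  have hoff : ∀ l : Fin (m + 1), l ≠ k →
      (τ + Pi.single k 1 : Fin (m + 1) → ZMod N) l = τ l := by
    intro l hl
    simp [hl]
  have hon : (τ + Pi.single k 1 : Fin (m + 1) → ZMod N) k = τ k + 1 := by simp
  have hq : ∏ l, qTilde M A Ph s σ l ((τ + Pi.single k 1 : Fin (m + 1) → ZMod N) l) =
      (∏ l, qTilde M A Ph s σ l (τ l)) *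
        (eigB s σ (bZero A (m + 1) τ k) * chi M A Ph k *
          (bZero A (m + 1) τ k / omega N) ^ (m + 1) /
        ∏ l : Fin (m + 1), M.F (l + 1) (bZero A (m + 1) τ k / omega N)) := by
    refine prod_mul_of_eq_off k _ _ _ (fun l hl => by rw [hoff l hl]) ?_
    rw [hon, qTilde_add_one h hb]
    rfl
  have hd := prod_offDiag_of_eq_off k
    (fun l j : Fin (m + 1) => wPair A Ph (m + 2) (j + 1) (m + 2) (l + 1) (τ l - τ j))
    (fun l j : Fin (m + 1) => wPair A Ph (m + 2) (j + 1) (m + 2) (l + 1)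
      ((τ + Pi.single k 1 : Fin (m + 1) → ZMod N) l -
        (τ + Pi.single k 1 : Fin (m + 1) → ZMod N) j))
    (fun l => (bZero A (m + 1) τ k - bZero A (m + 1) τ l) *
          (omegaPow (τ l) / A.R (m + 2) (l + 1)) / Ph.Y (m + 2) (k + 1) (m + 2) (l + 1))
    (fun l => Ph.Y (m + 2) (l + 1) (m + 2) (k + 1) * (bZero A (m + 1) τ k / omega N) /
          (bZero A (m + 1) τ k / omega N - bZero A (m + 1) τ l))
    (by
      intro l j hl hj
      simp only [hoff l hl, hoff j hj])
    (by
      intro l hl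
      simp only [hon, hoff l hl]
      rw [← sub_sub, wPair, wPair, (h.same (m + 1) le_rfl k l hl.symm).w_pred, xPair,
        one_sub_omegaPow_mul_div (hR l)]
      simp only [bZero]
      ring)
    (by
      intro l hl
      simp only [hon, hoff l hl]
      rw [show τ k + 1 - τ l = τ k - τ l + 1 by ring, wPair, wPair,
        (h.same (m + 1) le_rfl l k hl).w_succ]
      congr 1
      have hne := omegaPow_mul_bZero_ne h le_rfl τ τ hl.symm (-1) 0
      rw [omegaPow_zero, one_mul, omegaPow_neg, omegaPow_one, inv_mul_eq_div] at hne
      have h0 : 1 - omegaPow (τ k - τ l + 1) * xPair A (m + 2) (l + 1) (m + 2) (k + 1) =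
          (bZero A (m + 1) τ k / omega N - bZero A (m + 1) τ l) *
            (bZero A (m + 1) τ k / omega N)⁻¹ := by
        rw [xPair, show τ k - τ l + 1 = (τ k + 1) - τ l by ring,
          one_sub_omegaPow_mul_div (hR k), omegaPow_neg, omegaPow_neg, bZero, bZero, omegaPow_neg,
          omegaPow_neg, omegaPow_add, omegaPow_one]
        have := hR k
        have := omegaPow_ne_zero (τ k)
        have := omegaPow_ne_zero (τ l)
        have := omega_ne_zero (N := N)
        field_simp
        ring
      have hz : bZero A (m + 1) τ k / omega N ≠ 0 :=
        div_ne_zero (bZero_ne h le_rfl τ k) omega_ne_zero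
      rw [h0]
      have := sub_ne_zero.2 hne
      field_simp)
  rw [QSigma, QSigma, hq]
  simp only [filter_ne'] at hd ⊢
  rw [hd, mul_div_mul_comm]

/-- The eigenvector equation at the k-th node, with the Lagrange denominators before and after the
shift. The constant χ_k is exactly what makes the factors from `coeffD` and from the pair functions
cancel. -/
theorem QSigma_mul_coeffD (h : Regular M A Ph) (ha : M.a0 ≠ 0) (hb : BoundaryCurves M A s Ph)
    (σ : Fin (m + 2) → ZMod N) (τ : Fin (m + 1) → ZMod N) (k : Fin (m + 1)) :
    QSigma M A Ph s σ (τ + Pi.single k 1) * (coeffD M A Ph τ k /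
        (bZero A (m + 1) τ k / omega N *
          ∏ l ∈ univ.erase k, (bZero A (m + 1) τ k / omega N - bZero A (m + 1) τ l))) =
      QSigma M A Ph s σ τ * (eigB s σ (bZero A (m + 1) τ k) / (bZero A (m + 1) τ k *
          ∏ l ∈ univ.erase k, (bZero A (m + 1) τ k - bZero A (m + 1) τ l))) := by
  rw [QSigma_add_single h hb, mul_assoc]
  congr 1
  have hR := fun l : Fin (m + 1) => h.R_ne (m + 1) le_rfl (l + 1) l.2
  have hcard : (univ.erase k).card = m := by simp
  have hz := bZero_ne h le_rfl τ k
  have hω := omega_ne_zero (N := N)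
  have hF : ∏ l : Fin (m + 1), M.F (l + 1) (bZero A (m + 1) τ k / omega N) ≠ 0 :=
    prod_ne_zero_iff.2 fun l _ => F_zeroB_ne h hb l k (τ k)
  have hFq : ∏ l : Fin (m + 1), (M.bulk (l + 1)).qdet N (bZero A (m + 1) τ k / omega N) =
      ∏ l : Fin (m + 1), M.F (l + 1) (bZero A (m + 1) τ k / omega N) :=
    prod_congr rfl fun l _ => by rw [Model.F, M.site_of_lt l.2, Site.qdet]
  have e2 : ∏ l ∈ univ.erase k, (((bZero A (m + 1) τ k - bZero A (m + 1) τ l) *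
          (omegaPow (τ l) / A.R (m + 2) (l + 1)) / Ph.Y (m + 2) (k + 1) (m + 2) (l + 1)) *
        (Ph.Y (m + 2) (l + 1) (m + 2) (k + 1) * (bZero A (m + 1) τ k / omega N) /
          (bZero A (m + 1) τ k / omega N - bZero A (m + 1) τ l))) =
      (∏ l ∈ univ.erase k, (bZero A (m + 1) τ k - bZero A (m + 1) τ l)) *
          ((∏ l ∈ univ.erase k, omegaPow (τ l)) / ∏ l ∈ univ.erase k, A.R (m + 2) (l + 1)) /
          (∏ l ∈ univ.erase k, Ph.Y (m + 2) (k + 1) (m + 2) (l + 1)) *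
        ((∏ l ∈ univ.erase k, Ph.Y (m + 2) (l + 1) (m + 2) (k + 1)) *
            (bZero A (m + 1) τ k / omega N) ^ m /
          ∏ l ∈ univ.erase k, (bZero A (m + 1) τ k / omega N - bZero A (m + 1) τ l)) := by
    rw [prod_mul_distrib, prod_div_distrib, prod_mul_distrib, prod_div_distrib, prod_div_distrib,
      prod_mul_distrib, prod_const, hcard]
  have e3 : omegaPow (∑ j, τ j) = omegaPow (τ k) * ∏ l ∈ univ.erase k, omegaPow (τ l) := by
    rw [omegaPow_sum, ← mul_prod_erase univ _ (mem_univ k)]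
  have e4 : A.rt (m + 2) = A.R (m + 2) 0 *
      (A.R (m + 2) (k + 1) * ∏ l ∈ univ.erase k, A.R (m + 2) (l + 1)) := by
    rw [A.rt_succ, ← mul_prod_erase univ _ (mem_univ k)]
  have ez : A.R (m + 2) (k + 1) = -bZero A (m + 1) τ k * omegaPow (τ k) := by
    rw [bZero, omegaPow_neg]
    have := omegaPow_ne_zero (τ k)
    field_simp
  have p1 : ∏ l : Fin m, Ph.Y (m + 2) (k + 1) (m + 1) (l + 1) ≠ 0 :=
    prod_ne_zero_iff.2 fun l _ => (h.next m (by omega) k l).ne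
  have p2 : ∏ l ∈ univ.erase k, Ph.Y (m + 2) (l + 1) (m + 2) (k + 1) ≠ 0 :=
    prod_ne_zero_iff.2 fun l hl => (h.same (m + 1) le_rfl l k (ne_of_mem_erase hl)).ne
  have p3 : ∏ l ∈ univ.erase k, Ph.Y (m + 2) (k + 1) (m + 2) (l + 1) ≠ 0 :=
    prod_ne_zero_iff.2 fun l hl => (h.same (m + 1) le_rfl k l (ne_of_mem_erase hl).symm).ne
  have p4 : ∏ l ∈ univ.erase k, A.R (m + 2) (l + 1) ≠ 0 :=
    prod_ne_zero_iff.2 fun l _ => hR l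
  have p5 : ∏ l ∈ univ.erase k, omegaPow (τ l) ≠ 0 :=
    prod_ne_zero_iff.2 fun l _ => omegaPow_ne_zero _
  have p6 : ∏ l ∈ univ.erase k, (bZero A (m + 1) τ k / omega N - bZero A (m + 1) τ l) ≠ 0 := by
    refine prod_ne_zero_iff.2 fun l hl => sub_ne_zero.2 ?_
    have := omegaPow_mul_bZero_ne h le_rfl τ τ (ne_of_mem_erase hl).symm (-1) 0
    rwa [omegaPow_zero, one_mul, omegaPow_neg, omegaPow_one, inv_mul_eq_div] at this
  have p7 : ∏ l ∈ univ.erase k, (bZero A (m + 1) τ k - bZero A (m + 1) τ l) ≠ 0 :=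
    prod_ne_zero_iff.2 fun l hl => sub_ne_zero.2 fun h0 =>
      ne_of_mem_erase hl (bZero_injective h le_rfl τ h0).symm
  have p8 := h.R_ne (m + 1) le_rfl 0 (Nat.zero_le _)
  have p9 := rt_ne h (m := m) (by omega)
  have p10 := omegaPow_ne_zero (τ k)
  have eχ : chi M A Ph k = A.R (m + 2) 0 * A.rt (m + 1) / (M.a0 * A.rt (m + 2)) *
      ((∏ l ∈ univ.erase k, Ph.Y (m + 2) (l + 1) (m + 2) (k + 1)) /
        ∏ l ∈ univ.erase k, Ph.Y (m + 2) (k + 1) (m + 2) (l + 1)) *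
      ∏ l : Fin m, Ph.Y (m + 2) (k + 1) (m + 1) (l + 1) := by
    rw [chi, prod_Icc_erase_eq_prod_fin, prod_Icc_eq_prod_fin, prod_div_distrib]
    rfl
  rw [e2, coeffD, hFq, e3, eχ, e4, ez]
  generalize ∏ l : Fin m, Ph.Y (m + 2) (k + 1) (m + 1) (l + 1) = W1 at *
  generalize ∏ l ∈ univ.erase k, Ph.Y (m + 2) (l + 1) (m + 2) (k + 1) = W2 at *
  generalize ∏ l ∈ univ.erase k, Ph.Y (m + 2) (k + 1) (m + 2) (l + 1) = W3 at *
  generalize ∏ l ∈ univ.erase k, A.R (m + 2) (l + 1) = W4 at *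
  generalize ∏ l ∈ univ.erase k, omegaPow (τ l) = W5 at *
  generalize ∏ l ∈ univ.erase k, (bZero A (m + 1) τ k / omega N - bZero A (m + 1) τ l) = W6 at *
  generalize ∏ l ∈ univ.erase k, (bZero A (m + 1) τ k - bZero A (m + 1) τ l) = W7 at *
  generalize ∏ l : Fin (m + 1), M.F (l + 1) (bZero A (m + 1) τ k / omega N) = W8 at *
  generalize eigB s σ (bZero A (m + 1) τ k) = W9 at *
  have hμ : bZero A (m + 1) τ k = omega N * (bZero A (m + 1) τ k / omega N) := by field_simp
  have hμ0 : bZero A (m + 1) τ k / omega N ≠ 0 := div_ne_zero hz hω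
  generalize bZero A (m + 1) τ k / omega N = μ at *
  rw [hμ]
  field_simp
  ring

/-- This is where the constraint on σ is used: the top coefficient ∏ ω^{σ_j}/s_j then equals that of
the operator t^B, and both constant coefficients are 1. -/
theorem eigB_interpolation (h : Regular M A Ph)
    (hs : ∏ j, (s j)⁻¹ =
      (∏ l ∈ Icc 1 (m + 1), (M.bulk l).a * (M.bulk l).c) * (M.a0 * M.cEnd))
    {σ : Fin (m + 2) → ZMod N} (hσ : ∑ j, σ j = M.gEnd - M.g0) (τ : Fin (m + 1) → ZMod N) (t : ℂ) :
    eigB s σ t = (omegaPow (-M.g0) * M.a0 * (omegaPow M.gEnd * M.cEnd) *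
        ∏ k : Fin (m + 1), (M.bulk (k + 1)).a * (M.bulk (k + 1)).c) *
          (t * ∏ k, (t - bZero A (m + 1) τ k)) +
      (∏ k, (t - bZero A (m + 1) τ k)) / ∏ k, (-bZero A (m + 1) τ k) +
      ∑ k, eigB s σ (bZero A (m + 1) τ k) * ((t / bZero A (m + 1) τ k) *
        ((∏ l ∈ univ.erase k, (t - bZero A (m + 1) τ l)) /
          ∏ l ∈ univ.erase k, (bZero A (m + 1) τ k - bZero A (m + 1) τ l))) := by
  have hends : HasEnds (m + 2) (eigB s σ) 1 (∏ j, (s j * omegaPow (-σ j))⁻¹) := by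
    have hgen : ∀ (r : ℕ) (c : Fin r → ℂ),
        HasEnds r (fun t : ℂ => ∏ j, (t / c j + 1)) 1 (∏ j, (c j)⁻¹) := by
      intro r
      induction r with
      | zero =>
        intro c
        simpa using HasEnds.const (1 : ℂ)
      | succ r ih =>
        intro c
        have h1 := (ih (fun j => c j.castSucc)).mul (HasEnds.linear 1 (c (Fin.last r))⁻¹)
        refine h1.congr (fun t => ?_) (by simp) (Fin.prod_univ_castSucc _)
        rw [Fin.prod_univ_castSucc, smul_eq_mul, add_comm 1, div_eq_mul_inv t (c (Fin.last r))]
    exact hgen (m + 2) _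
  have hK : ∏ j, (s j * omegaPow (-σ j))⁻¹ = omegaPow (-M.g0) * M.a0 *
      (omegaPow M.gEnd * M.cEnd) *
        ∏ k : Fin (m + 1), (M.bulk (k + 1)).a * (M.bulk (k + 1)).c := by
    have h1 : ∀ j, (s j * omegaPow (-σ j))⁻¹ = (s j)⁻¹ * omegaPow (σ j) := by
      intro j
      rw [mul_inv, omegaPow_neg, inv_inv]
    simp only [h1]
    rw [prod_mul_distrib, ← omegaPow_sum, hs, hσ, sub_eq_add_neg, omegaPow_add,
      prod_Icc_eq_prod_fin]
    ring
  have hf : HasEnds (Fintype.card (Fin (m + 1)) + 1) (eigB s σ) 1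
      (∏ j, (s j * omegaPow (-σ j))⁻¹) := by
    rw [Fintype.card_fin]
    exact hends
  rw [hf.interpolation (bZero_injective h le_rfl τ) (bZero_ne h le_rfl τ) t, hK]
  simp only [smul_eq_mul]
  congr 1
  · ring
  · exact sum_congr rfl fun k _ => by ring

/-- Operator and eigenvalue are interpolated at the same zeros. The outer terms agree on each Ψ^B_τ,
and the node terms agree after summation over τ, by `QSigma_mul_coeffD`. -/
theorem tB_Phi (h : Regular M A Ph) (ha : M.a0 ≠ 0) (hb : BoundaryCurves M A s Ph)
    (hs : ∏ j, (s j)⁻¹ =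
      (∏ l ∈ Icc 1 (m + 1), (M.bulk l).a * (M.bulk l).c) * (M.a0 * M.cEnd))
    {σ : Fin (m + 2) → ZMod N} (hσ : ∑ j, σ j = M.gEnd - M.g0) (t : ℂ) :
    M.tB t (Phi M A Ph s σ) = eigB s σ t • Phi M A Ph s σ := by
  set K := omegaPow (-M.g0) * M.a0 * (omegaPow M.gEnd * M.cEnd) *
      ∏ k : Fin (m + 1), (M.bulk (k + 1)).a * (M.bulk (k + 1)).c with hK
  have hends : HasEnds (Fintype.card (Fin (m + 1)) + 1) M.tB 1 (K • 1) := by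
    rw [Fintype.card_fin]
    exact tB_hasEnds M
  have hT : ∀ τ, M.tB t (PsiB M A Ph τ) =
      (K * (t * ∏ k, (t - bZero A (m + 1) τ k)) +
        (∏ k, (t - bZero A (m + 1) τ k)) / ∏ k, (-bZero A (m + 1) τ k)) • PsiB M A Ph τ +
      ∑ k, ((t / bZero A (m + 1) τ k) *
        ((∏ l ∈ univ.erase k, (t - bZero A (m + 1) τ l)) /
          ∏ l ∈ univ.erase k, (bZero A (m + 1) τ k - bZero A (m + 1) τ l)) *
            coeffD M A Ph (τ - Pi.single k 1) k) • PsiB M A Ph (τ - Pi.single k 1) := by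
    intro τ
    have h1 := congrArg (fun X => X (PsiB M A Ph τ))
      (hends.interpolation (bZero_injective h le_rfl τ) (bZero_ne h le_rfl τ) t)
    simp only [LinearMap.add_apply, LinearMap.smul_apply, Module.End.one_apply,
      LinearMap.sum_apply, smul_smul] at h1
    rw [h1, ← add_smul]
    congr 1
    · congr 1
      ring
    · refine sum_congr rfl fun k _ => ?_
      have h2 := tB_PsiB h ha (τ - Pi.single k 1) k
      rw [sub_add_cancel, bZero_sub_single_self, mul_div_cancel_left₀ _ omega_ne_zero] at h2
      rw [h2, smul_smul]
  -- Raising τ_k moves only the k-th zero, which is omitted from these products.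
  have hoff : ∀ (τ : Fin (m + 1) → ZMod N) (k : Fin (m + 1)) (x : ℂ),
      ∏ l ∈ univ.erase k, (x - bZero A (m + 1) (τ + Pi.single k 1) l) =
        ∏ l ∈ univ.erase k, (x - bZero A (m + 1) τ l) := by
    intro τ k x
    refine prod_congr rfl fun l hl => ?_
    have := bZero_sub_single_of_ne A (m + 1) (τ + Pi.single k 1) (ne_of_mem_erase hl)
    rw [add_sub_cancel_right] at this
    rw [this]
  have hterm : ∀ τ k, QSigma M A Ph s σ (τ + Pi.single k 1) *
      ((t / bZero A (m + 1) (τ + Pi.single k 1) k) *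
        ((∏ l ∈ univ.erase k, (t - bZero A (m + 1) (τ + Pi.single k 1) l)) /
          ∏ l ∈ univ.erase k, (bZero A (m + 1) (τ + Pi.single k 1) k -
            bZero A (m + 1) (τ + Pi.single k 1) l)) * coeffD M A Ph τ k) =
      QSigma M A Ph s σ τ * (eigB s σ (bZero A (m + 1) τ k) * ((t / bZero A (m + 1) τ k) *
        ((∏ l ∈ univ.erase k, (t - bZero A (m + 1) τ l)) /
          ∏ l ∈ univ.erase k, (bZero A (m + 1) τ k - bZero A (m + 1) τ l)))) := by
    intro τ k
    have h1 := QSigma_mul_coeffD h ha hb σ τ k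
    rw [bZero_add_single_self, hoff, hoff]
    calc _ = (t * ∏ l ∈ univ.erase k, (t - bZero A (m + 1) τ l)) *
          (QSigma M A Ph s σ (τ + Pi.single k 1) * (coeffD M A Ph τ k /
            (bZero A (m + 1) τ k / omega N *
              ∏ l ∈ univ.erase k, (bZero A (m + 1) τ k / omega N - bZero A (m + 1) τ l)))) := by
          simp only [div_eq_mul_inv, mul_inv, inv_inv]
          ring
      _ = _ := by
          rw [h1]
          simp only [div_eq_mul_inv, mul_inv]
          ring
  -- Since t^B lowers τ_k at the k-th node, replacing τ by τ + e_k collects the coefficient of a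
  -- fixed Ψ^B_τ.
  have hshift : ∀ k, ∑ τ, (QSigma M A Ph s σ τ * ((t / bZero A (m + 1) τ k) *
        ((∏ l ∈ univ.erase k, (t - bZero A (m + 1) τ l)) /
          ∏ l ∈ univ.erase k, (bZero A (m + 1) τ k - bZero A (m + 1) τ l)) *
            coeffD M A Ph (τ - Pi.single k 1) k)) • PsiB M A Ph (τ - Pi.single k 1) =
      ∑ τ, (QSigma M A Ph s σ τ * (eigB s σ (bZero A (m + 1) τ k) *
        ((t / bZero A (m + 1) τ k) * ((∏ l ∈ univ.erase k, (t - bZero A (m + 1) τ l)) /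
          ∏ l ∈ univ.erase k, (bZero A (m + 1) τ k - bZero A (m + 1) τ l))))) •
            PsiB M A Ph τ := by
    intro k
    rw [← Equiv.sum_comp (Equiv.addRight (Pi.single k 1))]
    refine sum_congr rfl fun τ _ => ?_
    rw [Equiv.coe_addRight, add_sub_cancel_right, hterm]
  rw [Phi, map_sum, smul_sum]
  simp only [map_smul, hT, smul_add, smul_sum, smul_smul, sum_add_distrib]
  rw [sum_comm, sum_congr rfl fun k _ => hshift k, sum_comm, ← sum_add_distrib]
  refine sum_congr rfl fun τ _ => ?_
  rw [← sum_smul, ← add_smul, eigB_interpolation h hs hσ τ t, ← mul_sum]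
  congr 1
  ring

theorem Phi_ne (h : Regular M A Ph) (ha : M.a0 ≠ 0) (hb : BoundaryCurves M A s Ph)
    (σ : Fin (m + 2) → ZMod N) : Phi M A Ph s σ ≠ 0 := by
  intro h0
  exact QSigma_ne h hb σ 0
    (Fintype.linearIndependent_iff.1 (PsiB_linearIndependent h ha) _ h0 0)

end Eigenvector

section

/-! ### Averaged monodromy matrices -/

section Averages

theorem eps_mul_eps (N : ℕ) : eps N * eps N = 1 := by
  rw [eps, ← mul_pow]
  norm_num

/-- Agreement away from 0 suffices, which allows relations to be compared after division by z. -/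
theorem HasEnds.unique {m : ℕ} {f g : ℂ → ℂ} {c₀ c₁ d₀ d₁ : ℂ} (hf : HasEnds m f c₀ c₁)
    (hg : HasEnds m g d₀ d₁) (h : ∀ t, t ≠ 0 → f t = g t) : c₀ = d₀ ∧ c₁ = d₁ := by
  obtain ⟨p, _, p0, p1, hpe⟩ := hf
  obtain ⟨q, _, q0, q1, hqe⟩ := hg
  have hpq : p = q := by
    refine Polynomial.eq_of_infinite_eval_eq p q (Set.Infinite.mono (s := {0}ᶜ) (fun t ht => ?_)
      (Set.finite_singleton 0).infinite_compl)
    have h1 := h t ht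
    rw [hpe, hqe] at h1
    exact h1
  rw [← p0, ← p1, ← q0, ← q1, hpq]
  exact ⟨rfl, rfl⟩

theorem HasEnds.prod_sub {r : ℕ} (c : Fin r → ℂ) :
    HasEnds r (fun t : ℂ => ∏ j, (t - c j)) (∏ j, (-c j)) 1 := by
  induction r with
  | zero => simpa using HasEnds.const (1 : ℂ)
  | succ r ih =>
    have h1 := (ih (fun j => c j.castSucc)).mul (HasEnds.linear (-c (Fin.last r)) 1)
    refine h1.congr (fun t => ?_) (Fin.prod_univ_castSucc _) (by simp)
    rw [Fin.prod_univ_castSucc, smul_eq_mul]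
    ring

variable {N n : ℕ} [NeZero N]

omit [NeZero N] in
theorem avgL_matEnds (S : Site) :
    MatEnds 1 (avgL N S) (-eps N * S.kap ^ N) (-eps N * S.a ^ N * S.c ^ N) := by
  refine ⟨?_, ⟨-eps N * (S.a ^ N - S.b ^ N), ?_⟩, ⟨S.c ^ N - S.d ^ N, ?_⟩,
    ⟨S.b ^ N * S.d ^ N / S.kap ^ N, ?_⟩⟩
  · refine (HasEnds.linear (1 : ℂ) (-eps N * S.kap ^ N)).congr (fun t => ?_) rfl rfl
    simp only [avgL, Matrix.of_apply, Matrix.cons_val', Matrix.cons_val_zero,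
      Matrix.cons_val_fin_one, smul_eq_mul]
    ring
  · refine (HasEnds.linear (0 : ℂ) (-eps N * (S.a ^ N - S.b ^ N))).congr (fun t => ?_) rfl rfl
    simp only [avgL, Matrix.of_apply, Matrix.cons_val', Matrix.cons_val_zero,
      Matrix.cons_val_one, Matrix.cons_val_fin_one, smul_eq_mul]
    ring
  · refine (HasEnds.linear (S.c ^ N - S.d ^ N) (0 : ℂ)).congr (fun t => ?_) rfl rfl
    simp [avgL]
  · refine (HasEnds.linear (S.b ^ N * S.d ^ N / S.kap ^ N) (-eps N * S.a ^ N * S.c ^ N)).congr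
      (fun t => ?_) rfl rfl
    simp only [avgL, Matrix.of_apply, Matrix.cons_val',
      Matrix.cons_val_one, Matrix.cons_val_fin_one, smul_eq_mul]
    ring

theorem Model.avgT_succ (M : Model N n) (m : ℕ) (z : ℂ) :
    M.avgT (m + 1) z = M.avgT m z * avgL N (M.site (m + 1)) z := by
  rw [Model.avgT, List.ofFn_succ', List.concat_eq_append, List.prod_append, List.prod_singleton]
  rfl

theorem Model.avgT_A_ends (M : Model N n) (m : ℕ) :
    HasEnds m (fun z => M.avgT m z 0 0) 1 (∏ k : Fin m, (-eps N * (M.site (k + 1)).kap ^ N)) := by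
  have h1 := (MatEnds.list_prod (fun k : Fin m => avgL_matEnds (N := N) (M.site (k + 1)))
    (List.finRange m)).a
  rw [List.length_finRange] at h1
  refine h1.congr (fun t => ?_) rfl ?_
  · rw [Model.avgT, List.ofFn_eq_map]
  · rw [← List.prod_ofFn, List.ofFn_eq_map]

theorem Model.avgT_succ_00 (M : Model N n) (m : ℕ) (z : ℂ) :
    M.avgT (m + 1) z 0 0 = M.avgT m z 0 0 * (1 - eps N * (M.site (m + 1)).kap ^ N * z) +
      M.avgT m z 0 1 * ((M.site (m + 1)).c ^ N - (M.site (m + 1)).d ^ N) := by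
  rw [M.avgT_succ, Matrix.mul_apply, Fin.sum_univ_two]
  simp [avgL]

theorem Model.avgT_succ_01 (M : Model N n) (m : ℕ) (z : ℂ) :
    M.avgT (m + 1) z 0 1 =
      M.avgT m z 0 0 * (-eps N * z * ((M.site (m + 1)).a ^ N - (M.site (m + 1)).b ^ N)) +
      M.avgT m z 0 1 * ((M.site (m + 1)).b ^ N * (M.site (m + 1)).d ^ N /
        (M.site (m + 1)).kap ^ N - eps N * z * (M.site (m + 1)).a ^ N * (M.site (m + 1)).c ^ N) := by
  rw [M.avgT_succ, Matrix.mul_apply, Fin.sum_univ_two]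
  simp [avgL]

theorem Model.avgT_succ_11 (M : Model N n) (m : ℕ) (z : ℂ) :
    M.avgT (m + 1) z 1 1 =
      M.avgT m z 1 0 * (-eps N * z * ((M.site (m + 1)).a ^ N - (M.site (m + 1)).b ^ N)) +
      M.avgT m z 1 1 * ((M.site (m + 1)).b ^ N * (M.site (m + 1)).d ^ N /
        (M.site (m + 1)).kap ^ N - eps N * z * (M.site (m + 1)).a ^ N * (M.site (m + 1)).c ^ N) := by
  rw [M.avgT_succ, Matrix.mul_apply, Fin.sum_univ_two]
  simp [avgL]

theorem Model.det_avgT (M : Model N n) (m : ℕ) (z : ℂ) :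
    (M.avgT m z).det = ∏ k : Fin m, (avgL N (M.site (k + 1)) z).det := by
  induction m with
  | zero => simp [Model.avgT]
  | succ m ih => rw [M.avgT_succ, Matrix.det_mul, ih, Fin.prod_univ_castSucc]; rfl

omit [NeZero N] in
theorem det_avgL {S : Site} (hS : S.kap ≠ 0) (Z : ℂ) :
    (avgL N S (eps N * Z)).det =
      (S.b ^ N - Z * S.a ^ N * S.kap ^ N) * (S.d ^ N / S.kap ^ N - Z * S.c ^ N) := by
  have he := eps_mul_eps N
  have hk : S.kap ^ N ≠ 0 := pow_ne_zero _ hS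
  rw [Matrix.det_fin_two]
  simp only [avgL, Matrix.of_apply, Matrix.cons_val', Matrix.cons_val_zero,
      Matrix.cons_val_one, Matrix.cons_val_fin_one]
  have e1 : ∀ x : ℂ, eps N * x * (eps N * Z) = x * Z := fun x => by
    linear_combination x * Z * he
  have e2 : -eps N * (eps N * Z) = -Z := by linear_combination -Z * he
  have e3 : eps N * (eps N * Z) = Z := by linear_combination Z * he
  rw [e1, e2, e3]
  field_simp
  ring

theorem Model.site_last (M : Model N n) : M.site (n + 1) =
    { kap := 0, a := M.a0 * omegaPow (M.gEnd - M.g0), b := 0, c := M.cEnd, d := 0 } := by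
  rw [Model.site, if_pos rfl]

end Averages

/-! ### Averaged B-entries and the points with fixed coordinates -/

section Generic

variable {N n : ℕ} [NeZero N] {M : Model N n} {A : Amplitudes}

theorem IsAmplitudes.site_r_pow (hA : IsAmplitudes M A) {m : ℕ} (hm : m ≤ n) :
    (M.site (m + 1)).a ^ N - (M.site (m + 1)).b ^ N = A.r (m + 1) ^ N := by
  rcases hm.lt_or_eq with hm | rfl
  · rw [M.site_of_lt hm, hA.r_pow (m + 1) (by omega) (by omega)]
  · rw [M.site_last, hA.r_last, zero_pow (NeZero.ne N), mul_pow, omegaPow_pow]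
    ring

theorem IsAmplitudes.avgB_succ (hA : IsAmplitudes M A) {m : ℕ} (hm : m ≤ n) (z : ℂ) :
    M.avgT (m + 1) z 0 1 = z * ((-eps N) ^ (m + 1) * A.R (m + 1) 0 ^ N *
      ∏ i : Fin m, (z - eps N * A.R (m + 1) (i + 1) ^ N)) := by
  rw [hA.avgB (m + 1) (by omega) (by omega), Nat.add_sub_cancel, prod_Icc_eq_prod_fin]
  ring

/-- The value of the averaged `B_{m+1}` at `z = ε Z`. -/
theorem IsAmplitudes.avgB_eps_mul (hA : IsAmplitudes M A) {m : ℕ} (hm : m ≤ n) (Z : ℂ) :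
    M.avgT (m + 1) (eps N * Z) 0 1 =
      (-1) ^ (m + 1) * Z * A.R (m + 1) 0 ^ N * ∏ i : Fin m, (Z - A.R (m + 1) (i + 1) ^ N) := by
  have he : eps N ^ (m + 1) * eps N ^ (m + 1) = 1 := by rw [← mul_pow, eps_mul_eps, one_pow]
  rw [hA.avgB_succ hm]
  simp only [← mul_sub]
  rw [prod_mul_distrib, prod_const, card_univ, Fintype.card_fin, neg_pow]
  linear_combination ((-1) ^ (m + 1) * Z * A.R (m + 1) 0 ^ N *
    ∏ i : Fin m, (Z - A.R (m + 1) (i + 1) ^ N)) * he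

/-- The form normalized at Z = 0: at an N-th power of an amplitude of the next level the factors
become y^N for the points p^{m+2,·}_{m+1,·}. -/
theorem IsAmplitudes.avgB_eps_mul' (hA : IsAmplitudes M A) (hg : IsGeneric M A) {m : ℕ}
    (hm : m ≤ n) (Z : ℂ) : M.avgT (m + 1) (eps N * Z) 0 1 =
      -Z * A.rt (m + 1) ^ N * ∏ i : Fin m, (1 - Z / A.R (m + 1) (i + 1) ^ N) := by
  have h1 : ∀ i : Fin m, Z - A.R (m + 1) (i + 1) ^ N =
      -A.R (m + 1) (i + 1) ^ N * (1 - Z / A.R (m + 1) (i + 1) ^ N) := by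
    intro i
    have : A.R (m + 1) (i + 1) ^ N ≠ 0 :=
      pow_ne_zero _ (hg.R_ne (m + 1) (by omega) (by omega) _ (by omega))
    field_simp
    ring
  have he : (-1 : ℂ) ^ m * (-1) ^ m = 1 := by rw [← mul_pow]; norm_num
  rw [hA.avgB_eps_mul hm, prod_congr rfl fun i _ => h1 i, prod_mul_distrib, A.rt_succ, mul_pow,
    ← prod_pow, prod_neg, card_univ, Fintype.card_fin, pow_succ]
  linear_combination (-Z * A.R (m + 1) 0 ^ N * (∏ i : Fin m, A.R (m + 1) (i + 1) ^ N) *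
    ∏ i : Fin m, (1 - Z / A.R (m + 1) (i + 1) ^ N)) * he

/-- The recursion of the averaged B in the last site, divided by z, is compared in its constant and
its leading coefficient. The results are the curve equations of p̃_{m+2} and p_{m+2,0}. -/
theorem coefficient_relations (hA : IsAmplitudes M A) {m : ℕ} (hm : m + 1 ≤ n) :
    A.rt (m + 2) ^ N = A.r (m + 2) ^ N + (M.site (m + 2)).b ^ N * (M.site (m + 2)).d ^ N /
        (M.site (m + 2)).kap ^ N * A.rt (m + 1) ^ N ∧
      A.R (m + 2) 0 ^ N = (∏ k ∈ Icc 1 (m + 1), (M.bulk k).kap) ^ N * A.r (m + 2) ^ N +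
        A.R (m + 1) 0 ^ N * (M.site (m + 2)).a ^ N * (M.site (m + 2)).c ^ N := by
  have he := eps_mul_eps N
  have hbeta : ∀ m, HasEnds m (fun z => (-eps N) ^ (m + 1) * A.R (m + 1) 0 ^ N *
      ∏ i : Fin m, (z - eps N * A.R (m + 1) (i + 1) ^ N)) (-eps N * A.rt (m + 1) ^ N)
      ((-eps N) ^ (m + 1) * A.R (m + 1) 0 ^ N) := by
    intro m
    refine ((HasEnds.prod_sub fun i : Fin m => eps N * A.R (m + 1) (i + 1) ^ N).smul_left
      ((-eps N) ^ (m + 1) * A.R (m + 1) 0 ^ N)).congr (fun t => rfl) ?_ (by simp)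
    have h1 : (-eps N) ^ m * (-eps N) ^ m = 1 := by
      rw [← mul_pow, neg_mul_neg, he, one_pow]
    simp only [← neg_mul]
    rw [prod_mul_distrib, prod_const, card_univ, Fintype.card_fin, A.rt_succ, mul_pow, ← prod_pow,
      smul_eq_mul, pow_succ]
    linear_combination (eps N * A.R (m + 1) 0 ^ N * ∏ i : Fin m, A.R (m + 1) (i + 1) ^ N) * h1
  have hR := ((M.avgT_A_ends (m + 1)).smul_left (-eps N * A.r (m + 2) ^ N)).add
    ((hbeta m).mul (HasEnds.linear ((M.site (m + 2)).b ^ N * (M.site (m + 2)).d ^ N /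
        (M.site (m + 2)).kap ^ N) (-eps N * (M.site (m + 2)).a ^ N * (M.site (m + 2)).c ^ N)))
  obtain ⟨h0, h1⟩ := (hbeta (m + 1)).unique hR fun z hz => by
    have h2 := M.avgT_succ_01 (m + 1) z
    rw [hA.avgB_succ (m := m + 1) (by omega), hA.avgB_succ (m := m) (by omega),
      hA.site_r_pow (m := m + 1) (by omega)] at h2
    refine mul_left_cancel₀ hz ?_
    rw [h2, smul_eq_mul, smul_eq_mul]
    ring
  have hε : -eps N ≠ 0 := by
    intro h2
    rw [neg_eq_zero.1 h2] at he
    simp at he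
  constructor
  · refine mul_left_cancel₀ hε ?_
    rw [h0, smul_eq_mul]
    ring
  · have hK : ∏ k : Fin (m + 1), (-eps N * (M.site (k + 1)).kap ^ N) =
        (-eps N) ^ (m + 1) * (∏ k ∈ Icc 1 (m + 1), (M.bulk k).kap) ^ N := by
      rw [prod_mul_distrib, prod_const, card_univ, Fintype.card_fin, prod_Icc_eq_prod_fin,
        ← prod_pow]
      congr 1
      refine prod_congr rfl fun k _ => ?_
      rw [M.site_of_lt (by omega)]
    refine mul_left_cancel₀ (pow_ne_zero (m + 2) hε) ?_
    rw [h1, hK, smul_eq_mul]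
    ring

theorem IsAmplitudes.onFermat_zero (hA : IsAmplitudes M A) (hg : IsGeneric M A) {m : ℕ}
    (hm : m + 1 ≤ n) :
    OnFermat N (A.R (m + 1) 0 * (M.site (m + 2)).a * (M.site (m + 2)).c / A.R (m + 2) 0)
      ((∏ k ∈ Icc 1 (m + 1), (M.bulk k).kap) * A.r (m + 2) / A.R (m + 2) 0) := by
  have h1 := (coefficient_relations hA hm).2
  have hR := hg.R_ne (m + 2) (by omega) (by omega) 0 (by omega)
  have hRN : A.R (m + 2) 0 ^ N ≠ 0 := pow_ne_zero _ hR
  refine ⟨?_, ?_⟩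
  · rw [div_pow, div_pow, mul_pow, mul_pow, mul_pow, ← add_div, div_eq_one_iff_eq hRN, h1]
    ring
  · refine div_ne_zero (mul_ne_zero (prod_ne_zero_iff.2 fun k hk => ?_) ?_) hR
    · rw [mem_Icc] at hk
      exact (hg.bulk_ne k hk.1 (by omega)).1
    · rcases hm.lt_or_eq with hm | rfl
      · exact hg.r_ne _ (by omega) (by omega)
      · rw [hA.r_last]
        exact hg.a0_ne

theorem IsGeneric.rt_ne (hg : IsGeneric M A) {m : ℕ} (h0 : 1 ≤ m) (hm : m ≤ n + 1) :
    A.rt m ≠ 0 :=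
  prod_ne_zero_iff.2 fun i hi => hg.R_ne m h0 hm i (mem_range.1 hi)

theorem IsAmplitudes.onFermat_tilde (hA : IsAmplitudes M A) (hg : IsGeneric M A) {m : ℕ}
    (hm : m + 1 < n) :
    OnFermat N (A.r (m + 2) / A.rt (m + 2))
      ((M.bulk (m + 2)).b * (M.bulk (m + 2)).d * A.rt (m + 1) / (M.bulk (m + 2)).kap /
        A.rt (m + 2)) := by
  have h1 := (coefficient_relations hA hm.le).1
  obtain ⟨h2, _, h3, _, h4⟩ := hg.bulk_ne (m + 2) (by omega) (by omega)
  have h5 := hg.rt_ne (m := m + 1) (by omega) (by omega)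
  have h6 := hg.rt_ne (m := m + 2) (by omega) (by omega)
  have hRN : A.rt (m + 2) ^ N ≠ 0 := pow_ne_zero _ h6
  refine ⟨?_, ?_⟩
  · rw [M.site_of_lt hm] at h1
    rw [div_pow, div_pow, div_pow, mul_pow, mul_pow, ← add_div, div_eq_one_iff_eq hRN, h1]
    ring
  · exact div_ne_zero (div_ne_zero (mul_ne_zero (mul_ne_zero h3 h4) h5) h2) h6

end Generic

end

/-! ### Non-vanishing of the remaining y-coordinates -/

section Nonvanishing

variable {N n : ℕ} [NeZero N] {M : Model N n} {A : Amplitudes}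

theorem IsGeneric.det_avgL_ne (hg : IsGeneric M A) {p q : ℕ} (hp : p ≤ n + 1) (hq : 1 ≤ q)
    (hqp : q < p) {k : ℕ} (hk : k < n) :
    (avgL N (M.site (k + 1)) (eps N * A.R p q ^ N)).det ≠ 0 := by
  have h1 := hg.det_ne p (by omega) hp q hq hqp
  rw [M.det_avgT] at h1
  exact prod_ne_zero_iff.1 h1 ⟨k, hk⟩ (mem_univ _)

theorem IsGeneric.det_avgT_ne (hg : IsGeneric M A) {p q : ℕ} (hp : p ≤ n + 1) (hq : 1 ≤ q)
    (hqp : q < p) {m : ℕ} (hm : m ≤ n) : (M.avgT m (eps N * A.R p q ^ N)).det ≠ 0 := by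
  rw [M.det_avgT]
  exact prod_ne_zero_iff.2 fun k _ => hg.det_avgL_ne hp hq hqp (by omega)

theorem IsGeneric.det_factors_ne (hg : IsGeneric M A) {p q : ℕ} (hp : p ≤ n + 1) (hq : 1 ≤ q)
    (hqp : q < p) {k : ℕ} (hk : k < n) :
    (M.bulk (k + 1)).b ^ N - A.R p q ^ N * (M.bulk (k + 1)).a ^ N * (M.bulk (k + 1)).kap ^ N ≠ 0 ∧
      (M.bulk (k + 1)).d ^ N / (M.bulk (k + 1)).kap ^ N -
        A.R p q ^ N * (M.bulk (k + 1)).c ^ N ≠ 0 := by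
  have h1 := hg.det_avgL_ne hp hq hqp hk
  rw [M.site_of_lt hk, det_avgL (hg.bulk_ne (k + 1) (by omega) (by omega)).1] at h1
  exact mul_ne_zero_iff.1 h1

theorem IsAmplitudes.avgB_eq_zero (hA : IsAmplitudes M A) {m : ℕ} (hm : m ≤ n) (l : Fin m) :
    M.avgT (m + 1) (eps N * A.R (m + 1) (l + 1) ^ N) 0 1 = 0 := by
  rw [hA.avgB_eps_mul hm, prod_eq_zero (mem_univ l) (sub_self _), mul_zero]

theorem IsAmplitudes.avgB_succ_of_zero (hA : IsAmplitudes M A) {m : ℕ} (hm : m + 1 ≤ n)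
    (l : Fin m) : M.avgT (m + 2) (eps N * A.R (m + 1) (l + 1) ^ N) 0 1 =
      -A.R (m + 1) (l + 1) ^ N * A.r (m + 2) ^ N *
        M.avgT (m + 1) (eps N * A.R (m + 1) (l + 1) ^ N) 0 0 := by
  rw [M.avgT_succ_01, hA.avgB_eq_zero (by omega), zero_mul, add_zero, hA.site_r_pow hm]
  linear_combination (-A.R (m + 1) (l + 1) ^ N * A.r (m + 2) ^ N *
        M.avgT (m + 1) (eps N * A.R (m + 1) (l + 1) ^ N) 0 0) * eps_mul_eps N

theorem IsGeneric.r_ne' (hA : IsAmplitudes M A) (hg : IsGeneric M A) {m : ℕ} (hm : m ≤ n) :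
    A.r (m + 1) ≠ 0 := by
  rcases hm.lt_or_eq with hm | rfl
  · exact hg.r_ne _ (by omega) (by omega)
  · rw [hA.r_last]
    exact hg.a0_ne

/-- At a common zero of two consecutive averaged B-entries the A-entry of the shorter chain vanishes
too, hence so does its determinant, which genericity excludes. -/
theorem IsGeneric.R_pow_ne_next (hA : IsAmplitudes M A) (hg : IsGeneric M A) {m : ℕ}
    (hm : m + 1 ≤ n) (k : Fin (m + 1)) (l : Fin m) :
    A.R (m + 2) (k + 1) ^ N ≠ A.R (m + 1) (l + 1) ^ N := by
  intro h0
  have h1 := hA.avgB_succ_of_zero hm l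
  have h2 := hg.det_avgT_ne (m := m + 1) (p := m + 1) (q := l + 1) (by omega) (by omega) (by omega)
    (by omega)
  have h3 := hA.avgB_eq_zero (m := m + 1) (by omega) k
  rw [Matrix.det_fin_two, hA.avgB_eq_zero (by omega), zero_mul, sub_zero] at h2
  rw [h0, h1] at h3
  exact mul_ne_zero (mul_ne_zero (neg_ne_zero.2 (pow_ne_zero _
    (hg.R_ne (m + 1) (by omega) (by omega) _ (by omega)))) (pow_ne_zero _ (hg.r_ne' hA hm)))
    (left_ne_zero_of_mul h2) h3

theorem one_sub_xPair_pow (hg : IsGeneric M A) {p q : ℕ} (hp : 1 ≤ p) (hp' : p ≤ n + 1)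
    (hq : q < p) (p' q' : ℕ) : 1 - xPair A p' q' p q ^ N =
      (A.R p q ^ N - A.R p' q' ^ N) / A.R p q ^ N := by
  have : A.R p q ^ N ≠ 0 := pow_ne_zero _ (hg.R_ne p hp hp' q hq)
  rw [xPair, div_pow]
  field_simp

theorem one_sub_xOne_pow (hg : IsGeneric M A) {k : ℕ} (hk : k < n) (q : ℕ) :
    (M.bulk (k + 1)).b ^ N * (1 - xOne M A (k + 1) q ^ N) =
      (M.bulk (k + 1)).b ^ N - A.R (k + 1) q ^ N * (M.bulk (k + 1)).a ^ N *
        (M.bulk (k + 1)).kap ^ N := by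
  have : (M.bulk (k + 1)).b ^ N ≠ 0 :=
    pow_ne_zero _ (hg.bulk_ne (k + 1) (by omega) (by omega)).2.2.1
  rw [xOne, div_pow, mul_pow, mul_pow]
  field_simp

theorem one_sub_xtOne_pow (hg : IsGeneric M A) {k : ℕ} (hk : k < n) {q : ℕ} (hq : q < k + 1) :
    -A.R (k + 1) q ^ N * (M.bulk (k + 1)).c ^ N * (1 - xtOne M A (k + 1) q ^ N) =
      (M.bulk (k + 1)).d ^ N / (M.bulk (k + 1)).kap ^ N -
        A.R (k + 1) q ^ N * (M.bulk (k + 1)).c ^ N := by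
  obtain ⟨h1, _, _, h2, _⟩ := hg.bulk_ne (k + 1) (by omega) (by omega)
  have := pow_ne_zero N h1
  have := pow_ne_zero N h2
  have := pow_ne_zero N (hg.R_ne (k + 1) (by omega) (by omega) q hq)
  rw [xtOne, div_pow, mul_pow, mul_pow]
  field_simp
  ring

omit [NeZero N] in
theorem xPair_pow_ne_one {p q p' q' : ℕ} (hR : A.R p q ≠ 0) (h : A.R p' q' ^ N ≠ A.R p q ^ N) :
    xPair A p' q' p q ^ N ≠ 1 := by
  rw [xPair, div_pow]
  intro h0
  exact h ((div_eq_one_iff_eq (pow_ne_zero _ hR)).1 h0)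

/-- The vanishing of y would make one of the two factors of det 𝓛_{m+1} vanish at ε r_{m+1,l+1}^N.
-/
theorem onFermat_one (hg : IsGeneric M A) {m : ℕ} (hm : m < n) (l : Fin m) {y : ℂ}
    (h : xOne M A (m + 1) (l + 1) ^ N + y ^ N = 1) : OnFermat N (xOne M A (m + 1) (l + 1)) y := by
  refine OnFermat.of_pow h fun h0 => ?_
  have h1 := one_sub_xOne_pow hg hm (l + 1)
  rw [h0, sub_self, mul_zero] at h1
  exact (hg.det_factors_ne (p := m + 1) (q := l + 1) (by omega) (by omega) (by omega) hm).1 h1.symm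

theorem onFermat_tilde_one (hg : IsGeneric M A) {m : ℕ} (hm : m < n) (l : Fin m) {y : ℂ}
    (h : xtOne M A (m + 1) (l + 1) ^ N + y ^ N = 1) :
    OnFermat N (xtOne M A (m + 1) (l + 1)) y := by
  refine OnFermat.of_pow h fun h0 => ?_
  have h1 := one_sub_xtOne_pow hg hm (q := l + 1) (by omega)
  rw [h0, sub_self, mul_zero] at h1
  exact (hg.det_factors_ne (p := m + 1) (q := l + 1) (by omega) (by omega) (by omega) hm).2 h1.symm

/-! ### The `N`-th powers of the relations on the phases -/

/-- At a zero of 𝓑_{m+2}, the next B-entry is a multiple of 𝓐_{m+2}. Eliminating 𝓐_{m+1} by means of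
𝓑_{m+2} = 0 leaves 𝓑_{m+1} times a determinant: a relation between the B-entries of the levels above
and below. -/
theorem avgB_mul_of_zero (hA : IsAmplitudes M A) {m : ℕ} (hm : m + 1 < n) (l : Fin (m + 1)) :
    M.avgT (m + 3) (eps N * A.R (m + 2) (l + 1) ^ N) 0 1 * A.r (m + 2) ^ N =
      -A.r (m + 3) ^ N * M.avgT (m + 1) (eps N * A.R (m + 2) (l + 1) ^ N) 0 1 *
        (avgL N (M.site (m + 2)) (eps N * A.R (m + 2) (l + 1) ^ N)).det := by
  have h0 := hA.avgB_eq_zero (m := m + 1) (by omega) l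
  rw [hA.avgB_succ_of_zero (m := m + 1) (by omega), M.avgT_succ_00 (m + 1)]
  rw [M.avgT_succ_01 (m + 1)] at h0
  have he := eps_mul_eps N
  rw [← hA.site_r_pow (m := m + 1) (by omega), Matrix.det_fin_two]
  simp only [avgL, Matrix.of_apply, Matrix.cons_val', Matrix.cons_val_zero,
      Matrix.cons_val_one, Matrix.cons_val_fin_one]
  generalize A.R (m + 2) (l + 1) ^ N = Z at *
  generalize M.avgT (m + 1) (eps N * Z) 0 0 = a' at *
  generalize M.avgT (m + 1) (eps N * Z) 0 1 = b' at *
  generalize M.site (m + 2) = S at *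
  linear_combination A.r (m + 3) ^ N * (1 - eps N * S.kap ^ N * (eps N * Z)) * h0 +
    A.r (m + 3) ^ N * Z * (S.a ^ N - S.b ^ N) * ((1 - eps N * S.kap ^ N * (eps N * Z)) * a' +
      b' * (S.c ^ N - S.d ^ N)) * he

theorem bulk_identity (hA : IsAmplitudes M A) (hg : IsGeneric M A) {m : ℕ} (hm : m + 1 < n)
    (l : Fin (m + 1)) :
    (-1) ^ (m + 1) * A.R (m + 3) 0 ^ N *
        (∏ k : Fin (m + 2), (A.R (m + 2) (l + 1) ^ N - A.R (m + 3) (k + 1) ^ N)) *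
        A.r (m + 2) ^ N =
      A.r (m + 3) ^ N * A.rt (m + 1) ^ N *
        (∏ i : Fin m, (1 - A.R (m + 2) (l + 1) ^ N / A.R (m + 1) (i + 1) ^ N)) *
        ((M.bulk (m + 2)).b ^ N * (1 - xOne M A (m + 2) (l + 1) ^ N) *
          (-A.R (m + 2) (l + 1) ^ N * (M.bulk (m + 2)).c ^ N *
            (1 - xtOne M A (m + 2) (l + 1) ^ N))) := by
  have h1 := avgB_mul_of_zero hA hm l
  rw [hA.avgB_eps_mul (m := m + 2) (by omega), hA.avgB_eps_mul' hg (m := m) (by omega),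
    M.site_of_lt hm, det_avgL (hg.bulk_ne (m + 2) (by omega) (by omega)).1,
    ← one_sub_xOne_pow hg hm, ← one_sub_xtOne_pow hg hm (by omega)] at h1
  refine mul_left_cancel₀ (pow_ne_zero N (hg.R_ne (m + 2) (by omega) (by omega) (l + 1)
    (by omega))) ?_
  rw [pow_succ _ (m + 2), pow_succ _ (m + 1)] at h1
  linear_combination h1

/-- Antisymmetry: Z_l(1 − Z_i/Z_l) = −Z_i(1 − Z_l/Z_i) with Z_i = r_{m+2,i}^N, multiplied over i ≠
l. -/
theorem same_level_pow {n : ℕ} {M : Model N n} (hg : IsGeneric M A) {Ph : Phases n} {m : ℕ}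
    (hm : m + 1 ≤ n) (l : Fin (m + 1))
    (hs : ∀ i j : Fin (m + 1), i ≠ j → xPair A (m + 2) (i + 1) (m + 2) (j + 1) ^ N +
      Ph.Y (m + 2) (i + 1) (m + 2) (j + 1) ^ N = 1) :
    A.R (m + 2) 0 ^ N * (A.R (m + 2) (l + 1) ^ N) ^ (m + 1) *
        (∏ i ∈ univ.erase l, Ph.Y (m + 2) (i + 1) (m + 2) (l + 1)) ^ N =
      (-1) ^ m * A.rt (m + 2) ^ N *
        (∏ i ∈ univ.erase l, Ph.Y (m + 2) (l + 1) (m + 2) (i + 1)) ^ N := by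
  have hcard : (univ.erase l).card = m := by simp
  have hR := fun i : Fin (m + 1) =>
    pow_ne_zero N (hg.R_ne (m + 2) (by omega) (by omega) (i + 1) (by omega))
  have h1 : ∀ i ∈ univ.erase l, A.R (m + 2) (l + 1) ^ N *
      Ph.Y (m + 2) (i + 1) (m + 2) (l + 1) ^ N =
        -1 * A.R (m + 2) (i + 1) ^ N * Ph.Y (m + 2) (l + 1) (m + 2) (i + 1) ^ N := by
    intro i hi
    have hi := ne_of_mem_erase hi
    rw [eq_sub_of_add_eq' (hs i l hi), eq_sub_of_add_eq' (hs l i hi.symm),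
      one_sub_xPair_pow hg (by omega) (by omega) (by omega),
      one_sub_xPair_pow hg (by omega) (by omega) (by omega)]
    have := hR i
    have := hR l
    field_simp
    ring
  have h2 := prod_congr rfl h1
  rw [prod_mul_distrib, prod_mul_distrib, prod_mul_distrib, prod_const, prod_const, hcard,
    prod_pow, prod_pow, prod_pow] at h2
  rw [A.rt_succ, ← mul_prod_erase univ _ (mem_univ l), mul_pow, mul_pow, pow_succ]
  linear_combination (A.R (m + 2) 0 ^ N * A.R (m + 2) (l + 1) ^ N) * h2

/-- The N-th power of the first phase relation with y_{m,l}^N replaced by 1 − x_{m,l}^N. It does not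
mention y_{m,l}, so it shows that defining y_{m,l} by the relation puts the point on the curve. It
is `bulk_identity` with every factor 1 − x^N rewritten as y^N. -/
theorem bulk_rel_pow (hA : IsAmplitudes M A) (hg : IsGeneric M A) {Ph : Phases n} {m : ℕ}
    (hm : m + 1 < n) (l : Fin (m + 1))
    (hs : ∀ i j : Fin (m + 1), i ≠ j → xPair A (m + 2) (i + 1) (m + 2) (j + 1) ^ N +
      Ph.Y (m + 2) (i + 1) (m + 2) (j + 1) ^ N = 1)
    (hn : ∀ k : Fin (m + 2), xPair A (m + 3) (k + 1) (m + 2) (l + 1) ^ N +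
      Ph.Y (m + 3) (k + 1) (m + 2) (l + 1) ^ N = 1)
    (hp : ∀ i : Fin m, xPair A (m + 2) (l + 1) (m + 1) (i + 1) ^ N +
      Ph.Y (m + 2) (l + 1) (m + 1) (i + 1) ^ N = 1)
    (ht : xtOne M A (m + 2) (l + 1) ^ N + Ph.yt (m + 2) (l + 1) ^ N = 1) :
    (A.rt (m + 2) * A.R (m + 3) 0 * A.r (m + 2) *
        (∏ i ∈ univ.erase l, Ph.Y (m + 2) (l + 1) (m + 2) (i + 1)) *
        ∏ k : Fin (m + 2), Ph.Y (m + 3) (k + 1) (m + 2) (l + 1)) ^ N =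
      (A.rt (m + 1) * A.R (m + 2) 0 * A.r (m + 3) * (M.bulk (m + 2)).b * (M.bulk (m + 2)).c *
          Ph.yt (m + 2) (l + 1) *
        (∏ i ∈ univ.erase l, Ph.Y (m + 2) (i + 1) (m + 2) (l + 1)) *
        ∏ i : Fin m, Ph.Y (m + 2) (l + 1) (m + 1) (i + 1)) ^ N *
          (1 - xOne M A (m + 2) (l + 1) ^ N) := by
  have hZ : A.R (m + 2) (l + 1) ^ N ≠ 0 :=
    pow_ne_zero N (hg.R_ne (m + 2) (by omega) (by omega) (l + 1) (by omega))
  have hid := bulk_identity hA hg hm l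
  have h1 := same_level_pow hg hm.le l hs
  have h2 : ∏ k : Fin (m + 2), (A.R (m + 2) (l + 1) ^ N - A.R (m + 3) (k + 1) ^ N) =
      (A.R (m + 2) (l + 1) ^ N) ^ (m + 2) *
        (∏ k : Fin (m + 2), Ph.Y (m + 3) (k + 1) (m + 2) (l + 1)) ^ N := by
    have h3 : ∀ k : Fin (m + 2), A.R (m + 2) (l + 1) ^ N - A.R (m + 3) (k + 1) ^ N =
        A.R (m + 2) (l + 1) ^ N * Ph.Y (m + 3) (k + 1) (m + 2) (l + 1) ^ N := by
      intro k
      rw [eq_sub_of_add_eq' (hn k), one_sub_xPair_pow hg (by omega) (by omega) (by omega)]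
      field_simp
    rw [prod_congr rfl fun k _ => h3 k, prod_mul_distrib, prod_const, card_univ, Fintype.card_fin,
      prod_pow]
  have h4 : ∏ i : Fin m, (1 - A.R (m + 2) (l + 1) ^ N / A.R (m + 1) (i + 1) ^ N) =
      (∏ i : Fin m, Ph.Y (m + 2) (l + 1) (m + 1) (i + 1)) ^ N := by
    rw [← prod_pow]
    refine prod_congr rfl fun i _ => ?_
    rw [eq_sub_of_add_eq' (hp i), xPair, div_pow]
  rw [h2, h4, ← eq_sub_of_add_eq' ht] at hid
  have he : (-1 : ℂ) ^ m * (-1) ^ m = 1 := by rw [← mul_pow]; norm_num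
  simp only [mul_pow _ _ N]
  refine mul_left_cancel₀ (pow_ne_zero (m + 2) hZ) ?_
  rw [pow_succ (-1 : ℂ) m] at hid
  generalize (∏ i : Fin m, Ph.Y (m + 2) (l + 1) (m + 1) (i + 1)) ^ N = P3 at *
  generalize (∏ k : Fin (m + 2), Ph.Y (m + 3) (k + 1) (m + 2) (l + 1)) ^ N = P2 at *
  generalize (∏ i ∈ univ.erase l, Ph.Y (m + 2) (l + 1) (m + 2) (i + 1)) ^ N = P1 at *
  generalize (∏ i ∈ univ.erase l, Ph.Y (m + 2) (i + 1) (m + 2) (l + 1)) ^ N = P0 at *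
  generalize (-1 : ℂ) ^ m = e at *
  generalize A.R (m + 2) (l + 1) ^ N = Z at *
  rw [pow_succ Z (m + 1)] at *
  generalize Z ^ (m + 1) = W at *
  generalize A.R (m + 3) 0 ^ N = R3 at *
  generalize A.R (m + 2) 0 ^ N = R2 at *
  generalize A.r (m + 2) ^ N = r2 at *
  generalize A.r (m + 3) ^ N = r3 at *
  generalize A.rt (m + 2) ^ N = t2 at *
  generalize A.rt (m + 1) ^ N = t1 at *
  generalize Ph.yt (m + 2) (l + 1) ^ N = yt at *
  generalize xOne M A (m + 2) (l + 1) ^ N = x at *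
  linear_combination (-e * W * Z * R3 * r2 * P2) * h1 - R2 * W * P0 * hid -
    (W * Z * P2 * R3 * r2 * t2 * P1) * he

end Nonvanishing

/-! ### Averages at the zeros of the boundary B-entry -/

section BoundaryPoints

variable {N n : ℕ} [NeZero N] {M : Model N n} {A : Amplitudes} {s : Fin (n + 1) → ℂ}

/-- The averaged boundary operator has rank one, so 𝓑_{n+1} = 0 expresses 𝓐_n through 𝓑_n;
substituting this in 𝓑_n 𝓓_{n+1} produces det 𝓣_n. -/
theorem avgD_last (hA : IsAmplitudes M A) (k : Fin n) :
    M.avgT n (eps N * A.R (n + 1) (k + 1) ^ N) 0 1 *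
        M.avgT (n + 1) (eps N * A.R (n + 1) (k + 1) ^ N) 1 1 =
      A.R (n + 1) (k + 1) ^ N * M.a0 ^ N * (M.avgT n (eps N * A.R (n + 1) (k + 1) ^ N)).det := by
  have h0 := hA.avgB_eq_zero le_rfl k
  rw [M.avgT_succ_01] at h0
  rw [M.avgT_succ_11, Matrix.det_fin_two]
  rw [M.site_last] at *
  simp only [zero_pow (NeZero.ne N), mul_pow, omegaPow_pow, mul_one, sub_zero, zero_mul,
    zero_div, zero_sub] at *
  generalize A.R (n + 1) (k + 1) ^ N = Z at *
  have he := eps_mul_eps N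
  generalize M.avgT n (eps N * Z) = T at *
  linear_combination T 1 1 * h0 - (Z * M.a0 ^ N * (T 0 1 * T 1 0 - T 0 0 * T 1 1)) * he

/-- At a zero of 𝓑_{n+1} the entry 𝓐_{n+1} vanishes as well, since the two differ by the factor
−εza_0^N. The trace that defines the s_j therefore reduces to 𝓓_{n+1}. -/
theorem prod_one_sub_div (hA : IsAmplitudes M A)
    (hs : ∀ lam : ℂ, ∏ j, (1 - (-1) ^ N * (lam ^ N / s j ^ N)) =
      M.avgT (n + 1) (lam ^ N) 0 0 + M.avgT (n + 1) (lam ^ N) 1 1)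
    (ha : M.a0 ≠ 0) (k : Fin n) (hR : A.R (n + 1) (k + 1) ≠ 0) :
    M.avgT n (eps N * A.R (n + 1) (k + 1) ^ N) 0 1 *
        ∏ j, (1 - A.R (n + 1) (k + 1) ^ N / s j ^ N) =
      A.R (n + 1) (k + 1) ^ N * M.a0 ^ N * (M.avgT n (eps N * A.R (n + 1) (k + 1) ^ N)).det := by
  -- With λ = −r_{n+1,k} one has λ^N = ε r_{n+1,k}^N, and the two signs ε cancel in the product.
  have h1 := hs (-A.R (n + 1) (k + 1))
  have h2 : (-A.R (n + 1) (k + 1)) ^ N = eps N * A.R (n + 1) (k + 1) ^ N := neg_pow _ _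
  have h3 : ∀ j, 1 - (-1) ^ N * (eps N * A.R (n + 1) (k + 1) ^ N / s j ^ N) =
      1 - A.R (n + 1) (k + 1) ^ N / s j ^ N := by
    intro j
    have := eps_mul_eps N
    change 1 - eps N * _ = _
    linear_combination (-(A.R (n + 1) (k + 1) ^ N / s j ^ N)) * this
  have h4 : M.avgT (n + 1) (eps N * A.R (n + 1) (k + 1) ^ N) 0 0 = 0 := by
    have h0 := hA.avgB_eq_zero le_rfl k
    rw [M.avgT_succ_01] at h0
    rw [M.avgT_succ_00]
    rw [M.site_last] at *
    simp only [zero_pow (NeZero.ne N), mul_pow, omegaPow_pow, mul_one, sub_zero, zero_mul,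
      zero_div, zero_sub, mul_zero] at *
    have hZ : A.R (n + 1) (k + 1) ^ N * M.a0 ^ N ≠ 0 :=
      mul_ne_zero (pow_ne_zero _ hR) (pow_ne_zero _ ha)
    refine mul_left_cancel₀ hZ ?_
    rw [mul_zero]
    generalize A.R (n + 1) (k + 1) ^ N = Z at *
    have he := eps_mul_eps N
    generalize M.avgT n (eps N * Z) = T at *
    linear_combination -h0 - (Z * M.a0 ^ N * (T 0 0 + T 0 1 * M.cEnd ^ N)) * he
  rw [h2, prod_congr rfl fun j _ => h3 j, h4, zero_add] at h1
  rw [h1, avgD_last hA]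

theorem one_sub_xB_pow (hg : IsGeneric M A) (l k : Fin n) :
    -A.R (n + 1) (k + 1) ^ N * (M.bulk (l + 1)).a ^ N * (M.bulk (l + 1)).kap ^ N *
        (1 - xB M A l k ^ N) =
      (M.bulk (l + 1)).b ^ N - A.R (n + 1) (k + 1) ^ N * (M.bulk (l + 1)).a ^ N *
        (M.bulk (l + 1)).kap ^ N := by
  obtain ⟨h1, h2, _⟩ := hg.bulk_ne (l + 1) (by omega) (by omega)
  have := pow_ne_zero N h1
  have := pow_ne_zero N h2
  have := pow_ne_zero N (hg.R_ne (n + 1) (by omega) le_rfl (k + 1) (by omega))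
  rw [xB, div_pow, mul_pow, mul_pow]
  field_simp
  ring

theorem one_sub_xtB_pow (hg : IsGeneric M A) (l k : Fin n) :
    (M.bulk (l + 1)).d ^ N / (M.bulk (l + 1)).kap ^ N * (1 - xtB M A l k ^ N) =
      (M.bulk (l + 1)).d ^ N / (M.bulk (l + 1)).kap ^ N -
        A.R (n + 1) (k + 1) ^ N * (M.bulk (l + 1)).c ^ N := by
  obtain ⟨h1, _, _, _, h2⟩ := hg.bulk_ne (l + 1) (by omega) (by omega)
  have := pow_ne_zero N h1
  have := pow_ne_zero N h2
  rw [xtB, div_pow, mul_pow, mul_pow]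
  field_simp

theorem onFermat_B (hg : IsGeneric M A) (l k : Fin n) {y : ℂ} (h : xB M A l k ^ N + y ^ N = 1) :
    OnFermat N (xB M A l k) y := by
  refine OnFermat.of_pow h fun h0 => ?_
  have h1 := one_sub_xB_pow hg l k
  rw [h0, sub_self, mul_zero] at h1
  exact (hg.det_factors_ne (p := n + 1) (q := k + 1) le_rfl (by omega) (by omega) l.2).1 h1.symm

theorem onFermat_tilde_B (hg : IsGeneric M A) (l k : Fin n) {y : ℂ}
    (h : xtB M A l k ^ N + y ^ N = 1) : OnFermat N (xtB M A l k) y := by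
  refine OnFermat.of_pow h fun h0 => ?_
  have h1 := one_sub_xtB_pow hg l k
  rw [h0, sub_self, mul_zero] at h1
  exact (hg.det_factors_ne (p := n + 1) (q := k + 1) le_rfl (by omega) (by omega) l.2).2 h1.symm

theorem onFermat_BB (hA : IsAmplitudes M A) (hg : IsGeneric M A)
    (hs : ∀ lam : ℂ, ∏ j, (1 - (-1) ^ N * (lam ^ N / s j ^ N)) =
      M.avgT (n + 1) (lam ^ N) 0 0 + M.avgT (n + 1) (lam ^ N) 1 1)
    (j : Fin (n + 1)) (k : Fin n) {y : ℂ} (h : xBB A s j k ^ N + y ^ N = 1) :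
    OnFermat N (xBB A s j k) y := by
  refine OnFermat.of_pow h fun h0 => ?_
  have hR := hg.R_ne (n + 1) (by omega) le_rfl (k + 1) (by omega)
  have h1 := prod_one_sub_div hA hs hg.a0_ne k hR
  rw [xBB, div_pow] at h0
  rw [prod_eq_zero (mem_univ j) (by rw [h0, sub_self]), mul_zero] at h1
  exact mul_ne_zero (mul_ne_zero (pow_ne_zero _ hR) (pow_ne_zero _ hg.a0_ne))
    (hg.det_avgT_ne (p := n + 1) (q := k + 1) le_rfl (by omega) (by omega) le_rfl) h1.symm

end BoundaryPoints

/-! ### Existence and regularity of admissible choices -/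

section Points

variable {N m : ℕ} [NeZero N] {M : Model N (m + 1)} {A : Amplitudes} {Ph : Phases (m + 1)}
  {s : Fin (m + 2) → ℂ}

/-- `prod_one_sub_div` rewritten in y-coordinates: det 𝓣_n is a product over the sites and supplies
the points p^B and p̃^B, 𝓑_n the pairs with level n, and the product over j the points p^BB. The
ratio of pairs in χ_k comes from `same_level_pow`. -/
theorem boundary_rel_pow (hA : IsAmplitudes M A) (hg : IsGeneric M A)
    (hs : ∀ lam : ℂ, ∏ j, (1 - (-1) ^ N * (lam ^ N / s j ^ N)) =
      M.avgT (m + 2) (lam ^ N) 0 0 + M.avgT (m + 2) (lam ^ N) 1 1) (k : Fin (m + 1))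
    (hsame : ∀ i j : Fin (m + 1), i ≠ j → xPair A (m + 2) (i + 1) (m + 2) (j + 1) ^ N +
      Ph.Y (m + 2) (i + 1) (m + 2) (j + 1) ^ N = 1)
    (hY : ∀ i ∈ univ.erase k, Ph.Y (m + 2) (k + 1) (m + 2) (i + 1) ≠ 0)
    (hp : ∀ i : Fin m, xPair A (m + 2) (k + 1) (m + 1) (i + 1) ^ N +
      Ph.Y (m + 2) (k + 1) (m + 1) (i + 1) ^ N = 1)
    (hBB : ∀ j, xBB A s j k ^ N + Ph.yBB j k ^ N = 1)
    (hB : ∀ l, xB M A l k ^ N + Ph.yB l k ^ N = 1)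
    (htB : ∀ l, xtB M A l k ^ N + Ph.ytB l k ^ N = 1) :
    (∏ l : Fin (m + 1),
        (omega N * (M.bulk (l + 1)).a * (M.bulk (l + 1)).d * Ph.yB l k * Ph.ytB l k)) ^ N =
      (chi M A Ph k * ∏ j : Fin (m + 2), Ph.yBB j k) ^ N := by
  have hR := hg.R_ne (m + 2) (by omega) le_rfl (k + 1) (by omega)
  have hZ : A.R (m + 2) (k + 1) ^ N ≠ 0 := pow_ne_zero N hR
  have hid := prod_one_sub_div hA hs hg.a0_ne k hR
  have h1 := same_level_pow hg le_rfl k hsame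
  have hdet : (M.avgT (m + 1) (eps N * A.R (m + 2) (k + 1) ^ N)).det =
      (-A.R (m + 2) (k + 1) ^ N) ^ (m + 1) * (∏ l : Fin (m + 1),
        (omega N * (M.bulk (l + 1)).a * (M.bulk (l + 1)).d * Ph.yB l k * Ph.ytB l k)) ^ N := by
    have h2 : ∀ l : Fin (m + 1),
        (avgL N (M.site (l + 1)) (eps N * A.R (m + 2) (k + 1) ^ N)).det =
          -A.R (m + 2) (k + 1) ^ N * (omega N * (M.bulk (l + 1)).a * (M.bulk (l + 1)).d *
            Ph.yB l k * Ph.ytB l k) ^ N := by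
      intro l
      have hk := (hg.bulk_ne (l + 1) (by omega) (by omega)).1
      have hkN := pow_ne_zero N hk
      rw [M.site_of_lt l.2, det_avgL hk, ← one_sub_xB_pow hg, ← one_sub_xtB_pow hg,
        ← eq_sub_of_add_eq' (hB l), ← eq_sub_of_add_eq' (htB l), mul_pow, mul_pow, mul_pow,
        mul_pow, omega_pow]
      field_simp
    rw [M.det_avgT, prod_congr rfl fun l _ => h2 l, prod_mul_distrib, prod_const, card_univ,
      Fintype.card_fin, prod_pow]
  have h4 : ∏ i : Fin m, (1 - A.R (m + 2) (k + 1) ^ N / A.R (m + 1) (i + 1) ^ N) =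
      (∏ i : Fin m, Ph.Y (m + 2) (k + 1) (m + 1) (i + 1)) ^ N := by
    rw [← prod_pow]
    refine prod_congr rfl fun i _ => ?_
    rw [eq_sub_of_add_eq' (hp i), xPair, div_pow]
  have h5 : ∏ j, (1 - A.R (m + 2) (k + 1) ^ N / s j ^ N) = (∏ j, Ph.yBB j k) ^ N := by
    rw [← prod_pow]
    refine prod_congr rfl fun j _ => ?_
    rw [eq_sub_of_add_eq' (hBB j), xBB, div_pow]
  rw [hA.avgB_eps_mul' hg (m := m) (by omega), h4, h5, hdet, neg_pow _ (m + 1), pow_succ _ m,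
    pow_succ _ m] at hid
  rw [chi, show m + 1 - 1 = m from rfl, prod_Icc_erase_eq_prod_fin, prod_Icc_eq_prod_fin,
    prod_div_distrib]
  have ha := pow_ne_zero N hg.a0_ne
  have h6 := pow_ne_zero N (hg.rt_ne (m := m + 2) (by omega) le_rfl)
  have h7 : (∏ i ∈ univ.erase k, Ph.Y (m + 2) (k + 1) (m + 2) (i + 1)) ^ N ≠ 0 :=
    pow_ne_zero N (prod_ne_zero_iff.2 hY)
  have he : (-1 : ℂ) ^ m * (-1) ^ m = 1 := by rw [← mul_pow]; norm_num
  simp only [mul_pow _ _ N, div_pow]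
  have hW : (A.R (m + 2) (k + 1) ^ N) ^ m ≠ 0 := pow_ne_zero _ hZ
  rw [pow_succ _ m] at h1
  generalize (∏ l : Fin (m + 1), (omega N * (M.bulk (l + 1)).a * (M.bulk (l + 1)).d *
    Ph.yB l k * Ph.ytB l k)) ^ N = X at *
  generalize (∏ i : Fin m, Ph.Y (m + 2) (k + 1) (m + 1) (i + 1)) ^ N = P3 at *
  generalize (∏ i ∈ univ.erase k, Ph.Y (m + 2) (k + 1) (m + 2) (i + 1)) ^ N = P1 at *
  generalize (∏ i ∈ univ.erase k, Ph.Y (m + 2) (i + 1) (m + 2) (k + 1)) ^ N = P0 at *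
  generalize (∏ j, Ph.yBB j k) ^ N = P2 at *
  generalize (-1 : ℂ) ^ m = e at *
  generalize A.R (m + 2) (k + 1) ^ N = Z at *
  generalize Z ^ m = W at *
  generalize A.R (m + 2) 0 ^ N = R2 at *
  generalize A.rt (m + 2) ^ N = t2 at *
  generalize A.rt (m + 1) ^ N = t1 at *
  generalize M.a0 ^ N = a at *
  field_simp
  refine mul_left_cancel₀ (mul_ne_zero hZ (mul_ne_zero hW hZ)) ?_
  linear_combination (Z * W * R2 * P0) * hid - (Z * a * e * W * X * Z) * h1 -
    (Z * a * W * Z * X * t2 * P1) * he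

/-- The solution `y_{m,l}` of the first family of relations on the phases. -/
def yBulk {n : ℕ} (M : Model N n) (A : Amplitudes) (Ph : Phases n) (p l : ℕ) : ℂ :=
  A.rt p * A.R (p + 1) 0 * A.r p /
      (A.rt (p - 1) * A.R p 0 * A.r (p + 1) * (M.bulk p).b * (M.bulk p).c * Ph.yt p l) *
    (∏ i ∈ (Icc 1 (p - 1)).erase l, Ph.Y p l p i / Ph.Y p i p l) *
    ((∏ k ∈ Icc 1 p, Ph.Y (p + 1) k p l) / ∏ i ∈ Icc 1 (p - 2), Ph.Y p l (p - 1) i)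

omit [NeZero N] in
theorem yBulk_eq {n : ℕ} (M : Model N n) (A : Amplitudes) (Ph : Phases n) (m : ℕ)
    (l : Fin (m + 1)) : yBulk M A Ph (m + 2) (l + 1) =
      (A.rt (m + 2) * A.R (m + 3) 0 * A.r (m + 2) *
        (∏ i ∈ univ.erase l, Ph.Y (m + 2) (l + 1) (m + 2) (i + 1)) *
        ∏ k : Fin (m + 2), Ph.Y (m + 3) (k + 1) (m + 2) (l + 1)) /
      (A.rt (m + 1) * A.R (m + 2) 0 * A.r (m + 3) * (M.bulk (m + 2)).b * (M.bulk (m + 2)).c *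
          Ph.yt (m + 2) (l + 1) *
        (∏ i ∈ univ.erase l, Ph.Y (m + 2) (i + 1) (m + 2) (l + 1)) *
        ∏ i : Fin m, Ph.Y (m + 2) (l + 1) (m + 1) (i + 1)) := by
  rw [yBulk, show m + 2 - 1 = m + 1 from rfl, show m + 2 - 2 = m from rfl,
    prod_Icc_erase_eq_prod_fin, prod_Icc_eq_prod_fin, prod_Icc_eq_prod_fin, prod_div_distrib]
  simp only [div_eq_mul_inv, mul_inv]
  ring

omit [NeZero N] in
theorem bulk_rel_eq {n : ℕ} (M : Model N n) (A : Amplitudes) (Ph : Phases n) (p l : ℕ) :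
    A.rt p * A.R (p + 1) 0 * A.r p /
        (A.rt (p - 1) * A.R p 0 * A.r (p + 1) * (M.bulk p).b * (M.bulk p).c *
          Ph.y p l * Ph.yt p l) *
      (∏ i ∈ (Finset.Icc 1 (p - 1)).erase l, Ph.Y p l p i / Ph.Y p i p l) *
      ((∏ k ∈ Finset.Icc 1 p, Ph.Y (p + 1) k p l) /
        ∏ i ∈ Finset.Icc 1 (p - 2), Ph.Y p l (p - 1) i) = yBulk M A Ph p l / Ph.y p l := by
  rw [yBulk]
  simp only [div_eq_mul_inv, mul_inv]
  ring

theorem onFermat_same {n : ℕ} {M : Model N n} (hg : IsGeneric M A) {p : ℕ} (hp : p ≤ n)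
    {i j : Fin p} (hij : i ≠ j) {y : ℂ}
    (h : xPair A (p + 1) (i + 1) (p + 1) (j + 1) ^ N + y ^ N = 1) :
    OnFermat N (xPair A (p + 1) (i + 1) (p + 1) (j + 1)) y :=
  OnFermat.of_pow h (xPair_pow_ne_one (hg.R_ne (p + 1) (by omega) (by omega) _ (by omega))
    (hg.simple (p + 1) (by omega) (by omega) _ _ (by omega) (by omega) (by omega) (by omega)
      (by rw [Ne, Fin.ext_iff] at hij; omega)))

theorem onFermat_next {n : ℕ} {M : Model N n} (hA : IsAmplitudes M A) (hg : IsGeneric M A) {p : ℕ}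
    (hp : p < n) (k : Fin (p + 1)) (l : Fin p) {y : ℂ}
    (h : xPair A (p + 2) (k + 1) (p + 1) (l + 1) ^ N + y ^ N = 1) :
    OnFermat N (xPair A (p + 2) (k + 1) (p + 1) (l + 1)) y :=
  OnFermat.of_pow h (xPair_pow_ne_one (hg.R_ne (p + 1) (by omega) (by omega) _ (by omega))
    (hg.R_pow_ne_next hA hp k l))

theorem regular_of_isPhases {n : ℕ} [NeZero n] {M : Model N n} {Ph : Phases n}
    {s : Fin (n + 1) → ℂ} (hA : IsAmplitudes M A) (hg : IsGeneric M A)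
    (hP : IsPhases M A s Ph) : Regular M A Ph := by
  have hbulk := fun q (hq : q < n) => hg.bulk_ne (q + 1) (by omega) (by omega)
  have hsame : ∀ q, q ≤ n → ∀ i j : Fin q, i ≠ j →
      OnFermat N (xPair A (q + 1) (i + 1) (q + 1) (j + 1))
        (Ph.Y (q + 1) (i + 1) (q + 1) (j + 1)) := fun q hq i j hij =>
    onFermat_same hg hq hij (hP.same_level (q + 1) (by have := i.2; omega) (by omega) _ _ (by omega) (by omega)
      (by omega) (by omega) (by rw [Ne, Fin.ext_iff] at hij; omega))
  have hnext : ∀ q, q < n → ∀ (k : Fin (q + 1)) (l : Fin q),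
      OnFermat N (xPair A (q + 2) (k + 1) (q + 1) (l + 1))
        (Ph.Y (q + 2) (k + 1) (q + 1) (l + 1)) := fun q hq k l =>
    onFermat_next hA hg hq k l (hP.next_level (q + 1) (by have := l.2; omega) (by omega) _ _ (by omega)
      (by omega) (by omega) (by omega))
  have hone : ∀ q, q < n → ∀ l : Fin q,
      OnFermat N (xOne M A (q + 1) (l + 1)) (Ph.y (q + 1) (l + 1)) := fun q hq l =>
    onFermat_one hg hq l (hP.one (q + 1) (by have := l.2; omega) (by omega) _ (by omega) (by omega))
  have htone : ∀ q, q < n → ∀ l : Fin q,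
      OnFermat N (xtOne M A (q + 1) (l + 1)) (Ph.yt (q + 1) (l + 1)) := fun q hq l =>
    onFermat_tilde_one hg hq l (hP.tilde_one (q + 1) (by have := l.2; omega) (by omega) _ (by omega) (by omega))
  refine
    { kap_ne := fun q hq => (hbulk q hq).1
      a_ne := fun q hq => (hbulk q hq).2.1
      b_ne := fun q hq => (hbulk q hq).2.2.1
      c_ne := fun q hq => (hbulk q hq).2.2.2.1
      d_ne := fun q hq => (hbulk q hq).2.2.2.2
      r_pow := fun q hq => hA.r_pow (q + 1) (by omega) (by omega)
      R_one := hA.R_one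
      r_ne := fun q hq => hg.r_ne' hA hq
      R_ne := fun q hq l hl => hg.R_ne (q + 1) (by omega) (by omega) l (by omega)
      same := hsame
      next := hnext
      one := hone
      tilde_one := htone
      rel := ?_
      zero := fun q hq => ?_
      tilde := fun q hq => hA.onFermat_tilde hg hq
      zero_last := fun q hq => ?_
      r_last := hA.r_last
      rt_last := hA.rt_last }
  · intro q hq l
    obtain ⟨p, rfl⟩ : ∃ p, q = p + 1 := ⟨q - 1, by have := l.2; omega⟩
    have h1 := hP.bulk_rel (p + 2) (by omega) (by omega) (l + 1) (by omega) (by omega)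
    have hy := (hone (p + 1) hq l).ne
    obtain ⟨_, _, hb, hc, _⟩ := hbulk (p + 1) hq
    have p1 := hg.rt_ne (m := p + 1) (by omega) (by omega)
    have p2 := hg.R_ne (p + 2) (by omega) (by omega) 0 (by omega)
    have p3 := hg.r_ne' hA (m := p + 2) (by omega)
    have p4 := (htone (p + 1) hq l).ne
    have p5 : ∏ i ∈ univ.erase l, Ph.Y (p + 2) (i + 1) (p + 2) (l + 1) ≠ 0 :=
      prod_ne_zero_iff.2 fun i hi => (hsame (p + 1) (by omega) i l (ne_of_mem_erase hi)).ne
    have p6 : ∏ i : Fin p, Ph.Y (p + 2) (l + 1) (p + 1) (i + 1) ≠ 0 :=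
      prod_ne_zero_iff.2 fun i _ => (hnext p (by omega) l i).ne
    rw [bulk_rel_eq, div_eq_one_iff_eq hy, yBulk_eq, div_eq_iff (by
      simp only [ne_eq, mul_eq_zero, not_or]
      exact ⟨⟨⟨⟨⟨⟨⟨p1, p2⟩, p3⟩, hb⟩, hc⟩, p4⟩, p5⟩, p6⟩)] at h1
    rw [Nat.add_sub_cancel, prod_Icc_eq_prod_fin]
    rw [h1]
    ring
  · have := hA.onFermat_zero hg (m := q) hq.le
    rwa [M.site_of_lt hq] at this
  · subst hq
    have h1 := hA.onFermat_zero hg (m := q) le_rfl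
    rw [M.site_last, hA.r_last] at h1
    -- The parameter a of the boundary site carries the phase ω^{γ_{n+1} − γ_0}, absent from
    -- p_{n+1,0}; its N-th power is 1.
    refine ⟨?_, h1.ne⟩
    rw [← h1.eq]
    congr 1
    simp only [div_pow, mul_pow, omegaPow_pow, mul_one]

theorem boundaryCurves_of_isPhases (hA : IsAmplitudes M A) (hg : IsGeneric M A)
    (hs_prod : ∏ j, (s j)⁻¹ =
      (∏ l ∈ Icc 1 (m + 1), (M.bulk l).a * (M.bulk l).c) * (M.a0 * M.cEnd))
    (hs : ∀ lam : ℂ, ∏ j, (1 - (-1) ^ N * (lam ^ N / s j ^ N)) =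
      M.avgT (m + 2) (lam ^ N) 0 0 + M.avgT (m + 2) (lam ^ N) 1 1)
    (hP : IsPhases M A s Ph) : BoundaryCurves M A s Ph where
  s_ne j := by
    have h1 : ∏ j, (s j)⁻¹ ≠ 0 := by
      rw [hs_prod]
      refine mul_ne_zero (prod_ne_zero_iff.2 fun l hl => ?_) (mul_ne_zero hg.a0_ne hg.cEnd_ne)
      rw [mem_Icc] at hl
      obtain ⟨_, h2, _, h3, _⟩ := hg.bulk_ne l hl.1 hl.2
      exact mul_ne_zero h2 h3
    exact fun h0 => prod_ne_zero_iff.1 h1 j (mem_univ j) (by rw [h0, inv_zero])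
  BB j k := onFermat_BB hA hg hs j k (hP.BB j k)
  B l k := onFermat_B hg l k (hP.B l k)
  tilde_B l k := onFermat_tilde_B hg l k (hP.tilde_B l k)
  rel := hP.boundary_rel

/-- Arbitrary N-th roots are taken for all y-coordinates but the y_{m,l}, which are defined by the
first family of relations. The second family then holds up to N-th roots of unity c_k, and
multiplying y^B_{1,k} by c_k repairs it without leaving the curve. -/
theorem exists_isPhases (hA : IsAmplitudes M A) (hg : IsGeneric M A)
    (hs : ∀ lam : ℂ, ∏ j, (1 - (-1) ^ N * (lam ^ N / s j ^ N)) =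
      M.avgT (m + 2) (lam ^ N) 0 0 + M.avgT (m + 2) (lam ^ N) 1 1) :
    ∃ Ph : Phases (m + 1), IsPhases M A s Ph := by
  have hroot : ∀ x : ℂ, ∃ y : ℂ, x ^ N + y ^ N = 1 := fun x => by
    obtain ⟨y, hy⟩ := IsAlgClosed.exists_pow_nat_eq (1 - x ^ N) (NeZero.pos N)
    exact ⟨y, by rw [hy, add_sub_cancel]⟩
  choose f hf using hroot
  let P0 : Phases (m + 1) :=
    { Y := fun p i q j => f (xPair A p i q j)
      y := fun _ _ => 0
      yt := fun p l => f (xtOne M A p l)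
      yBB := fun j k => f (xBB A s j k)
      yB := fun l k => f (xB M A l k)
      ytB := fun l k => f (xtB M A l k) }
  let c : Fin (m + 1) → ℂ := fun k => (chi M A P0 k * ∏ j : Fin (m + 2), P0.yBB j k) /
    ∏ l : Fin (m + 1),
      (omega N * (M.bulk (l + 1)).a * (M.bulk (l + 1)).d * P0.yB l k * P0.ytB l k)
  have hprod : ∀ k, ∏ l : Fin (m + 1),
      (omega N * (M.bulk (l + 1)).a * (M.bulk (l + 1)).d * P0.yB l k * P0.ytB l k) ≠ 0 := by
    intro k
    refine prod_ne_zero_iff.2 fun l _ => ?_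
    obtain ⟨_, h1, _, _, h2⟩ := hg.bulk_ne (l + 1) (by omega) (by omega)
    exact mul_ne_zero (mul_ne_zero (mul_ne_zero (mul_ne_zero omega_ne_zero h1) h2)
      (onFermat_B hg l k (hf _)).ne) (onFermat_tilde_B hg l k (hf _)).ne
  have hc : ∀ k, c k ^ N = 1 := by
    intro k
    have h1 := boundary_rel_pow (Ph := P0) hA hg hs k (fun i j _ => hf _)
      (fun i hi => (onFermat_same hg le_rfl (ne_of_mem_erase hi).symm (hf _)).ne)
      (fun i => hf _) (fun j => hf _) (fun l => hf _) (fun l => hf _)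
    rw [div_pow, ← h1, div_self (pow_ne_zero _ (hprod k))]
  refine ⟨{ P0 with
    y := yBulk M A P0
    yB := fun l k => P0.yB l k * if l = 0 then c k else 1 }, ?_⟩
  have hy : ∀ p, 2 ≤ p → p ≤ m + 1 → ∀ l, 1 ≤ l → l < p →
      xOne M A p l ^ N + yBulk M A P0 p l ^ N = 1 := by
    intro p hp hp' l hl hl'
    obtain ⟨q, rfl⟩ : ∃ q, p = q + 2 := ⟨p - 2, by omega⟩
    obtain ⟨l, rfl⟩ : ∃ j, l = j + 1 := ⟨l - 1, by omega⟩
    have h1 := bulk_rel_pow (Ph := P0) hA hg (m := q) (by omega) (⟨l, by omega⟩ : Fin (q + 1))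
      (fun i j _ => hf _) (fun k => hf _) (fun i => hf _) (hf _)
    have h2 := yBulk_eq M A P0 q ⟨l, by omega⟩
    simp only at h1 h2
    rw [h2, div_pow, h1, mul_div_cancel_left₀, add_sub_cancel]
    obtain ⟨_, _, hb, hc, _⟩ := hg.bulk_ne (q + 2) (by omega) (by omega)
    have p1 := hg.rt_ne (m := q + 1) (by omega) (by omega)
    have p2 := hg.R_ne (q + 2) (by omega) (by omega) 0 (by omega)
    have p3 := hg.r_ne' hA (m := q + 2) (by omega)
    have p4 := (onFermat_tilde_one hg (m := q + 1) (by omega) ⟨l, by omega⟩ (hf _)).ne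
    have p5 : ∏ i ∈ univ.erase (⟨l, by omega⟩ : Fin (q + 1)),
        P0.Y (q + 2) (i + 1) (q + 2) (l + 1) ≠ 0 :=
      prod_ne_zero_iff.2 fun i hi =>
        (onFermat_same hg (p := q + 1) (by omega) (ne_of_mem_erase hi) (hf _)).ne
    have p6 : ∏ i : Fin q, P0.Y (q + 2) (l + 1) (q + 1) (i + 1) ≠ 0 :=
      prod_ne_zero_iff.2 fun i _ =>
        (onFermat_next hA hg (p := q) (by omega) ⟨l, by omega⟩ i (hf _)).ne
    exact pow_ne_zero N (mul_ne_zero (mul_ne_zero (mul_ne_zero (mul_ne_zero (mul_ne_zero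
      (mul_ne_zero (mul_ne_zero p1 p2) p3) hb) hc) p4) p5) p6)
  refine
    { same_level := fun p _ _ i j _ _ _ _ _ => hf _
      next_level := fun p _ _ k l _ _ _ _ => hf _
      one := hy
      tilde_one := fun p _ _ l _ _ => hf _
      bulk_rel := fun p hp hp' l hl hl' => ?_
      BB := fun j k => hf _
      B := fun l k => ?_
      tilde_B := fun l k => hf _
      boundary_rel := fun k => ?_ }
  · rw [bulk_rel_eq]
    refine div_self ?_
    obtain ⟨q, rfl⟩ : ∃ q, p = q + 1 := ⟨p - 1, by omega⟩
    obtain ⟨l, rfl⟩ : ∃ j, l = j + 1 := ⟨l - 1, by omega⟩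
    exact (onFermat_one hg (m := q) (by omega) ⟨l, by omega⟩
      (hy (q + 1) hp hp' (l + 1) hl hl')).ne
  · have h1 : (if l = 0 then c k else 1) ^ N = 1 := by
      split
      · exact hc k
      · exact one_pow N
    change _ + (P0.yB l k * _) ^ N = 1
    rw [mul_pow, h1, mul_one]
    exact hf _
  · change ∏ l : Fin (m + 1), (omega N * (M.bulk (l + 1)).a * (M.bulk (l + 1)).d *
      (P0.yB l k * if l = 0 then c k else 1) * P0.ytB l k) =
        chi M A P0 k * ∏ j : Fin (m + 2), P0.yBB j k
    have h1 : ∀ l : Fin (m + 1), omega N * (M.bulk (l + 1)).a * (M.bulk (l + 1)).d *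
        (P0.yB l k * if l = 0 then c k else 1) * P0.ytB l k =
          (omega N * (M.bulk (l + 1)).a * (M.bulk (l + 1)).d * P0.yB l k * P0.ytB l k) *
            if l = 0 then c k else 1 := fun l => by ring
    rw [prod_congr rfl fun l _ => h1 l, prod_mul_distrib, prod_ite_eq' univ 0, if_pos (mem_univ _)]
    exact mul_div_cancel₀ _ (hprod k)

end Points

end

end BBS

/-! ### The theorem -/

theorem mainTheorem2 (N n : ℕ) [NeZero N] [NeZero n] (hN : 2 ≤ N)
    (M : BBS.Model N n) (A : BBS.Amplitudes)
    (hA : BBS.IsAmplitudes M A) (hgen : BBS.IsGeneric M A)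
    (s : Fin (n + 1) → ℂ)
    (hs_prod : ∏ j, (s j)⁻¹ =
      (∏ m ∈ Finset.Icc 1 n, (M.bulk m).a * (M.bulk m).c) * (M.a0 * M.cEnd))
    (hs_avg : ∀ lam : ℂ, ∏ j, (1 - (-1) ^ N * (lam ^ N / s j ^ N)) =
      M.avgT (n + 1) (lam ^ N) 0 0 + M.avgT (n + 1) (lam ^ N) 1 1) :
    (∃ Ph : BBS.Phases n, BBS.IsPhases M A s Ph) ∧
    ∀ Ph : BBS.Phases n, BBS.IsPhases M A s Ph →
      ∀ σ : Fin (n + 1) → ZMod N, ∑ j, σ j = M.gEnd - M.g0 →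
        (∀ (k : Fin n) (lam : ℂ), BBS.DeltaMinus M A Ph k lam = 0) ∧
        (∀ (k : Fin n) (g : ZMod N),
          BBS.eigB s σ (BBS.zeroB N A k g) * BBS.qTilde M A Ph s σ k g =
            BBS.DeltaPlus M A Ph k (BBS.zeroB N A k g) * BBS.qTilde M A Ph s σ k (g + 1) +
            BBS.DeltaMinus M A Ph k (BBS.omega N * BBS.zeroB N A k g) *
              BBS.qTilde M A Ph s σ k (g - 1)) ∧
        ∀ lam : ℂ, (M.tB lam).HasEigenvector (BBS.eigB s σ lam) (BBS.Phi M A Ph s σ) := by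
  obtain ⟨m, rfl⟩ := Nat.exists_eq_succ_of_ne_zero (NeZero.ne n)
  refine ⟨BBS.exists_isPhases hA hgen hs_avg, fun Ph hP σ hσ => ?_⟩
  have h := BBS.regular_of_isPhases hA hgen hP
  have hb := BBS.boundaryCurves_of_isPhases hA hgen hs_prod hs_avg hP
  refine ⟨BBS.deltaMinus_eq_zero, fun k g => ?_, fun lam => ?_⟩
  · rw [BBS.deltaMinus_eq_zero, zero_mul, add_zero]
    exact BBS.baxter_equation h hgen.a0_ne hb σ k g
  · rw [Module.End.hasEigenvector_iff, Module.End.mem_eigenspace_iff]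
    exact ⟨BBS.tB_Phi h hgen.a0_ne hb hs_prod hσ lam, BBS.Phi_ne h hgen.a0_ne hb σ⟩
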